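/- Let $(M,g)$ be a smooth Riemannian manifold of dimension $n\ge 2$, and let $\gamma=(\gamma(r))_{r\in\mathbb R}$ be an admissible family: a family of $(1,1)$-tensor fields on $M$, smooth in $(r,x)\in\mathbb R\times M$, such that each $\gamma(r)$ is self-adjoint with respect to $g$, $\gamma(0)=\mathrm{Id}$, and for some $\delta>0$ all $\gamma(r)$ with $|r|<\delta$ are nonsingular. Put $\dot\gamma(0)=\frac{d}{dr}\big|_{r=0}\gamma(r)$. Let $\widetilde M=\mathbb R_{>0}\times(-\delta,\delta)\times M$, with points $(t,r,x)$, carry the Lorentzian metric $$\widetilde g=d(rt)\otimes dt+dt\otimes d(rt)+t^2\,g(\gamma(r)\,\cdot\,,\,\cdot\,),$$ with Levi-Civita connection $\widetilde\nabla$. For $u\in C^\infty(M)$ let $\Psi^u\colon M\to\widetilde M$, $\Psi^u(x)=(e^{u(x)},0,x)$, and $\xi^u=e^u\,\partial_t|_{\Psi^u}$. The tractor bundle associated with $(\Psi^u,\xi^u)$ is the quadruple $(\mathcal T,\mathcal T^1,\mathbf h,\nabla)$ consisting of $\mathcal T=(\Psi^u)^*(T\widetilde M)$, the line subbundle $\mathcal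 T^1=\mathrm{Span}(\xi^u)$ oriented by $\xi^u$, the bundle metric $\mathbf h$ induced by $\widetilde g$, and the connection $\nabla$ on $\mathcal T$ induced by $\widetilde\nabla$. A quadruple $(\mathcal T,\mathcal T^1,\mathbf h,\nabla)$ over $M$ is called the normal conformal tractor bundle of $(M,[g])$ if: (a) $\mathcal T$ is a smooth vector bundle of rank $n+2$ with a bundle metric $\mathbf h$ of Lorentzian signature and an oriented lightlike line subbundle $\mathcal T^1$; (b) $\nabla$ is a tractor connection: a smooth linear connection with $\nabla\mathbf h=0$ such that $\beta\colon TM\to\mathrm{Hom}(\mathcal T^1,(\mathcal T^1)^\perp/\mathcal T^1)$, $\beta(V_x)(\sigma(x))=\nabla_{V_x}\sigma+\mathcal T^1_x$ for local sections $\sigma$ of $\mathcal T^1$, is an isomorphism; (c) for every nonvanishing local section $\sigma$ of $\mathcal T^1$ the metric $\mathbf h^\sigma(V,W)=\mathbf h(\nabla_V\sigma,\nabla_W\sigma)$ is conformal to $g$, that is, equal to $f\,g$ with $f$ a smooth positive function; (d) $\nabla$ is normalized: its curvature $R$ satisfies $R(V,W)\mathcal T^1\subset\mathcal T^1$, and the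 Ricci-type contraction of the curvature induced on $(\mathcal T^1)^\perp/\mathcal T^1$ vanishes, i.e. for every nonvanishing local section $\sigma$ of $\mathcal T^1$, every $W\in T_xM$ and every $z\in(\mathcal T^1_x)^\perp$, the endomorphism $A$ of $T_xM$ determined by $R(V,W)z\equiv\nabla_{A(V)}\sigma \pmod{\mathcal T^1_x}$ for all $V\in T_xM$ has trace zero. (For $n=2$ the same conditions are used, although they then do not determine the connection uniquely.) Then the tractor bundle associated with $(\Psi^u,\xi^u)$ is the normal conformal tractor bundle of $(M,[g])$ if and only if: - for $n=2$: $\mathrm{trace}(\dot\gamma(0))=2K^g$ on $M$, where $K^g$ is the Gauss curvature of $g$; - for $n\ge 3$: $g(\dot\gamma(0)(\cdot),\cdot)=2P^g$ on $M$, where $P^g=\frac1{n-2}\Big(\mathrm{Ric}^g-\frac{S^g}{2(n-1)}\,g\Big)$ is the Schouten tensor, $\mathrm{Ric}^g$ and $S^g$ being the Ricci and scalar curvatures of $g$. -/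

import Mathlib

set_option maxSynthPendingDepth 3

open Bundle Manifold
open scoped ContDiff Manifold Topology

/-! ### Additive and topological structure on the fibres of a pullback bundle -/

section PullbackInstances

variable {B B' : Type*} {E : B → Type*} {f : B' → B}

instance [∀ b, AddCommGroup (E b)] (x : B') : AddCommGroup ((f *ᵖ E) x) :=
  inferInstanceAs (AddCommGroup (E (f x)))

instance [∀ b, AddCommGroup (E b)] [∀ b, TopologicalSpace (E b)]
    [∀ b, IsTopologicalAddGroup (E b)] (x : B') : IsTopologicalAddGroup ((f *ᵖ E) x) :=
  inferInstanceAs (IsTopologicalAddGroup (E (f x)))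

instance {𝕜 : Type*} [NontriviallyNormedField 𝕜] [∀ b, AddCommGroup (E b)]
    [∀ b, TopologicalSpace (E b)] [∀ b, Module 𝕜 (E b)] [∀ b, ContinuousSMul 𝕜 (E b)] (x : B') :
    ContinuousSMul 𝕜 ((f *ᵖ E) x) :=
  inferInstanceAs (ContinuousSMul 𝕜 (E (f x)))

end PullbackInstances

namespace TractorGeometry

noncomputable section

/-! ### Curvature of a linear connection and pullback connections

A linear connection `∇` on a bundle `V` is handled as in Mathlib: it is a function `cov` on sections
with `cov σ x v = (∇_v σ)(x)`. -/

section Connections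

variable {E : Type*} [NormedAddCommGroup E] [NormedSpace ℝ E]
  {H : Type*} [TopologicalSpace H] (I : ModelWithCorners ℝ E H)
  {M : Type*} [TopologicalSpace M] [ChartedSpace H M] [IsManifold I ∞ M]
  (F : Type*) [NormedAddCommGroup F] [NormedSpace ℝ F]
  {V : M → Type*} [TopologicalSpace (TotalSpace F V)]
  [∀ x, AddCommGroup (V x)] [∀ x, Module ℝ (V x)] [∀ x, TopologicalSpace (V x)]
  [FiberBundle F V]

/-- The curvature `R(v, w) s = ∇_X ∇_Y σ - ∇_Y ∇_X σ - ∇_[X,Y] σ` at `x`, where `X`, `Y`, `σ` are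
local smooth extensions of `v`, `w`, `s`. -/
def curvature (cov : (Π x : M, V x) → (Π x : M, TangentSpace I x →L[ℝ] V x))
    (x : M) (v w : TangentSpace I x) (s : V x) : V x :=
  let X : Π y : M, TangentSpace I y := FiberBundle.extend E v
  let Y : Π y : M, TangentSpace I y := FiberBundle.extend E w
  let σ : Π y : M, V y := FiberBundle.extend F s
  cov (fun y ↦ cov σ y (Y y)) x v - cov (fun y ↦ cov σ y (X y)) x w
    - cov σ x (VectorField.mlieBracket I X Y x)

variable {E' : Type*} [NormedAddCommGroup E'] [NormedSpace ℝ E']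
  {H' : Type*} [TopologicalSpace H'] (J : ModelWithCorners ℝ E' H')
  {N : Type*} [TopologicalSpace N] [ChartedSpace H' N]
  {W : N → Type*} [TopologicalSpace (TotalSpace F W)]
  [∀ p, AddCommGroup (W p)] [∀ p, Module ℝ (W p)] [∀ p, TopologicalSpace (W p)]
  [∀ p, IsTopologicalAddGroup (W p)] [∀ p, ContinuousSMul ℝ (W p)]
  [FiberBundle F W] [VectorBundle ℝ F W]

/-- The connection induced on the pullback bundle `f *ᵖ W` by a connection on `W → N`. With the
local frame `(e_k)` of `W` given by the trivialization at `f x`, a section `σ = ∑ σ^k (e_k ∘ f)` has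
`∇_v σ = ∑ dσ^k(v) e_k + ∑ σ^k(x) ∇_{df(v)} e_k`. -/
def pullbackConnection (f : M → N)
    (cov : (Π p : N, W p) → (Π p : N, TangentSpace J p →L[ℝ] W p))
    (σ : Π x : M, (f *ᵖ W) x) (x : M) : TangentSpace I x →L[ℝ] (f *ᵖ W) x :=
  let e := trivializationAt F W (f x)
  let σx : W (f x) := σ x
  let D : TangentSpace I x →L[ℝ] W (f x) :=
    (e.symmL ℝ (f x)) ∘L
        (mvfderiv I (fun y : M ↦ (e (TotalSpace.mk' F (f y) (σ y : W (f y)))).2) x)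
      + (cov (FiberBundle.extend F σx) (f x)) ∘L (mfderiv I J f x)
  D

end Connections

/-! ### Levi-Civita connection of a (pseudo-)Riemannian metric -/

section LeviCivita

variable {E : Type*} [NormedAddCommGroup E] [NormedSpace ℝ E]
  {H : Type*} [TopologicalSpace H] (I : ModelWithCorners ℝ E H)
  {M : Type*} [TopologicalSpace M] [ChartedSpace H M] [IsManifold I ∞ M]
  (G : Π x : M, TangentSpace I x →L[ℝ] TangentSpace I x →L[ℝ] ℝ)

/-- The components `g_ij` of the metric near `p`, as a bilinear form on the model space, with
respect to the coordinate frame of the chart at `p`. -/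
def metricCoord (p q : M) : E →L[ℝ] E →L[ℝ] ℝ :=
  let e := trivializationAt E (TangentSpace I : M → Type _) p
  (ContinuousLinearMap.precomp ℝ (e.symmL ℝ q)) ∘L (G q) ∘L (e.symmL ℝ q)

/-- The derivatives `(u, v, w) ↦ ∂_u (g (v, w))` at `p` of the metric components, in the chart
at `p`. -/
def metricCoordDeriv (p : M) : E →L[ℝ] E →L[ℝ] E →L[ℝ] ℝ :=
  (mvfderiv I (metricCoord I G p) p) ∘L
    ((trivializationAt E (TangentSpace I : M → Type _) p).symmL ℝ p)

/-- Christoffel symbols of the first kind at `p` in the chart at `p`: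
`Γ(u, v; w) = (∂_u g(v, w) + ∂_v g(u, w) - ∂_w g(u, v)) / 2`. -/
def christoffelFirst (p : M) : E →L[ℝ] E →L[ℝ] E →L[ℝ] ℝ :=
  let D : E →L[ℝ] E →L[ℝ] E →L[ℝ] ℝ := metricCoordDeriv I G p
  let D₂ : E →L[ℝ] E →L[ℝ] E →L[ℝ] ℝ := D.flip
  let D₃ : E →L[ℝ] E →L[ℝ] E →L[ℝ] ℝ :=
    (ContinuousLinearMap.flipₗᵢ ℝ E E ℝ).toContinuousLinearEquiv.toContinuousLinearMap ∘L D₂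
  (1 / 2 : ℝ) • (D + D₂ - D₃)

/-- Christoffel symbols of the second kind at `p` in the chart at `p` (the last index raised with
the inverse of the metric). -/
def christoffel (p : M) : E →L[ℝ] E →L[ℝ] E :=
  (ContinuousLinearMap.compL ℝ E (E →L[ℝ] ℝ) E (metricCoord I G p p).inverse) ∘L
    (christoffelFirst I G p)

/-- The Levi-Civita connection of the metric `G`:
`(∇_v Y)^k = dY^k(v) + Γ^k_ij v^i Y^j` at `p`, in the chart at `p`. -/
def leviCivita (Y : Π x : M, TangentSpace I x) (p : M) :
    TangentSpace I p →L[ℝ] TangentSpace I p :=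
  let e := trivializationAt E (TangentSpace I : M → Type _) p
  let Yc : M → E := fun q ↦ (e (TotalSpace.mk' E q (Y q))).2
  (e.symmL ℝ p) ∘L
    (mvfderiv I Yc p + ((christoffel I G p).flip (Yc p)) ∘L (e.continuousLinearMapAt ℝ p))

end LeviCivita

/-! ### Riemannian curvature quantities -/

section RiemannianCurvature

variable {n : ℕ} {M : Type*} [TopologicalSpace M] [ChartedSpace (EuclideanSpace ℝ (Fin n)) M]
  [IsManifold (𝓡 n) ∞ M]

/-- The `i`-th coordinate vector at `x` of the chart at `x`. -/
def coordVec (x : M) (i : Fin n) : TangentSpace (𝓡 n) x :=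
  (EuclideanSpace.single i (1 : ℝ) : EuclideanSpace ℝ (Fin n))

/-- The `i`-th component of a tangent vector at `x` in the basis `coordVec x`. -/
def coordComp (x : M) (v : TangentSpace (𝓡 n) x) (i : Fin n) : ℝ :=
  (show EuclideanSpace ℝ (Fin n) from v) i

variable (g : ContMDiffRiemannianMetric (𝓡 n) ∞ (EuclideanSpace ℝ (Fin n))
    (TangentSpace (𝓡 n) : M → Type _))

/-- The Riemann curvature `R(v, w) z = ∇_v ∇_w z - ∇_w ∇_v z - ∇_[v,w] z` of `g`. -/
def riemann (x : M) (v w z : TangentSpace (𝓡 n) x) : TangentSpace (𝓡 n) x :=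
  curvature (𝓡 n) (EuclideanSpace ℝ (Fin n)) (leviCivita (𝓡 n) g.inner) x v w z

/-- The Ricci tensor `Ric(v, w) = trace (z ↦ R(z, v) w)`. -/
def ricci (x : M) (v w : TangentSpace (𝓡 n) x) : ℝ :=
  ∑ i, coordComp x (riemann g x (coordVec x i) v w) i

/-- The scalar curvature `S = g^ij Ric_ij`. -/
def scalarCurvature (x : M) : ℝ :=
  let gram : Matrix (Fin n) (Fin n) ℝ :=
    Matrix.of fun i j ↦ g.inner x (coordVec x i) (coordVec x j)
  ∑ i, ∑ j, gram⁻¹ i j * ricci g x (coordVec x i) (coordVec x j)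

/-- The Schouten tensor `P = (Ric - S / (2 (n - 1)) g) / (n - 2)`, for `n ≥ 3`. -/
def schouten (x : M) (v w : TangentSpace (𝓡 n) x) : ℝ :=
  1 / ((n : ℝ) - 2) *
    (ricci g x v w - scalarCurvature g x / (2 * ((n : ℝ) - 1)) * g.inner x v w)

/-- The sectional curvature of the plane spanned by `v` and `w`. -/
def sectionalCurvature (x : M) (v w : TangentSpace (𝓡 n) x) : ℝ :=
  g.inner x (riemann g x v w w) v /
    (g.inner x v v * g.inner x w w - g.inner x v w ^ 2)

/-- The Gauss curvature of a surface: the sectional curvature of the tangent plane. -/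
def gaussCurvature (hn : n = 2) (x : M) : ℝ :=
  sectionalCurvature g x (coordVec x (Fin.cast hn.symm 0)) (coordVec x (Fin.cast hn.symm 1))

end RiemannianCurvature

/-! ### Conformal tractor bundles and the normal tractor connection -/

section Tractor

variable {E : Type*} [NormedAddCommGroup E] [NormedSpace ℝ E]
  {H : Type*} [TopologicalSpace H] (I : ModelWithCorners ℝ E H)
  {M : Type*} [TopologicalSpace M] [ChartedSpace H M] [IsManifold I ∞ M]
  (F : Type*) [NormedAddCommGroup F] [NormedSpace ℝ F]
  (V : M → Type*) [TopologicalSpace (TotalSpace F V)]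
  [∀ x, AddCommGroup (V x)] [∀ x, Module ℝ (V x)] [∀ x, TopologicalSpace (V x)]
  [∀ x, IsTopologicalAddGroup (V x)] [∀ x, ContinuousSMul ℝ (V x)]
  [FiberBundle F V] [VectorBundle ℝ F V] [ContMDiffVectorBundle ∞ F V I]

/-- The data `(T¹, h, ∇)` on a vector bundle `V`: a field of lines `line` with a distinguished
half-line `pos` in each of them (the orientation), a field of bilinear forms `metric`, and an
operator `conn` with `conn σ x v = (∇_v σ)(x)`. -/
structure TractorData where
  line : Π x : M, Submodule ℝ (V x)
  pos : Π x : M, Set (V x)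
  metric : Π x : M, V x →L[ℝ] V x →L[ℝ] ℝ
  conn : (Π x : M, V x) → (Π x : M, TangentSpace I x →L[ℝ] V x)

namespace TractorData

variable {I V}
variable (T : TractorData I V)

/-- The orthogonal complement of the line `T¹` at `x`. -/
def perp (x : M) : Submodule ℝ (V x) where
  carrier := {v | ∀ l ∈ T.line x, T.metric x l v = 0}
  add_mem' := fun {a b} ha hb l hl ↦ by rw [map_add, ha l hl, hb l hl, add_zero]
  zero_mem' := fun l _ ↦ map_zero _
  smul_mem' := fun c v hv l hl ↦ by rw [map_smul, hv l hl, smul_zero]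

/-- `s` is, on the set `U`, a smooth section of the line bundle `T¹`. -/
def IsLineSectionOn (s : Π x : M, V x) (U : Set M) : Prop :=
  ContMDiffOn I (I.prod 𝓘(ℝ, F)) ∞ (fun x ↦ TotalSpace.mk' F x (s x)) U ∧ ∀ x ∈ U, s x ∈ T.line x

/-- `(V, T¹, h)` is a (Riemannian) conformal tractor bundle over an `n`-dimensional base: `V` is a
smooth vector bundle of rank `n + 2`, `h` is a smooth bundle metric of Lorentzian signature
`(-, +, …, +)`, and `T¹` is a smooth oriented lightlike line subbundle. -/
structure IsConformalTractorBundle (n : ℕ) : Prop where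
  rank_eq : Module.finrank ℝ F = n + 2
  metric_smooth : ContMDiff I (I.prod 𝓘(ℝ, F →L[ℝ] F →L[ℝ] ℝ)) ∞
    (fun x ↦ TotalSpace.mk' (F →L[ℝ] F →L[ℝ] ℝ) x (T.metric x))
  metric_symm : ∀ (x : M) (v w : V x), T.metric x v w = T.metric x w v
  lorentzian : ∀ x : M, ∃ b : Module.Basis (Fin (n + 2)) ℝ (V x), ∀ i j,
    T.metric x (b i) (b j) = if i = j then (if i = 0 then -1 else 1) else 0
  line_subbundle : ∀ x : M, ∃ U : Set M, IsOpen U ∧ x ∈ U ∧ ∃ s : Π y : M, V y,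
    ContMDiffOn I (I.prod 𝓘(ℝ, F)) ∞ (fun y ↦ TotalSpace.mk' F y (s y)) U ∧
    ∀ y ∈ U, s y ≠ 0 ∧ T.metric y (s y) (s y) = 0 ∧ T.line y = Submodule.span ℝ {s y} ∧
      T.pos y = {v | ∃ c : ℝ, 0 < c ∧ v = c • s y}

/-- `∇` is a tractor connection: a smooth linear connection with `∇h = 0` for which
`β : TM → Hom(T¹, (T¹)^⊥ / T¹)`, `β(v)(σ(x)) = ∇_v σ + T¹`, is (well defined and) an isomorphism.
Here `Hom(T¹, (T¹)^⊥ / T¹)` is the subspace of `Hom(T¹, V / T¹)` of the maps with values in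
`(T¹)^⊥ / T¹`. -/
structure IsTractorConnection : Prop where
  isCovariantDerivative : IsCovariantDerivativeOn F T.conn Set.univ
  smooth : ContMDiffCovariantDerivativeOn F ∞ T.conn Set.univ
  metric_parallel : ∀ (σ τ : Π x : M, V x) (x : M),
    MDifferentiableAt I (I.prod 𝓘(ℝ, F)) (fun y ↦ TotalSpace.mk' F y (σ y)) x →
    MDifferentiableAt I (I.prod 𝓘(ℝ, F)) (fun y ↦ TotalSpace.mk' F y (τ y)) x →
    ∀ v : TangentSpace I x, mvfderiv I (fun y ↦ T.metric y (σ y) (τ y)) x v =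
      T.metric x (T.conn σ x v) (τ x) + T.metric x (σ x) (T.conn τ x v)
  beta_iso : ∃ β : Π x : M, TangentSpace I x →ₗ[ℝ] (T.line x →ₗ[ℝ] V x ⧸ T.line x),
    (∀ (U : Set M) (s : Π y : M, V y), IsOpen U → ∀ hs : T.IsLineSectionOn F s U,
      ∀ (x : M) (hx : x ∈ U) (v : TangentSpace I x),
        β x v ⟨s x, hs.2 x hx⟩ = (T.line x).mkQ (T.conn s x v)) ∧
    ∀ x : M, Function.Injective (β x) ∧
      ∀ φ : T.line x →ₗ[ℝ] V x ⧸ T.line x,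
        φ ∈ LinearMap.range (β x) ↔ ∀ l, φ l ∈ (T.perp x).map (T.line x).mkQ

/-- The metrics `h^s(v, w) = h(∇_v s, ∇_w s)` induced on the base by the nonvanishing local sections
`s` of `T¹` belong to the conformal class of the Riemannian metric `g`. -/
def InducesConformalClass
    (g : Π x : M, TangentSpace I x →L[ℝ] TangentSpace I x →L[ℝ] ℝ) : Prop :=
  ∀ (U : Set M) (s : Π y : M, V y), IsOpen U → T.IsLineSectionOn F s U → (∀ x ∈ U, s x ≠ 0) →
    ∃ f : M → ℝ, ContMDiffOn I 𝓘(ℝ) ∞ f U ∧ ∀ x ∈ U, 0 < f x ∧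
      ∀ v w : TangentSpace I x, T.metric x (T.conn s x v) (T.conn s x w) = f x * g x v w

/-- The normalization conditions on a tractor connection, in terms of its curvature `R`:
* `∇` is torsion free, that is, `R(v, w)` preserves `T¹`;
* the Ricci type contraction of the curvature that `R` then induces on `(T¹)^⊥ / T¹` vanishes. Using
  a nonvanishing local section `s` of `T¹` to identify `TM` with `(T¹)^⊥ / T¹` by
  `v ↦ ∇_v s + T¹`, this says that for `w ∈ T_x M` and `z ∈ (T¹)^⊥` the endomorphism `A` of `T_x M`
  which corresponds to `v ↦ R(v, w) z + T¹` has trace zero. -/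
structure IsNormalConnection : Prop where
  torsion_free : ∀ (x : M) (v w : TangentSpace I x), ∀ l ∈ T.line x,
    curvature I F T.conn x v w l ∈ T.line x
  ricci_free : ∀ (U : Set M) (s : Π y : M, V y), IsOpen U → T.IsLineSectionOn F s U →
    ∀ x ∈ U, s x ≠ 0 → ∀ (w : TangentSpace I x), ∀ z ∈ T.perp x,
      ∃ A : TangentSpace I x →ₗ[ℝ] TangentSpace I x,
        (∀ v, (T.line x).mkQ (curvature I F T.conn x v w z) =
          (T.line x).mkQ (T.conn s x (A v))) ∧
        LinearMap.trace ℝ (TangentSpace I x) A = 0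

end TractorData

end Tractor

/-- `T` is the normal conformal tractor bundle of the Riemannian conformal structure `(M, [g])`:
a conformal tractor bundle with a tractor connection, inducing the conformal class `[g]`, and whose
connection satisfies the normalization conditions. -/
structure IsNormalConformalTractorBundle {n : ℕ} {M : Type*} [TopologicalSpace M]
    [ChartedSpace (EuclideanSpace ℝ (Fin n)) M] [IsManifold (𝓡 n) ∞ M]
    (g : ContMDiffRiemannianMetric (𝓡 n) ∞ (EuclideanSpace ℝ (Fin n))
      (TangentSpace (𝓡 n) : M → Type _))
    (F : Type*) [NormedAddCommGroup F] [NormedSpace ℝ F]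
    {V : M → Type*} [TopologicalSpace (TotalSpace F V)]
    [∀ x, AddCommGroup (V x)] [∀ x, Module ℝ (V x)] [∀ x, TopologicalSpace (V x)]
    [∀ x, IsTopologicalAddGroup (V x)] [∀ x, ContinuousSMul ℝ (V x)]
    [FiberBundle F V] [VectorBundle ℝ F V] [ContMDiffVectorBundle ∞ F V (𝓡 n)]
    (T : TractorData (𝓡 n) V) : Prop where
  bundle : T.IsConformalTractorBundle F n
  connection : T.IsTractorConnection F
  standard : T.InducesConformalClass F g.inner
  normal : T.IsNormalConnection F

/-- The tractor bundle associated with a pair `(Ψ, ξ)`: the pullback `Ψ^*(TN)` of the tangent bundle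
of the Lorentzian manifold `(N, G)`, with the line bundle `Span(ξ)` (oriented by `ξ`), the bundle
metric given by `G` and the connection induced by the Levi-Civita connection of `G`. -/
def associatedTractorBundle
    {E : Type*} [NormedAddCommGroup E] [NormedSpace ℝ E]
    {H : Type*} [TopologicalSpace H] {I : ModelWithCorners ℝ E H}
    {M : Type*} [TopologicalSpace M] [ChartedSpace H M]
    {E' : Type*} [NormedAddCommGroup E'] [NormedSpace ℝ E']
    {H' : Type*} [TopologicalSpace H'] {J : ModelWithCorners ℝ E' H'}
    {N : Type*} [TopologicalSpace N] [ChartedSpace H' N] [IsManifold J ∞ N]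
    (G : Π p : N, TangentSpace J p →L[ℝ] TangentSpace J p →L[ℝ] ℝ)
    (Ψ : C^∞⟮I, M; J, N⟯)
    (ξ : Π x : M, ((Ψ : M → N) *ᵖ (TangentSpace J : N → Type _)) x) :
    TractorData I ((Ψ : M → N) *ᵖ (TangentSpace J : N → Type _)) where
  line x := Submodule.span ℝ {ξ x}
  pos x := {v | ∃ c : ℝ, 0 < c ∧ v = c • ξ x}
  metric x := G (Ψ x)
  conn := pullbackConnection I E' J Ψ (leviCivita J G)

/-! ### The Lorentzian manifold of an admissible family and the immersions `Ψ^u` -/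

section Ambient

variable {n : ℕ} {M : Type*} [TopologicalSpace M] [ChartedSpace (EuclideanSpace ℝ (Fin n)) M]
  [IsManifold (𝓡 n) ∞ M]

/-- `γ` is an admissible family of `(1,1)`-tensor fields on `(M, g)`, with `γ(r)` nonsingular for
`|r| < δ`. Self-adjointness with respect to `g` is the same as with respect to all the metrics in
the conformal class of `g`. -/
structure IsAdmissible
    (g : ContMDiffRiemannianMetric (𝓡 n) ∞ (EuclideanSpace ℝ (Fin n))
      (TangentSpace (𝓡 n) : M → Type _))
    (γ : ℝ → Π x : M, TangentSpace (𝓡 n) x →L[ℝ] TangentSpace (𝓡 n) x) (δ : ℝ) : Prop where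
  smooth : ContMDiff (𝓘(ℝ, ℝ).prod (𝓡 n))
    ((𝓡 n).prod 𝓘(ℝ, EuclideanSpace ℝ (Fin n) →L[ℝ] EuclideanSpace ℝ (Fin n))) ∞
    (fun q : ℝ × M ↦ TotalSpace.mk' (EuclideanSpace ℝ (Fin n) →L[ℝ] EuclideanSpace ℝ (Fin n))
      (E := fun x : M ↦ TangentSpace (𝓡 n) x →L[ℝ] TangentSpace (𝓡 n) x) q.2 (γ q.1 q.2))
  self_adjoint : ∀ (r : ℝ) (x : M) (v w : TangentSpace (𝓡 n) x),
    g.inner x (γ r x v) w = g.inner x v (γ r x w)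
  at_zero : ∀ x : M, γ 0 x = ContinuousLinearMap.id ℝ (TangentSpace (𝓡 n) x)
  delta_pos : 0 < δ
  nonsingular : ∀ (r : ℝ), |r| < δ → ∀ x : M, Function.Bijective (γ r x)

/-- The derivative `γ̇(0)` at the point `x`. -/
def gammaDot (γ : ℝ → Π x : M, TangentSpace (𝓡 n) x →L[ℝ] TangentSpace (𝓡 n) x) (x : M) :
    TangentSpace (𝓡 n) x →L[ℝ] TangentSpace (𝓡 n) x :=
  deriv (F := EuclideanSpace ℝ (Fin n) →L[ℝ] EuclideanSpace ℝ (Fin n)) (fun r : ℝ ↦ γ r x) 0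

/-- The half-line of positive reals. -/
abbrev posReals : TopologicalSpace.Opens ℝ := ⟨Set.Ioi 0, isOpen_Ioi⟩

/-- The interval `(-δ, δ)`. -/
abbrev symInterval (δ : ℝ) : TopologicalSpace.Opens ℝ := ⟨Set.Ioo (-δ) δ, isOpen_Ioo⟩

/-- The manifold `ℝ_{>0} × (-δ, δ) × M`, with points `(t, r, x)`. -/
abbrev Ambient (δ : ℝ) (M : Type*) : Type _ := posReals × symInterval δ × M

/-- The model of `ℝ_{>0} × (-δ, δ) × M`. -/
abbrev ambientModel (n : ℕ) := 𝓘(ℝ, ℝ).prod (𝓘(ℝ, ℝ).prod (𝓡 n))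

/-- The model vector space of `ℝ_{>0} × (-δ, δ) × M`. -/
abbrev AmbientVec (n : ℕ) := ℝ × ℝ × EuclideanSpace ℝ (Fin n)

variable {δ : ℝ}

/-- The 1-form `dt`. -/
def dt (p : Ambient δ M) : TangentSpace (ambientModel n) p →L[ℝ] ℝ :=
  ContinuousLinearMap.fst ℝ ℝ (ℝ × EuclideanSpace ℝ (Fin n))

/-- The 1-form `dr`. -/
def dr (p : Ambient δ M) : TangentSpace (ambientModel n) p →L[ℝ] ℝ :=
  (ContinuousLinearMap.fst ℝ ℝ (EuclideanSpace ℝ (Fin n))) ∘L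
    (ContinuousLinearMap.snd ℝ ℝ (ℝ × EuclideanSpace ℝ (Fin n)))

/-- The differential of the projection to `M`. -/
def dproj (p : Ambient δ M) :
    TangentSpace (ambientModel n) p →L[ℝ] TangentSpace (𝓡 n) p.2.2 :=
  (ContinuousLinearMap.snd ℝ ℝ (EuclideanSpace ℝ (Fin n))) ∘L
    (ContinuousLinearMap.snd ℝ ℝ (ℝ × EuclideanSpace ℝ (Fin n)))

/-- The 1-form `d(rt) = r dt + t dr`. -/
def drt (p : Ambient δ M) : TangentSpace (ambientModel n) p →L[ℝ] ℝ :=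
  (p.2.1 : ℝ) • dt p + (p.1 : ℝ) • dr p

/-- The Lorentzian metric `d(rt) ⊗ dt + dt ⊗ d(rt) + t² g(γ(r) -, -)`. -/
def ambientMetric
    (g : ContMDiffRiemannianMetric (𝓡 n) ∞ (EuclideanSpace ℝ (Fin n))
      (TangentSpace (𝓡 n) : M → Type _))
    (γ : ℝ → Π x : M, TangentSpace (𝓡 n) x →L[ℝ] TangentSpace (𝓡 n) x) (p : Ambient δ M) :
    TangentSpace (ambientModel n) p →L[ℝ] TangentSpace (ambientModel n) p →L[ℝ] ℝ :=
  (drt p).smulRight (dt p) + (dt p).smulRight (drt p)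
    + ((p.1 : ℝ) ^ 2) • ((ContinuousLinearMap.precomp ℝ (dproj p)) ∘L (g.inner p.2.2)
        ∘L (γ p.2.1 p.2.2) ∘L (dproj p))

/-- The immersion `Ψ^u : x ↦ (e^{u(x)}, 0, x)`. -/
def immersion (hδ : 0 < δ) (u : C^∞⟮𝓡 n, M; ℝ⟯) :
    C^∞⟮𝓡 n, M; ambientModel n, Ambient δ M⟯ :=
  ⟨fun x ↦ (⟨Real.exp (u x), Real.exp_pos _⟩, ⟨0, neg_lt_zero.mpr hδ, hδ⟩, x), by
    refine ContMDiff.prodMk ?_ (ContMDiff.prodMk contMDiff_const contMDiff_id)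
    rw [← ContMDiff.subtypeVal_comp_iff]
    exact Real.contDiff_exp.contMDiff.comp u.contMDiff⟩

/-- The lightlike normal vector field `ξ^u = e^u ∂_t` along `Ψ^u`. -/
def xi (hδ : 0 < δ) (u : C^∞⟮𝓡 n, M; ℝ⟯) (x : M) :
    ((immersion hδ u : M → Ambient δ M) *ᵖ
      (TangentSpace (ambientModel n) : Ambient δ M → Type _)) x :=
  ((Real.exp (u x), 0, 0) : AmbientVec n)

end Ambient

end

end TractorGeometry

/-! Write `γ̇` for `γ̇(0)`. Along `Ψ^u` the coordinate `r` vanishes, so the ambient Levi-Civita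
connection there sees the family only through `γ(0) = Id` and `γ̇`. Split the pulled back bundle
into multiples of `∂_t`, multiples of `∂_r` and `TM`. From the ambient Christoffel symbols
(`IsAdmissible.christoffel_ambient`), the derivative of a section `(a, b, z)` in the direction `v`
has the components `da(v) - e^u g(γ̇ v, z) / 2`, `db(v) + du(v) b - g(v, z)` and `∇_v z + du(v) z +
e^{-u} a v + b γ̇ v / 2` (`IsAdmissible.ambientTractor_conn_eq`). The line `T¹` is `b = 0, z = 0`,
and its orthogonal complement is `b = 0`.

Conditions (a), (b), (c) can be read off from these formulas and hold for every admissible family.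
The same is true of the first half of (d): on `(T¹)^⊥` the `∂_r`-component of the curvature vanishes
because the second derivative is symmetric in its two directions. The `TM`-component is `R(v, w) z -
g(γ̇ w, z) v / 2 + g(γ̇ v, z) w / 2 - g(w, z) γ̇ v / 2 + g(v, z) γ̇ w / 2`; the function `u` has
dropped out, and this is zero when `z = 0`.

Taking the trace over `v` (`trace_tractorEnd`) turns the whole statement into the pointwise equation
`Ric = (n - 2) / 2 · g(γ̇ ·, ·) + trace(γ̇) / 2 · g`
(`IsAdmissible.isNormalConformalTractorBundle_iff`). For `n = 2` the first term disappears and `Ric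
= K g`, so the equation says `trace(γ̇) = 2K` (`ricci_eq_iff_gaussCurvature`). For `n ≥ 3`
contraction gives `S = (n - 1) trace(γ̇)`, and solving for `γ̇` gives `2P`
(`ricci_eq_iff_schouten`).

Much of the work is about the Levi-Civita connection itself. At each point it is defined in the
chart at that point, so its smoothness is not visible from the definition and comes from the Koszul
formula. -/

set_option linter.unusedSectionVars false

namespace TractorGeometry

noncomputable section

/-! ### Calculus of vector-valued functions on a manifold. -/

section VectorValued

variable {E : Type*} [NormedAddCommGroup E] [NormedSpace ℝ E]
  {H : Type*} [TopologicalSpace H] {I : ModelWithCorners ℝ E H}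
  {M : Type*} [TopologicalSpace M] [ChartedSpace H M]
  {F₁ : Type*} [NormedAddCommGroup F₁] [NormedSpace ℝ F₁]
  {F₂ : Type*} [NormedAddCommGroup F₂] [NormedSpace ℝ F₂]
  {F₃ : Type*} [NormedAddCommGroup F₃] [NormedSpace ℝ F₃]

theorem mvfderiv_congr {f g : M → F₁} {x : M} (h : f =ᶠ[𝓝 x] g) :
    mvfderiv I f x = mvfderiv I g x := by
  ext v
  have := h.mfderiv_eq (I := I) (I' := 𝓘(ℝ, F₁))
  exact congrArg (fun L : E →L[ℝ] F₁ ↦ L v) this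

theorem hasMFDerivAt_mvfderiv {f : M → F₁} {x : M} (hf : MDifferentiableAt I 𝓘(ℝ, F₁) f x) :
    HasMFDerivAt I 𝓘(ℝ, F₁) f x (mvfderiv I f x) :=
  hf.hasMFDerivAt

theorem mvfderiv_eq_of_hasMFDerivAt {f : M → F₁} {x : M} {f' : TangentSpace I x →L[ℝ] F₁}
    (hf : HasMFDerivAt I 𝓘(ℝ, F₁) f x f') : mvfderiv I f x = f' :=
  hf.mfderiv

theorem mvfderiv_clm_apply {f : M → F₁ →L[ℝ] F₂} {g : M → F₁} {x : M}
    (hf : MDifferentiableAt I 𝓘(ℝ, F₁ →L[ℝ] F₂) f x) (hg : MDifferentiableAt I 𝓘(ℝ, F₁) g x)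
    (v : TangentSpace I x) :
    mvfderiv I (fun y ↦ f y (g y)) x v = f x (mvfderiv I g x v) + mvfderiv I f x v (g x) := by
  let f' : E →L[ℝ] F₁ →L[ℝ] F₂ := mvfderiv I f x
  let g' : E →L[ℝ] F₁ := mvfderiv I g x
  have h : HasMFDerivAt I 𝓘(ℝ, F₂) (fun y ↦ f y (g y)) x
      ((f x) ∘L g' + f'.flip (g x) : E →L[ℝ] F₂) := by
    refine ⟨(hf.clm_apply hg).continuousAt, ?_⟩
    have h1 := (hasMFDerivAt_mvfderiv hf).2
    have h2 := (hasMFDerivAt_mvfderiv hg).2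
    have h3 := HasFDerivWithinAt.clm_apply h1 h2
    simpa [writtenInExtChartAt] using! h3
  rw [mvfderiv_eq_of_hasMFDerivAt h]
  rfl

theorem mvfderiv_clm_comp (L : F₁ →L[ℝ] F₂) {g : M → F₁} {x : M}
    (hg : MDifferentiableAt I 𝓘(ℝ, F₁) g x) (v : TangentSpace I x) :
    mvfderiv I (fun y ↦ L (g y)) x v = L (mvfderiv I g x v) := by
  rw [mvfderiv_clm_apply (f := fun _ ↦ L) mdifferentiableAt_const hg, mvfderiv_const]
  simp

/-- A basis of `F₁` identifies the space of linear maps with a finite power of `F₂`, and smoothness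
into a finite power is tested componentwise. -/
theorem contMDiffAt_clm_of_apply [FiniteDimensional ℝ F₁] {k : ℕ∞ω} {f : M → F₁ →L[ℝ] F₂} {x : M}
    (h : ∀ w, ContMDiffAt I 𝓘(ℝ, F₂) k (fun y ↦ f y w) x) :
    ContMDiffAt I 𝓘(ℝ, F₁ →L[ℝ] F₂) k f x := by
  let d := Module.finrank ℝ F₁
  have hd : d = Module.finrank ℝ (Fin d → ℝ) := (Module.finrank_fin_fun ℝ).symm
  let e₁ := ContinuousLinearEquiv.ofFinrankEq hd
  let e₂ := (e₁.arrowCongr (1 : F₂ ≃L[ℝ] F₂)).trans (ContinuousLinearEquiv.piRing (Fin d))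
  have h1 : ContMDiffAt I 𝓘(ℝ, Fin d → F₂) k (fun y ↦ e₂ (f y)) x :=
    contMDiffAt_pi_space.2 fun i ↦ h _
  have h2 := (e₂.symm.contDiff (n := k)).contMDiff.contMDiffAt.comp x h1
  simpa [Function.comp_def] using h2

end VectorValued

/-! ### Local sections with constant components. -/

section Bundles

variable {E : Type*} [NormedAddCommGroup E] [NormedSpace ℝ E]
  {H : Type*} [TopologicalSpace H] {I : ModelWithCorners ℝ E H}
  {M : Type*} [TopologicalSpace M] [ChartedSpace H M]
  {F : Type*} [NormedAddCommGroup F] [NormedSpace ℝ F]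
  {V : M → Type*} [TopologicalSpace (TotalSpace F V)]
  [∀ x, AddCommGroup (V x)] [∀ x, Module ℝ (V x)] [∀ x, TopologicalSpace (V x)]
  [FiberBundle F V] [VectorBundle ℝ F V]
  {F' : Type*} [NormedAddCommGroup F'] [NormedSpace ℝ F']
  {V' : M → Type*} [TopologicalSpace (TotalSpace F' V')]
  [∀ x, AddCommGroup (V' x)] [∀ x, Module ℝ (V' x)] [∀ x, TopologicalSpace (V' x)]
  [FiberBundle F' V'] [VectorBundle ℝ F' V']
  [∀ x, IsTopologicalAddGroup (V' x)] [∀ x, ContinuousSMul ℝ (V' x)]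

/-- Over the base set, `FiberBundle.extend` is the section with constant components in the
trivialization at `x`. The formula is restricted to that set, which is why later identities hold
only eventually near `x`. -/
theorem extend_apply_of_mem {x y : M} (hy : y ∈ (trivializationAt F V x).baseSet) (v : V x) :
    FiberBundle.extend F v y = (trivializationAt F V x).symmL ℝ y
      ((trivializationAt F V x).continuousLinearMapAt ℝ x v) := by
  rw [Trivialization.symmL_apply _ hy, Trivialization.continuousLinearMapAt_apply,
    Trivialization.coe_linearMapAt_of_mem _ (FiberBundle.mem_baseSet_trivializationAt' x)]
  rfl

theorem eventually_mem_baseSet (x : M) : ∀ᶠ y in 𝓝 x, y ∈ (trivializationAt F V x).baseSet :=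
  (trivializationAt F V x).open_baseSet.mem_nhds (FiberBundle.mem_baseSet_trivializationAt' x)

theorem extend_symmL {x y : M} (w : F) (hy : y ∈ (trivializationAt F V x).baseSet) :
    FiberBundle.extend F ((trivializationAt F V x).symmL ℝ x w) y =
      (trivializationAt F V x).symmL ℝ y w := by
  rw [extend_apply_of_mem hy, Trivialization.continuousLinearMapAt_symmL _
    (FiberBundle.mem_baseSet_trivializationAt' x)]

theorem snd_trivializationAt_apply {x y : M} (hy : y ∈ (trivializationAt F V x).baseSet)
    (v : V y) : (trivializationAt F V x (TotalSpace.mk' F y v)).2 =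
      (trivializationAt F V x).continuousLinearMapAt ℝ y v := by
  rw [Trivialization.continuousLinearMapAt_apply, Trivialization.coe_linearMapAt_of_mem _ hy]

theorem snd_trivializationAt_extend {x y : M} (hy : y ∈ (trivializationAt F V x).baseSet)
    (v : V x) : (trivializationAt F V x (TotalSpace.mk' F y (FiberBundle.extend F v y))).2 =
      (trivializationAt F V x).continuousLinearMapAt ℝ x v := by
  rw [snd_trivializationAt_apply hy, extend_apply_of_mem hy,
    Trivialization.continuousLinearMapAt_symmL _ hy]

theorem extend_add {x y : M} (hy : y ∈ (trivializationAt F V x).baseSet) (v w : V x) :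
    FiberBundle.extend F (v + w) y = FiberBundle.extend F v y + FiberBundle.extend F w y := by
  simp only [extend_apply_of_mem hy, map_add]

theorem extend_smul {x y : M} (hy : y ∈ (trivializationAt F V x).baseSet) (c : ℝ) (v : V x) :
    FiberBundle.extend F (c • v) y = c • FiberBundle.extend F v y := by
  simp only [extend_apply_of_mem hy, map_smul]

/-- A section of a bundle of linear maps is smooth if its values on the local extensions of
vectors are smooth. -/
theorem contMDiffAt_hom_of_extend [FiniteDimensional ℝ F] {k : ℕ∞ω}
    {φ : Π x : M, V x →L[ℝ] V' x} {x : M}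
    (h : ∀ w : V x, ContMDiffAt I (I.prod 𝓘(ℝ, F')) k
      (fun y ↦ TotalSpace.mk' F' y (φ y (FiberBundle.extend F w y))) x) :
    ContMDiffAt I (I.prod 𝓘(ℝ, F →L[ℝ] F')) k
      (fun y ↦ TotalSpace.mk' (F →L[ℝ] F') y (φ y)) x := by
  rw [contMDiffAt_hom_bundle]
  refine ⟨contMDiffAt_id, contMDiffAt_clm_of_apply fun w ↦ ?_⟩
  have hw := (contMDiffAt_section x).1 (h ((trivializationAt F V x).symmL ℝ x w))
  refine hw.congr_of_eventuallyEq ?_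
  filter_upwards [eventually_mem_baseSet (F := F) (V := V) x,
    eventually_mem_baseSet (F := F') (V := V') x] with y hy hy'
  rw [extend_symmL w hy, snd_trivializationAt_apply hy']
  simp [ContinuousLinearMap.inCoordinates]

end Bundles

/-! ### Coordinate vector fields. -/

section Tangent

variable {E : Type*} [NormedAddCommGroup E] [NormedSpace ℝ E]
  {H : Type*} [TopologicalSpace H] {I : ModelWithCorners ℝ E H}
  {M : Type*} [TopologicalSpace M] [ChartedSpace H M] [IsManifold I ∞ M]
  {F : Type*} [NormedAddCommGroup F] [NormedSpace ℝ F]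

/-- The identification of the tangent space at `x` with `E` is already made by the chart at `x`, so
there is no change of coordinates. -/
theorem continuousLinearMapAt_tangent_self (x : M) :
    (trivializationAt E (TangentSpace I : M → Type _) x).continuousLinearMapAt ℝ x =
      ContinuousLinearMap.id ℝ E := by
  rw [TangentBundle.continuousLinearMapAt_trivializationAt (mem_chart_source H x),
    mfderiv_extChartAt_self]
  rfl

theorem symmL_tangent_self (x : M) :
    (trivializationAt E (TangentSpace I : M → Type _) x).symmL ℝ x =
      ContinuousLinearMap.id ℝ E := by
  ext v
  have h := Trivialization.continuousLinearMapAt_symmL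
    (trivializationAt E (TangentSpace I : M → Type _) x) (R := ℝ)
    (FiberBundle.mem_baseSet_trivializationAt' x) v
  rw [continuousLinearMapAt_tangent_self] at h
  exact h

variable (I) in
/-- The trivialization of the tangent bundle given by the chart at `x`. -/
abbrev tangentTriv (x : M) := trivializationAt E (TangentSpace I : M → Type _) x

theorem symmL_clmAt_self (x : M) (v : TangentSpace I x) :
    (tangentTriv I x).symmL ℝ x ((tangentTriv I x).continuousLinearMapAt ℝ x v) = v :=
  (tangentTriv I x).symmL_continuousLinearMapAt (mem_chart_source H x) v

theorem clmAt_symmL_self (x : M) (v : E) :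
    (tangentTriv I x).continuousLinearMapAt ℝ x ((tangentTriv I x).symmL ℝ x v) = v :=
  (tangentTriv I x).continuousLinearMapAt_symmL (mem_chart_source H x) v

variable [I.Boundaryless]

/-- In the chart at `x` both extensions are constant vector fields, whose bracket is zero. This
removes the bracket term from every curvature computation. -/
theorem mlieBracket_extend (x : M) (v w : TangentSpace I x) :
    VectorField.mlieBracket I (FiberBundle.extend E v : Π y : M, TangentSpace I y)
      (FiberBundle.extend E w) x = 0 := by
  rw [← VectorField.mlieBracketWithin_univ, VectorField.mlieBracketWithin_apply]
  have key : ∀ v : TangentSpace I x, ∀ᶠ z in 𝓝 (extChartAt I x x),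
      VectorField.mpullbackWithin 𝓘(ℝ, E) I (extChartAt I x).symm
        (FiberBundle.extend E v : Π y : M, TangentSpace I y) (Set.range I) z = v := by
    intro v
    filter_upwards [extChartAt_target_mem_nhds (I := I) x] with z hz
    have hs : (extChartAt I x).symm z ∈ (chartAt H x).source := by
      simpa using (extChartAt I x).map_target hz
    rw [VectorField.mpullbackWithin_apply, extend_apply_of_mem hs,
      continuousLinearMapAt_tangent_self,
      TangentBundle.symmL_trivializationAt hs, (extChartAt I x).right_inv hz]
    obtain ⟨A, hA⟩ := isInvertible_mfderivWithin_extChartAt_symm (I := I) hz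
    rw [← hA, ContinuousLinearMap.inverse_equiv]
    exact A.symm_apply_apply v
  have h0 := Filter.EventuallyEq.lieBracketWithin_vectorField_eq (𝕜 := ℝ) (E := E)
    (s := (extChartAt I x).symm ⁻¹' Set.univ ∩ Set.range I)
    (V₁ := VectorField.mpullbackWithin 𝓘(ℝ, E) I (extChartAt I x).symm
        (FiberBundle.extend E v : Π y : M, TangentSpace I y) (Set.range I))
    (W₁ := VectorField.mpullbackWithin 𝓘(ℝ, E) I (extChartAt I x).symm
        (FiberBundle.extend E w : Π y : M, TangentSpace I y) (Set.range I))
    (V := fun _ ↦ v) (W := fun _ ↦ w)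
    ((key v).filter_mono nhdsWithin_le_nhds) (key v).self_of_nhds
    ((key w).filter_mono nhdsWithin_le_nhds) (key w).self_of_nhds
  have h1 : ∀ (v w z : E) (s : Set E),
      VectorField.lieBracketWithin ℝ (fun _ : E ↦ v) (fun _ : E ↦ w) s z = 0 := by
    simp [VectorField.lieBracketWithin_eq]
  refine (congrArg _ (h0.trans (h1 v w _ _))).trans (map_zero _)

/-- Derivatives along two coordinate vector fields commute. -/
theorem mvfderiv_mvfderiv_extend_comm {f : M → F} {x : M}
    (hf : ContMDiffAt I 𝓘(ℝ, F) 2 f x) (v w : TangentSpace I x) :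
    mvfderiv I (fun y ↦ mvfderiv I f y (FiberBundle.extend E w y)) x v =
      mvfderiv I (fun y ↦ mvfderiv I f y (FiberBundle.extend E v y)) x w := by
  set φ := extChartAt I x
  set f' : E → F := f ∘ φ.symm
  have hf' : ContDiffAt ℝ 2 f' (φ x) := by
    have := (contMDiffAt_iff.1 hf).2
    simpa [f', ModelWithCorners.range_eq_univ] using! this
  have hfd : ∀ᶠ y in 𝓝 x, DifferentiableAt ℝ f' (φ y) := by
    have h1 : ∀ᶠ z in 𝓝 (φ x), DifferentiableAt ℝ f' z :=
      (hf'.eventually (by simp)).mono fun z hz ↦ hz.differentiableAt (by simp)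
    exact (continuousAt_extChartAt x).eventually h1
  have hφ : ∀ y ∈ (chartAt H x).source, HasMFDerivAt I 𝓘(ℝ, E) φ y (mfderiv I 𝓘(ℝ, E) φ y) :=
    fun y hy ↦ (mdifferentiableAt_extChartAt hy).hasMFDerivAt
  -- Along a coordinate field the derivative of `f` is the Fréchet derivative of its coordinate
  -- expression in a fixed direction; the claim thus reduces to the symmetry of the second
  -- derivative.
  have key : ∀ w : TangentSpace I x, ∀ᶠ y in 𝓝 x,
      mvfderiv I f y (FiberBundle.extend E w y) = fderiv ℝ f' (φ y) w := by
    intro w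
    filter_upwards [hfd.eventually_nhds, (chartAt H x).open_source.mem_nhds
      (mem_chart_source H x)] with y hy hys
    have h1 : f =ᶠ[𝓝 y] fun z ↦ f' (φ z) := by
      filter_upwards [(chartAt H x).open_source.mem_nhds hys] with z hz
      have : φ.symm (φ z) = z := φ.left_inv (by simpa [φ] using hz)
      simp [f', this]
    have h2 : HasMFDerivAt I 𝓘(ℝ, F) (fun z ↦ f' (φ z)) y
        ((fderiv ℝ f' (φ y)) ∘L (mfderiv I 𝓘(ℝ, E) φ y) : E →L[ℝ] F) :=
      (hy.self_of_nhds.hasFDerivAt.hasMFDerivAt).comp y (hφ y hys)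
    rw [mvfderiv_congr h1, mvfderiv_eq_of_hasMFDerivAt h2, extend_apply_of_mem hys,
      continuousLinearMapAt_tangent_self,
      ← TangentBundle.continuousLinearMapAt_trivializationAt hys]
    exact congrArg (fderiv ℝ f' (φ y)) (Trivialization.continuousLinearMapAt_symmL
      (trivializationAt E (TangentSpace I : M → Type _) x) (R := ℝ) hys w)
  have hd2 : DifferentiableAt ℝ (fderiv ℝ f') (φ x) :=
    (hf'.fderiv_right (m := 1) (by norm_num)).differentiableAt (by simp)
  have key2 : ∀ v w : TangentSpace I x,
      mvfderiv I (fun y ↦ mvfderiv I f y (FiberBundle.extend E w y)) x v =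
        fderiv ℝ (fderiv ℝ f') (φ x) v w := by
    intro v (w : E)
    have h3 : HasMFDerivAt I 𝓘(ℝ, F) (fun y ↦ fderiv ℝ f' (φ y) w) x
        (((fderiv ℝ (fderiv ℝ f') (φ x)).flip w) ∘L (mfderiv I 𝓘(ℝ, E) φ x) : E →L[ℝ] F) := by
      have h4 : HasFDerivAt (fun z ↦ fderiv ℝ f' z w) ((fderiv ℝ (fderiv ℝ f') (φ x)).flip w)
          (φ x) := by
        convert hd2.hasFDerivAt.clm_apply (hasFDerivAt_const w (φ x)) using 1
        rw [ContinuousLinearMap.comp_zero, zero_add]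
      exact h4.hasMFDerivAt.comp x (hφ x (mem_chart_source H x))
    rw [mvfderiv_congr (key w), mvfderiv_eq_of_hasMFDerivAt h3, mfderiv_extChartAt_self]
    rfl
  rw [key2, key2]
  exact (hf'.isSymmSndFDerivAt (by simp)).eq v w

end Tangent

end

end TractorGeometry

namespace TractorGeometry

noncomputable section

/-! ### Pairing sections by a smooth bilinear form. -/

section Pairing

variable {E : Type*} [NormedAddCommGroup E] [NormedSpace ℝ E]
  {H : Type*} [TopologicalSpace H] {I : ModelWithCorners ℝ E H}
  {M : Type*} [TopologicalSpace M] [ChartedSpace H M]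
  {F : Type*} [NormedAddCommGroup F] [NormedSpace ℝ F]
  {V : M → Type*} [TopologicalSpace (TotalSpace F V)]
  [∀ x, AddCommGroup (V x)] [∀ x, Module ℝ (V x)] [∀ x, TopologicalSpace (V x)]
  [FiberBundle F V] [VectorBundle ℝ F V] [∀ x, IsTopologicalAddGroup (V x)]
  [∀ x, ContinuousSMul ℝ (V x)]
  {G : Π x : M, V x →L[ℝ] V x →L[ℝ] ℝ} {k : ℕ∞ω} {x : M} {σ τ : Π x : M, V x}

theorem contMDiffAt_pairing
    (hG : ContMDiffAt I (I.prod 𝓘(ℝ, F →L[ℝ] F →L[ℝ] ℝ)) k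
      (fun b ↦ TotalSpace.mk' (F →L[ℝ] F →L[ℝ] ℝ) b (G b)) x)
    (hσ : ContMDiffAt I (I.prod 𝓘(ℝ, F)) k (fun y ↦ TotalSpace.mk' F y (σ y)) x)
    (hτ : ContMDiffAt I (I.prod 𝓘(ℝ, F)) k (fun y ↦ TotalSpace.mk' F y (τ y)) x) :
    ContMDiffAt I 𝓘(ℝ) k (fun y ↦ G y (σ y) (τ y)) x := by
  have : ContMDiffAt I (I.prod 𝓘(ℝ)) k
      (fun m ↦ TotalSpace.mk' ℝ (E := Bundle.Trivial M ℝ) m (G m (σ m) (τ m))) x :=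
    ContMDiffAt.clm_bundle_apply₂ (F₁ := F) (F₂ := F) hG hσ hτ
  rw [contMDiffAt_totalSpace] at this
  exact this.2

theorem mdifferentiableAt_pairing
    (hG : ContMDiff I (I.prod 𝓘(ℝ, F →L[ℝ] F →L[ℝ] ℝ)) ∞
      (fun b ↦ TotalSpace.mk' (F →L[ℝ] F →L[ℝ] ℝ) b (G b)))
    (hσ : MDifferentiableAt I (I.prod 𝓘(ℝ, F)) (fun y ↦ TotalSpace.mk' F y (σ y)) x)
    (hτ : MDifferentiableAt I (I.prod 𝓘(ℝ, F)) (fun y ↦ TotalSpace.mk' F y (τ y)) x) :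
    MDifferentiableAt I 𝓘(ℝ) (fun y ↦ G y (σ y) (τ y)) x := by
  have : MDifferentiableAt I (I.prod 𝓘(ℝ))
      (fun m ↦ TotalSpace.mk' ℝ (E := Bundle.Trivial M ℝ) m (G m (σ m) (τ m))) x :=
    MDifferentiableAt.clm_bundle_apply₂ (F₁ := F) (F₂ := F)
      ((hG x).mdifferentiableAt (by simp)) hσ hτ
  rw [mdifferentiableAt_totalSpace] at this
  exact this.2

end Pairing

/-! ### The Levi-Civita connection in a chart. -/

section Christoffel

variable {E : Type*} [NormedAddCommGroup E] [NormedSpace ℝ E]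
  {H : Type*} [TopologicalSpace H] {I : ModelWithCorners ℝ E H}
  {M : Type*} [TopologicalSpace M] [ChartedSpace H M] [IsManifold I ∞ M]
  {G : Π x : M, TangentSpace I x →L[ℝ] TangentSpace I x →L[ℝ] ℝ}

theorem metricCoord_apply (p q : M) (v w : E) : metricCoord I G p q v w =
    G q ((tangentTriv I p).symmL ℝ q v) ((tangentTriv I p).symmL ℝ q w) := rfl

theorem metricCoordDeriv_apply (p : M) (v : E) : metricCoordDeriv I G p v =
    mvfderiv I (metricCoord I G p) p ((tangentTriv I p).symmL ℝ p v) := rfl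

theorem christoffelFirst_apply (p : M) (u v w : E) : christoffelFirst I G p u v w =
    1 / 2 * (metricCoordDeriv I G p u v w + metricCoordDeriv I G p v u w -
      metricCoordDeriv I G p w u v) := rfl

/-- `ContinuousLinearMap.inverse` has its intended meaning only at an equivalence; nondegeneracy and
equality of dimensions provide one. -/
theorem exists_equiv_of_nondegenerate [FiniteDimensional ℝ E] (b : E →L[ℝ] E →L[ℝ] ℝ)
    (hb : ∀ v : E, (∀ w, b v w = 0) → v = 0) :
    ∃ B : E ≃L[ℝ] (E →L[ℝ] ℝ), (B : E →L[ℝ] (E →L[ℝ] ℝ)) = b := by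
  have hinj : Function.Injective b := by
    refine (injective_iff_map_eq_zero _).2 fun v hv ↦ hb v fun w ↦ ?_
    rw [hv]
    rfl
  let A : E ≃ₗ[ℝ] (E →L[ℝ] ℝ) := LinearEquiv.ofInjectiveOfFinrankEq b.toLinearMap hinj (by
    rw [← (LinearMap.toContinuousLinearMap : (E →ₗ[ℝ] ℝ) ≃ₗ[ℝ] _).finrank_eq,
      Module.finrank_linearMap, Module.finrank_self, mul_one])
  exact ⟨A.toContinuousLinearEquiv, by ext v w; rfl⟩

/-- Lowering the index undoes the inverse metric. Christoffel symbols can therefore be identified by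
pairing with an arbitrary `w`, without inverting the metric explicitly. -/
theorem metricCoord_christoffel [FiniteDimensional ℝ E] (p : M)
    (hG : ∀ v : E, (∀ w, metricCoord I G p p v w = 0) → v = 0) (u v w : E) :
    metricCoord I G p p (christoffel I G p u v) w = christoffelFirst I G p u v w := by
  obtain ⟨B, hB⟩ := exists_equiv_of_nondegenerate _ hG
  have h1 : christoffel I G p u v = B.symm (christoffelFirst I G p u v) := by
    rw [christoffel, ← hB, ContinuousLinearMap.inverse_equiv]
    rfl
  have h2 : B (christoffel I G p u v) = christoffelFirst I G p u v := by
    rw [h1, B.apply_symm_apply]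
  rw [← h2, ← hB]
  rfl

variable (I) in
/-- The components of a vector field with respect to the coordinate frame of the chart at `p`. -/
def tangentCoord (Y : Π x : M, TangentSpace I x) (p q : M) : E :=
  (tangentTriv I p (TotalSpace.mk' E q (Y q))).2

theorem tangentCoord_apply (Y : Π x : M, TangentSpace I x) {p q : M}
    (hq : q ∈ (tangentTriv I p).baseSet) :
    tangentCoord I Y p q = (tangentTriv I p).continuousLinearMapAt ℝ q (Y q) :=
  snd_trivializationAt_apply hq (Y q)

theorem tangentCoord_self (Y : Π x : M, TangentSpace I x) (p : M) :
    tangentCoord I Y p p = (tangentTriv I p).continuousLinearMapAt ℝ p (Y p) :=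
  tangentCoord_apply Y (mem_chart_source H p)

theorem eventually_mem_tangentTriv (p : M) : ∀ᶠ q in 𝓝 p, q ∈ (tangentTriv I p).baseSet :=
  eventually_mem_baseSet (F := E) (V := (TangentSpace I : M → Type _)) p

theorem mdifferentiableAt_tangentCoord {Y : Π x : M, TangentSpace I x} {p : M}
    (hY : MDifferentiableAt I (I.prod 𝓘(ℝ, E)) (fun y ↦ TotalSpace.mk' E y (Y y)) p) :
    MDifferentiableAt I 𝓘(ℝ, E) (tangentCoord I Y p) p :=
  (mdifferentiableAt_section I Y).1 hY

theorem leviCivita_apply (Y : Π x : M, TangentSpace I x) (p : M) (v : TangentSpace I p) :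
    leviCivita I G Y p v = (tangentTriv I p).symmL ℝ p (mvfderiv I (tangentCoord I Y p) p v +
      christoffel I G p ((tangentTriv I p).continuousLinearMapAt ℝ p v) (tangentCoord I Y p p)) :=
  rfl

theorem tangentCoord_extend (p : M) (Y : TangentSpace I p) :
    tangentCoord I (FiberBundle.extend E Y) p =ᶠ[𝓝 p]
      fun _ ↦ (tangentTriv I p).continuousLinearMapAt ℝ p Y := by
  filter_upwards [eventually_mem_tangentTriv (I := I) p] with q hq
  exact snd_trivializationAt_extend hq Y

/-- The components of the extension are constant near `p`, so only the Christoffel term survives. -/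
theorem leviCivita_extend (p : M) (Y v : TangentSpace I p) :
    leviCivita I G (FiberBundle.extend E Y) p v = (tangentTriv I p).symmL ℝ p
      (christoffel I G p ((tangentTriv I p).continuousLinearMapAt ℝ p v)
        ((tangentTriv I p).continuousLinearMapAt ℝ p Y)) := by
  rw [leviCivita_apply, mvfderiv_congr (tangentCoord_extend p Y), mvfderiv_const,
    (tangentCoord_extend p Y).self_of_nhds, zero_apply, zero_add]

/-- The Christoffel term is linear over functions, so the Leibniz rule comes entirely from
differentiating the components. -/
theorem isCovariantDerivativeOn_leviCivita :
    IsCovariantDerivativeOn E (leviCivita I G) Set.univ where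
  add {σ σ' x} hσ hσ' _ := by
    ext v
    have h1 := mdifferentiableAt_tangentCoord hσ
    have h2 := mdifferentiableAt_tangentCoord hσ'
    have h3 : tangentCoord I (σ + σ') x =ᶠ[𝓝 x]
        fun q ↦ tangentCoord I σ x q + tangentCoord I σ' x q := by
      filter_upwards [eventually_mem_tangentTriv (I := I) x] with q hq
      simp only [tangentCoord_apply _ hq, Pi.add_apply, map_add]
    rw [add_apply, leviCivita_apply, leviCivita_apply, leviCivita_apply,
      mvfderiv_congr h3, mvfderiv_fun_add h1 h2, h3.self_of_nhds]
    simp only [map_add, add_apply]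
    abel
  leibniz {σ f x} hσ hf _ := by
    ext v
    have h1 := mdifferentiableAt_tangentCoord hσ
    have h3 : tangentCoord I (f • σ) x =ᶠ[𝓝 x] fun q ↦ f q • tangentCoord I σ x q := by
      filter_upwards [eventually_mem_tangentTriv (I := I) x] with q hq
      simp only [tangentCoord_apply _ hq, Pi.smul_apply', map_smul]
    have h4 : mvfderiv I f x v • σ x = (tangentTriv I x).symmL ℝ x
        (mvfderiv I f x v • tangentCoord I σ x x) := by
      rw [map_smul, tangentCoord_self, symmL_clmAt_self]
    rw [add_apply, smul_apply, leviCivita_apply,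
      leviCivita_apply, mvfderiv_congr h3, mvfderiv_fun_smul hf h1, h3.self_of_nhds,
      ContinuousLinearMap.smulRight_apply, h4, ← map_smul, ← map_add, map_smul, add_apply,
      smul_apply, ContinuousLinearMap.smulRight_apply]
    congr 1
    module

end Christoffel

/-! ### Metric compatibility and vanishing torsion. -/

section Riemannian

variable {E : Type*} [NormedAddCommGroup E] [NormedSpace ℝ E] [FiniteDimensional ℝ E]
  {H : Type*} [TopologicalSpace H] {I : ModelWithCorners ℝ E H} [I.Boundaryless]
  {M : Type*} [TopologicalSpace M] [ChartedSpace H M] [IsManifold I ∞ M]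
  (g : ContMDiffRiemannianMetric I ∞ E (TangentSpace I : M → Type _))

theorem inner_nondegenerate {x : M} {v : TangentSpace I x} (h : ∀ w, g.inner x v w = 0) :
    v = 0 := by
  by_contra hv
  exact (g.pos x v hv).ne' (h v)

theorem contMDiffAt_inner {x : M} {σ τ : Π y : M, TangentSpace I y} {k : ℕ∞ω} (hk : k ≤ ∞)
    (hσ : ContMDiffAt I (I.prod 𝓘(ℝ, E)) k (fun y ↦ TotalSpace.mk' E y (σ y)) x)
    (hτ : ContMDiffAt I (I.prod 𝓘(ℝ, E)) k (fun y ↦ TotalSpace.mk' E y (τ y)) x) :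
    ContMDiffAt I 𝓘(ℝ) k (fun y ↦ g.inner y (σ y) (τ y)) x :=
  contMDiffAt_pairing ((g.contMDiff x).of_le hk) hσ hτ

theorem mdifferentiableAt_inner {x : M} {σ τ : Π y : M, TangentSpace I y}
    (hσ : MDifferentiableAt I (I.prod 𝓘(ℝ, E)) (fun y ↦ TotalSpace.mk' E y (σ y)) x)
    (hτ : MDifferentiableAt I (I.prod 𝓘(ℝ, E)) (fun y ↦ TotalSpace.mk' E y (τ y)) x) :
    MDifferentiableAt I 𝓘(ℝ) (fun y ↦ g.inner y (σ y) (τ y)) x :=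
  mdifferentiableAt_pairing g.contMDiff hσ hτ

theorem metricCoord_nondegenerate' {p q : M} (hq : q ∈ (tangentTriv I p).baseSet) (v : E)
    (h : ∀ w, metricCoord I g.inner p q v w = 0) : v = 0 := by
  rw [← (tangentTriv I p).continuousLinearMapAt_symmL (R := ℝ) hq v, inner_nondegenerate g
    (v := (tangentTriv I p).symmL ℝ q v), map_zero]
  intro w
  rw [← (tangentTriv I p).symmL_continuousLinearMapAt (R := ℝ) hq w, ← metricCoord_apply, h]

theorem metricCoord_nondegenerate (p : M) (v : E)
    (h : ∀ w, metricCoord I g.inner p p v w = 0) : v = 0 :=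
  metricCoord_nondegenerate' g (mem_chart_source H p) v h

theorem contMDiffAt_metricCoord (p : M) :
    ContMDiffAt I 𝓘(ℝ, E →L[ℝ] E →L[ℝ] ℝ) ∞ (metricCoord I g.inner p) p := by
  refine contMDiffAt_clm_of_apply fun v ↦ contMDiffAt_clm_of_apply fun w ↦ ?_
  have h := contMDiffAt_inner g le_rfl
    (FiberBundle.contMDiffAt_extend (k := ∞) I E ((tangentTriv I p).symmL ℝ p v))
    (FiberBundle.contMDiffAt_extend (k := ∞) I E ((tangentTriv I p).symmL ℝ p w))
  refine h.congr_of_eventuallyEq ?_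
  filter_upwards [eventually_mem_tangentTriv (I := I) p] with q hq
  rw [extend_symmL _ hq, extend_symmL _ hq, metricCoord_apply]

theorem mdifferentiableAt_metricCoord (p : M) :
    MDifferentiableAt I 𝓘(ℝ, E →L[ℝ] E →L[ℝ] ℝ) (metricCoord I g.inner p) p :=
  (contMDiffAt_metricCoord g p).mdifferentiableAt (by simp)

theorem metricCoordDeriv_apply_apply
    {G : Π x : M, TangentSpace I x →L[ℝ] TangentSpace I x →L[ℝ] ℝ} {p : M}
    (hG : MDifferentiableAt I 𝓘(ℝ, E →L[ℝ] E →L[ℝ] ℝ) (metricCoord I G p) p) (u v w : E) :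
    metricCoordDeriv I G p u v w = mvfderiv I (fun q ↦ metricCoord I G p q v w) p
      ((tangentTriv I p).symmL ℝ p u) := by
  rw [metricCoordDeriv_apply]
  let L : (E →L[ℝ] E →L[ℝ] ℝ) →L[ℝ] ℝ :=
    (ContinuousLinearMap.apply ℝ ℝ w) ∘L (ContinuousLinearMap.apply ℝ (E →L[ℝ] ℝ) v)
  exact (mvfderiv_clm_comp L hG _).symm

theorem metricCoordDeriv_symm (p : M) (u v w : E) :
    metricCoordDeriv I g.inner p u v w = metricCoordDeriv I g.inner p u w v := by
  rw [metricCoordDeriv_apply_apply (mdifferentiableAt_metricCoord g p),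
    metricCoordDeriv_apply_apply (mdifferentiableAt_metricCoord g p)]
  simp only [metricCoord_apply, g.symm]

theorem christoffel_symm (p : M) (u v : E) :
    christoffel I g.inner p u v = christoffel I g.inner p v u := by
  refine sub_eq_zero.1 (metricCoord_nondegenerate g p _ fun w ↦ ?_)
  rw [map_sub, sub_apply, metricCoord_christoffel p (metricCoord_nondegenerate g p),
    metricCoord_christoffel p (metricCoord_nondegenerate g p), christoffelFirst_apply,
    christoffelFirst_apply, metricCoordDeriv_symm g p w u v]
  ring

theorem inner_eq_metricCoord_tangentCoord (σ τ : Π y : M, TangentSpace I y) {x q : M}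
    (hq : q ∈ (tangentTriv I x).baseSet) : g.inner q (σ q) (τ q) =
      metricCoord I g.inner x q (tangentCoord I σ x q) (tangentCoord I τ x q) := by
  rw [metricCoord_apply, tangentCoord_apply _ hq, tangentCoord_apply _ hq,
    Trivialization.symmL_continuousLinearMapAt _ hq,
    Trivialization.symmL_continuousLinearMapAt _ hq]

/-- The Levi-Civita connection is compatible with the metric. -/
theorem mvfderiv_inner {x : M} {σ τ : Π y : M, TangentSpace I y}
    (hσ : MDifferentiableAt I (I.prod 𝓘(ℝ, E)) (fun y ↦ TotalSpace.mk' E y (σ y)) x)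
    (hτ : MDifferentiableAt I (I.prod 𝓘(ℝ, E)) (fun y ↦ TotalSpace.mk' E y (τ y)) x)
    (v : TangentSpace I x) :
    mvfderiv I (fun y ↦ g.inner y (σ y) (τ y)) x v =
      g.inner x (leviCivita I g.inner σ x v) (τ x) +
        g.inner x (σ x) (leviCivita I g.inner τ x v) := by
  have h1 : (fun y ↦ g.inner y (σ y) (τ y)) =ᶠ[𝓝 x] fun y ↦
      metricCoord I g.inner x y (tangentCoord I σ x y) (tangentCoord I τ x y) := by
    filter_upwards [eventually_mem_tangentTriv (I := I) x] with q hq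
    exact inner_eq_metricCoord_tangentCoord g σ τ hq
  have hσc := mdifferentiableAt_tangentCoord hσ
  have hτc := mdifferentiableAt_tangentCoord hτ
  have hm := mdifferentiableAt_metricCoord g x
  have hn := metricCoord_nondegenerate g x
  rw [mvfderiv_congr h1, mvfderiv_clm_apply (hm.clm_apply hσc) hτc, mvfderiv_clm_apply hm hσc,
    leviCivita_apply, leviCivita_apply]
  set vc := (tangentTriv I x).continuousLinearMapAt ℝ x v with hvc
  rw [← symmL_clmAt_self x (τ x), ← symmL_clmAt_self x (σ x), ← tangentCoord_self,
    ← tangentCoord_self, ← metricCoord_apply, ← metricCoord_apply]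
  set s := tangentCoord I σ x x
  set t := tangentCoord I τ x x
  have hsymm : ∀ a b, metricCoord I g.inner x x a b = metricCoord I g.inner x x b a := by
    intro a b
    rw [metricCoord_apply, g.symm, metricCoord_apply]
  -- The two Christoffel terms add up to the derivative of the metric components: `Γ(v, s; t) + Γ(v,
  -- t; s) = ∂_v g(s, t)`.
  have h2 : metricCoord I g.inner x x (christoffel I g.inner x vc s) t +
      metricCoord I g.inner x x s (christoffel I g.inner x vc t) =
      mvfderiv I (metricCoord I g.inner x) x v s t := by
    rw [hsymm s, metricCoord_christoffel x hn, metricCoord_christoffel x hn,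
      christoffelFirst_apply, christoffelFirst_apply, metricCoordDeriv_symm g x vc t s,
      metricCoordDeriv_symm g x s vc t, metricCoordDeriv_symm g x t vc s,
      metricCoordDeriv_apply x vc, hvc, symmL_clmAt_self]
    ring
  simp only [map_add, add_apply]
  linarith

theorem leviCivita_extend_comm (p : M) (v w : TangentSpace I p) :
    leviCivita I g.inner (FiberBundle.extend E v) p w =
      leviCivita I g.inner (FiberBundle.extend E w) p v := by
  rw [leviCivita_extend, leviCivita_extend, christoffel_symm]

/-- The Levi-Civita connection is torsion free. -/
theorem leviCivita_sub_leviCivita {x : M} {X Y : Π y : M, TangentSpace I y}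
    (hX : MDifferentiableAt I (I.prod 𝓘(ℝ, E)) (fun y ↦ TotalSpace.mk' E y (X y)) x)
    (hY : MDifferentiableAt I (I.prod 𝓘(ℝ, E)) (fun y ↦ TotalSpace.mk' E y (Y y)) x) :
    leviCivita I g.inner Y x (X x) - leviCivita I g.inner X x (Y x) =
      VectorField.mlieBracket I X Y x := by
  have : IsManifold I 2 M := IsManifold.of_le (n := ∞) (by norm_cast)
  have hc := isCovariantDerivativeOn_leviCivita (I := I) (G := g.inner)
  -- Torsion is tensorial, so it may be computed on the constant extensions of `X x` and `Y x`;
  -- there the bracket is zero and the symmetric Christoffel terms cancel.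
  have h1 := hc.torsion_apply hX hY
  have h2 := hc.torsion_apply_eq_extend (X x) (Y x)
  rw [mlieBracket_extend, leviCivita_extend_comm g x (Y x) (X x), sub_self, sub_zero] at h2
  rw [h2] at h1
  exact sub_eq_zero.1 h1.symm

end Riemannian

end

end TractorGeometry

namespace TractorGeometry

noncomputable section

/-! ### Smoothness of the Levi-Civita connection. -/

section LeviCivitaSmooth

variable {E : Type*} [NormedAddCommGroup E] [NormedSpace ℝ E] [FiniteDimensional ℝ E]
  {H : Type*} [TopologicalSpace H] {I : ModelWithCorners ℝ E H} [I.Boundaryless]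
  {M : Type*} [TopologicalSpace M] [ChartedSpace H M] [IsManifold I ∞ M]
  (g : ContMDiffRiemannianMetric I ∞ E (TangentSpace I : M → Type _))

theorem contMDiffAt_mvfderiv_apply {f : M → ℝ} {X : Π y : M, TangentSpace I y} {x : M}
    (hf : ContMDiffAt I 𝓘(ℝ) ∞ f x)
    (hX : ContMDiffAt I (I.prod 𝓘(ℝ, E)) ∞ (fun y ↦ TotalSpace.mk' E y (X y)) x) :
    ContMDiffAt I 𝓘(ℝ) ∞ (fun y ↦ mvfderiv I f y (X y)) x := by
  have h1 := hf.mfderiv_const (m := ∞) (by simp)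
  have h2 := ContMDiffAt.clm_apply_of_inCoordinates (F₁ := E) (F₂ := ℝ)
    (E₁ := (TangentSpace I : M → Type _)) (E₂ := (TangentSpace 𝓘(ℝ) : ℝ → Type _))
    (b₁ := id) (b₂ := f) (ϕ := fun y ↦ mfderiv I 𝓘(ℝ) f y) (v := X) h1 hX hf
  exact (contMDiff_snd_tangentBundle_modelSpace ℝ 𝓘(ℝ) (n := ∞)).contMDiffAt.comp x h2

theorem eventually_mdifferentiableAt {F : Type*} [NormedAddCommGroup F] [NormedSpace ℝ F]
    {V : M → Type*} [TopologicalSpace (TotalSpace F V)]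
    [∀ x, AddCommGroup (V x)] [∀ x, Module ℝ (V x)] [∀ x, TopologicalSpace (V x)]
    [FiberBundle F V] [VectorBundle ℝ F V] [ContMDiffVectorBundle ∞ F V I]
    {s : Π y : M, V y} {x : M}
    (hs : ContMDiffAt I (I.prod 𝓘(ℝ, F)) ∞ (fun y ↦ TotalSpace.mk' F y (s y)) x) :
    ∀ᶠ y in 𝓝 x, MDifferentiableAt I (I.prod 𝓘(ℝ, F)) (fun y ↦ TotalSpace.mk' F y (s y)) y := by
  have : IsManifold I 1 M := IsManifold.of_le (n := ∞) (by norm_cast)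
  have : ContMDiffVectorBundle 1 F V I := ContMDiffVectorBundle.of_le (n := ∞) (by norm_cast)
  have h1 : ContMDiffAt I (I.prod 𝓘(ℝ, F)) 1 (fun y ↦ TotalSpace.mk' F y (s y)) x :=
    hs.of_le (by norm_cast)
  exact ((contMDiffAt_iff_contMDiffAt_nhds (by simp)).1 h1).mono fun y hy ↦ hy.mdifferentiableAt (by simp)

/-- Compatibility and vanishing torsion express the connection by derivatives and brackets of
globally meaningful fields. The right-hand side does not mention the chart at `x`, so it can be
followed as the point moves. -/
theorem koszul {x : M} {X Y Z : Π y : M, TangentSpace I y}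
    (hX : MDifferentiableAt I (I.prod 𝓘(ℝ, E)) (fun y ↦ TotalSpace.mk' E y (X y)) x)
    (hY : MDifferentiableAt I (I.prod 𝓘(ℝ, E)) (fun y ↦ TotalSpace.mk' E y (Y y)) x)
    (hZ : MDifferentiableAt I (I.prod 𝓘(ℝ, E)) (fun y ↦ TotalSpace.mk' E y (Z y)) x) :
    g.inner x (leviCivita I g.inner Y x (X x)) (Z x) = 1 / 2 * (
      mvfderiv I (fun y ↦ g.inner y (Y y) (Z y)) x (X x) +
      mvfderiv I (fun y ↦ g.inner y (X y) (Z y)) x (Y x) -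
      mvfderiv I (fun y ↦ g.inner y (X y) (Y y)) x (Z x) +
      g.inner x (VectorField.mlieBracket I X Y x) (Z x) -
      g.inner x (VectorField.mlieBracket I X Z x) (Y x) -
      g.inner x (VectorField.mlieBracket I Y Z x) (X x)) := by
  rw [← leviCivita_sub_leviCivita g hX hY, ← leviCivita_sub_leviCivita g hX hZ,
    ← leviCivita_sub_leviCivita g hY hZ, mvfderiv_inner g hY hZ, mvfderiv_inner g hX hZ,
    mvfderiv_inner g hX hY]
  simp only [map_sub, sub_apply]
  rw [g.symm x (Y x) (leviCivita I g.inner Z x (X x)),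
    g.symm x (X x) (leviCivita I g.inner Z x (Y x)),
    g.symm x (X x) (leviCivita I g.inner Y x (Z x))]
  ring

/-- The metric identifies vectors with covectors. In a fixed chart the inverse of this
identification depends smoothly on the point, because inversion of linear maps is smooth at an
invertible one. -/
theorem contMDiffAt_of_inner {s : Π y : M, TangentSpace I y} {x : M}
    (h : ∀ z : TangentSpace I x,
      ContMDiffAt I 𝓘(ℝ) ∞ (fun y ↦ g.inner y (s y) (FiberBundle.extend E z y)) x) :
    ContMDiffAt I (I.prod 𝓘(ℝ, E)) ∞ (fun y ↦ TotalSpace.mk' E y (s y)) x := by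
  rw [contMDiffAt_section]
  change ContMDiffAt I 𝓘(ℝ, E) ∞ (tangentCoord I s x) x
  have h1 : ContMDiffAt I 𝓘(ℝ, E →L[ℝ] ℝ) ∞
      (fun y ↦ metricCoord I g.inner x y (tangentCoord I s x y)) x := by
    refine contMDiffAt_clm_of_apply fun w ↦ ?_
    refine (h ((tangentTriv I x).symmL ℝ x w)).congr_of_eventuallyEq ?_
    filter_upwards [eventually_mem_tangentTriv (I := I) x] with y hy
    rw [inner_eq_metricCoord_tangentCoord g s _ hy, tangentCoord_apply _ hy, tangentCoord_apply _ hy,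
      extend_symmL _ hy, Trivialization.continuousLinearMapAt_symmL _ hy]
  obtain ⟨B, hB⟩ := exists_equiv_of_nondegenerate _ (metricCoord_nondegenerate g x)
  have h2 : ContMDiffAt I 𝓘(ℝ, (E →L[ℝ] ℝ) →L[ℝ] E) ∞
      (fun y ↦ (metricCoord I g.inner x y).inverse) x := by
    have h3 := contDiffAt_map_inverse (𝕜 := ℝ) (n := ∞) B
    rw [hB] at h3
    exact h3.contMDiffAt.comp x (contMDiffAt_metricCoord g x)
  refine (h2.clm_apply h1).congr_of_eventuallyEq ?_
  filter_upwards [eventually_mem_tangentTriv (I := I) x] with y hy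
  obtain ⟨B, hB⟩ := exists_equiv_of_nondegenerate _ (metricCoord_nondegenerate' g hy)
  rw [← hB, ContinuousLinearMap.inverse_equiv]
  exact (B.symm_apply_apply _).symm

/-- The Levi-Civita connection is smooth. -/
theorem contMDiffAt_leviCivita {σ : Π y : M, TangentSpace I y} {x : M}
    (hσ : ContMDiffAt I (I.prod 𝓘(ℝ, E)) ∞ (fun y ↦ TotalSpace.mk' E y (σ y)) x) :
    ContMDiffAt I (I.prod 𝓘(ℝ, E →L[ℝ] E)) ∞ (fun y ↦ TotalSpace.mk' (E →L[ℝ] E)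
      (E := fun y : M ↦ TangentSpace I y →L[ℝ] TangentSpace I y) y
        (leviCivita I g.inner σ y)) x := by
  have : IsManifold I (minSmoothness ℝ 2) M :=
    IsManifold.of_le (n := ∞) (by simp; norm_cast)
  have : IsManifold I (((⊤ : ℕ∞) : ℕ∞ω) + 1) M := ‹IsManifold I ∞ M›
  -- Smoothness is tested on the constant extension of `w` as direction and paired with that of `z`;
  -- the Koszul formula then holds on a whole neighbourhood.
  refine contMDiffAt_hom_of_extend fun w ↦ contMDiffAt_of_inner g fun z ↦ ?_
  have hX := FiberBundle.contMDiffAt_extend (k := ∞) I E w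
  have hZ := FiberBundle.contMDiffAt_extend (k := ∞) I E z
  have hb : ∀ {X Y : Π y : M, TangentSpace I y},
      ContMDiffAt I (I.prod 𝓘(ℝ, E)) ∞ (fun y ↦ TotalSpace.mk' E y (X y)) x →
      ContMDiffAt I (I.prod 𝓘(ℝ, E)) ∞ (fun y ↦ TotalSpace.mk' E y (Y y)) x →
      ContMDiffAt I (I.prod 𝓘(ℝ, E)) ∞
        (fun y ↦ TotalSpace.mk' E y (VectorField.mlieBracket I X Y y)) x :=
    fun hX hY ↦ ContMDiffAt.mlieBracket_vectorField (m := ⊤) (n := ⊤) hX hY (by simp)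
  have hi : ∀ {X Y : Π y : M, TangentSpace I y},
      ContMDiffAt I (I.prod 𝓘(ℝ, E)) ∞ (fun y ↦ TotalSpace.mk' E y (X y)) x →
      ContMDiffAt I (I.prod 𝓘(ℝ, E)) ∞ (fun y ↦ TotalSpace.mk' E y (Y y)) x →
      ContMDiffAt I 𝓘(ℝ) ∞ (fun y ↦ g.inner y (X y) (Y y)) x :=
    fun hX hY ↦ contMDiffAt_inner g le_rfl hX hY
  have hrhs := contMDiffAt_const (c := (1 / 2 : ℝ)).mul
    ((((((contMDiffAt_mvfderiv_apply (hi hσ hZ) hX).add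
      (contMDiffAt_mvfderiv_apply (hi hX hZ) hσ)).sub
      (contMDiffAt_mvfderiv_apply (hi hX hσ) hZ)).add
      (hi (hb hX hσ) hZ)).sub (hi (hb hX hZ) hσ)).sub (hi (hb hσ hZ) hX))
  refine hrhs.congr_of_eventuallyEq ?_
  filter_upwards [eventually_mdifferentiableAt hX, eventually_mdifferentiableAt hσ,
    eventually_mdifferentiableAt hZ] with y h1 h2 h3
  exact koszul g h1 h2 h3

theorem contMDiffAt_leviCivita_apply {σ X : Π y : M, TangentSpace I y} {x : M}
    (hσ : ContMDiffAt I (I.prod 𝓘(ℝ, E)) ∞ (fun y ↦ TotalSpace.mk' E y (σ y)) x)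
    (hX : ContMDiffAt I (I.prod 𝓘(ℝ, E)) ∞ (fun y ↦ TotalSpace.mk' E y (X y)) x) :
    ContMDiffAt I (I.prod 𝓘(ℝ, E)) ∞
      (fun y ↦ TotalSpace.mk' E y (leviCivita I g.inner σ y (X y))) x :=
  (contMDiffAt_leviCivita g hσ).clm_bundle_apply hX

theorem contMDiffAt_leviCivita_extend {x : M} (z w : TangentSpace I x) :
    ContMDiffAt I (I.prod 𝓘(ℝ, E)) ∞ (fun y ↦ TotalSpace.mk' E y
      (leviCivita I g.inner (FiberBundle.extend E z) y (FiberBundle.extend E w y))) x :=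
  contMDiffAt_leviCivita_apply g (FiberBundle.contMDiffAt_extend I E z)
    (FiberBundle.contMDiffAt_extend I E w)

theorem mdifferentiableAt_leviCivita_extend {x : M} (z w : TangentSpace I x) :
    MDifferentiableAt I (I.prod 𝓘(ℝ, E)) (fun y ↦ TotalSpace.mk' E y
      (leviCivita I g.inner (FiberBundle.extend E z) y (FiberBundle.extend E w y))) x :=
  (contMDiffAt_leviCivita_extend g z w).mdifferentiableAt (by simp)

theorem leviCivita_congr {G : Π x : M, TangentSpace I x →L[ℝ] TangentSpace I x →L[ℝ] ℝ}
    {σ τ : Π y : M, TangentSpace I y} {x : M} (h : ∀ᶠ y in 𝓝 x, σ y = τ y) :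
    leviCivita I G σ x = leviCivita I G τ x := by
  have h1 : tangentCoord I σ x =ᶠ[𝓝 x] tangentCoord I τ x := by
    filter_upwards [h] with y hy
    rw [tangentCoord, tangentCoord, hy]
  ext v
  rw [leviCivita_apply, leviCivita_apply, mvfderiv_congr h1, h1.self_of_nhds]

end LeviCivitaSmooth

/-! ### Linearity and symmetries of the curvature. -/

section Curvature

variable {E : Type*} [NormedAddCommGroup E] [NormedSpace ℝ E] [FiniteDimensional ℝ E]
  {H : Type*} [TopologicalSpace H] {I : ModelWithCorners ℝ E H} [I.Boundaryless]
  {M : Type*} [TopologicalSpace M] [ChartedSpace H M] [IsManifold I ∞ M]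

theorem curvature_eq (F : Type*) [NormedAddCommGroup F] [NormedSpace ℝ F]
    {V : M → Type*} [TopologicalSpace (TotalSpace F V)]
    [∀ x, AddCommGroup (V x)] [∀ x, Module ℝ (V x)] [∀ x, TopologicalSpace (V x)]
    [FiberBundle F V] (cov : (Π x : M, V x) → (Π x : M, TangentSpace I x →L[ℝ] V x))
    (x : M) (v w : TangentSpace I x) (s : V x) : curvature I F cov x v w s =
      cov (fun y ↦ cov (FiberBundle.extend F s) y (FiberBundle.extend E w y)) x v -
      cov (fun y ↦ cov (FiberBundle.extend F s) y (FiberBundle.extend E v y)) x w := by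
  simp only [curvature]
  rw [mlieBracket_extend, map_zero, sub_zero]

variable (g : ContMDiffRiemannianMetric I ∞ E (TangentSpace I : M → Type _))

theorem curvature_antisymm (x : M) (v w z : TangentSpace I x) :
    curvature I E (leviCivita I g.inner) x v w z =
      -curvature I E (leviCivita I g.inner) x w v z := by
  rw [curvature_eq, curvature_eq, neg_sub]

theorem curvature_add_left (x : M) (v v' w z : TangentSpace I x) :
    curvature I E (leviCivita I g.inner) x (v + v') w z =
      curvature I E (leviCivita I g.inner) x v w z +
        curvature I E (leviCivita I g.inner) x v' w z := by
  have h : ∀ᶠ y in 𝓝 x, leviCivita I g.inner (FiberBundle.extend E z) y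
      (FiberBundle.extend E (v + v') y) =
      ((fun y ↦ leviCivita I g.inner (FiberBundle.extend E z) y (FiberBundle.extend E v y)) +
        fun y ↦ leviCivita I g.inner (FiberBundle.extend E z) y
          (FiberBundle.extend E v' y)) y := by
    filter_upwards [eventually_mem_tangentTriv (I := I) x] with y hy
    rw [extend_add hy, map_add, Pi.add_apply]
  rw [curvature_eq, curvature_eq, curvature_eq, leviCivita_congr h,
    isCovariantDerivativeOn_leviCivita.add (mdifferentiableAt_leviCivita_extend g z v)
      (mdifferentiableAt_leviCivita_extend g z v'), map_add, add_apply]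
  abel

theorem curvature_smul_left (x : M) (c : ℝ) (v w z : TangentSpace I x) :
    curvature I E (leviCivita I g.inner) x (c • v) w z =
      c • curvature I E (leviCivita I g.inner) x v w z := by
  have h : ∀ᶠ y in 𝓝 x, leviCivita I g.inner (FiberBundle.extend E z) y
      (FiberBundle.extend E (c • v) y) =
      (c • fun y ↦ leviCivita I g.inner (FiberBundle.extend E z) y
        (FiberBundle.extend E v y)) y := by
    filter_upwards [eventually_mem_tangentTriv (I := I) x] with y hy
    rw [extend_smul hy, map_smul, Pi.smul_apply]
  rw [curvature_eq, curvature_eq, leviCivita_congr h,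
    isCovariantDerivativeOn_leviCivita.smul_const c (mdifferentiableAt_leviCivita_extend g z v),
    map_smul, smul_apply, smul_sub]

theorem curvature_smul_right (x : M) (c : ℝ) (v w z : TangentSpace I x) :
    curvature I E (leviCivita I g.inner) x v w (c • z) =
      c • curvature I E (leviCivita I g.inner) x v w z := by
  have h : ∀ w : TangentSpace I x, ∀ᶠ y in 𝓝 x,
      leviCivita I g.inner (FiberBundle.extend E (c • z)) y (FiberBundle.extend E w y) =
      (c • fun y ↦ leviCivita I g.inner (FiberBundle.extend E z) y
        (FiberBundle.extend E w y)) y := by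
    intro w
    -- The inner derivative is differentiated once more, so it has to be known near `x`. This
    -- requires the extensions to agree near each nearby `y`.
    filter_upwards [(eventually_mem_tangentTriv (I := I) x).eventually_nhds,
      eventually_mdifferentiableAt (FiberBundle.contMDiffAt_extend (k := ∞) I E z)] with y hy h1
    have h3 : ∀ᶠ q in 𝓝 y, FiberBundle.extend E (c • z) q = (c • FiberBundle.extend E z) q := by
      filter_upwards [hy] with q hq
      rw [extend_smul hq, Pi.smul_apply]
    rw [leviCivita_congr h3, isCovariantDerivativeOn_leviCivita.smul_const c h1]
    rfl
  rw [curvature_eq, curvature_eq, leviCivita_congr (h w), leviCivita_congr (h v),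
    isCovariantDerivativeOn_leviCivita.smul_const c (mdifferentiableAt_leviCivita_extend g z v),
    isCovariantDerivativeOn_leviCivita.smul_const c (mdifferentiableAt_leviCivita_extend g z w),
    smul_apply, smul_apply, smul_sub]

/-- The Riemann curvature operators are skew-adjoint. -/
theorem inner_curvature_skew (x : M) (v w z z' : TangentSpace I x) :
    g.inner x (curvature I E (leviCivita I g.inner) x v w z) z' =
      -g.inner x z (curvature I E (leviCivita I g.inner) x v w z') := by
  have hz := FiberBundle.contMDiffAt_extend (k := ∞) I E z
  have hz' := FiberBundle.contMDiffAt_extend (k := ∞) I E z'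
  have hmz := hz.mdifferentiableAt (by simp)
  have hmz' := hz'.mdifferentiableAt (by simp)
  -- Metric compatibility is used twice to differentiate `g(z, z')`. The mixed terms are symmetric
  -- in `v` and `w`, and so is the left-hand side because coordinate derivatives commute; the
  -- difference leaves the two curvature terms.
  have key : ∀ v w : TangentSpace I x,
      mvfderiv I (fun y ↦ mvfderiv I (fun q ↦ g.inner q (FiberBundle.extend E z q)
        (FiberBundle.extend E z' q)) y (FiberBundle.extend E w y)) x v =
      g.inner x (leviCivita I g.inner (fun y ↦ leviCivita I g.inner (FiberBundle.extend E z) y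
        (FiberBundle.extend E w y)) x v) z' +
      g.inner x (leviCivita I g.inner (FiberBundle.extend E z) x w)
        (leviCivita I g.inner (FiberBundle.extend E z') x v) +
      (g.inner x (leviCivita I g.inner (FiberBundle.extend E z) x v)
        (leviCivita I g.inner (FiberBundle.extend E z') x w) +
      g.inner x z (leviCivita I g.inner (fun y ↦ leviCivita I g.inner (FiberBundle.extend E z') y
        (FiberBundle.extend E w y)) x v)) := by
    intro v w
    have h : (fun y ↦ mvfderiv I (fun q ↦ g.inner q (FiberBundle.extend E z q)
        (FiberBundle.extend E z' q)) y (FiberBundle.extend E w y)) =ᶠ[𝓝 x] fun y ↦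
        g.inner y (leviCivita I g.inner (FiberBundle.extend E z) y (FiberBundle.extend E w y))
          (FiberBundle.extend E z' y) +
        g.inner y (FiberBundle.extend E z y)
          (leviCivita I g.inner (FiberBundle.extend E z') y (FiberBundle.extend E w y)) := by
      filter_upwards [eventually_mdifferentiableAt hz, eventually_mdifferentiableAt hz']
        with y h1 h2
      exact mvfderiv_inner g h1 h2 _
    have h1 := mdifferentiableAt_leviCivita_extend g z w
    have h2 := mdifferentiableAt_leviCivita_extend g z' w
    rw [mvfderiv_congr h, mvfderiv_fun_add (mdifferentiableAt_inner g h1 hmz')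
      (mdifferentiableAt_inner g hmz h2), add_apply, mvfderiv_inner g h1 hmz',
      mvfderiv_inner g hmz h2]
    simp only [FiberBundle.extend_apply_self]
  have hf : ContMDiffAt I 𝓘(ℝ) 2 (fun q ↦ g.inner q (FiberBundle.extend E z q)
        (FiberBundle.extend E z' q)) x :=
    (contMDiffAt_inner g le_rfl hz hz').of_le (by norm_cast)
  have hcomm := mvfderiv_mvfderiv_extend_comm hf v w
  rw [key, key] at hcomm
  rw [curvature_eq, curvature_eq]
  simp only [map_sub, sub_apply]
  linarith

end Curvature

end

end TractorGeometry

namespace TractorGeometry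

noncomputable section

/-! ### Coordinates on the ambient manifold. -/

section OpensReal

variable (U : TopologicalSpace.Opens ℝ) (p q : U)

/-- The preferred chart of an open subset of `ℝ` is the inclusion, and a chart has identity
derivative at its own base point. -/
theorem hasMFDerivAt_subtypeVal :
    HasMFDerivAt 𝓘(ℝ, ℝ) 𝓘(ℝ, ℝ) (Subtype.val : U → ℝ) p (ContinuousLinearMap.id ℝ ℝ) := by
  have h := (mdifferentiableAt_extChartAt (I := 𝓘(ℝ, ℝ)) (mem_chart_source ℝ p)).hasMFDerivAt
  rw [mfderiv_extChartAt_self] at h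
  exact h

end OpensReal

section ProductModel

variable {E : Type*} [NormedAddCommGroup E] [NormedSpace ℝ E]
  {H : Type*} [TopologicalSpace H] {I : ModelWithCorners ℝ E H}
  {M : Type*} [TopologicalSpace M] [ChartedSpace H M]
  {F₁ : Type*} [NormedAddCommGroup F₁] [NormedSpace ℝ F₁]
  {F₂ : Type*} [NormedAddCommGroup F₂] [NormedSpace ℝ F₂]
  {F₃ : Type*} [NormedAddCommGroup F₃] [NormedSpace ℝ F₃]

/-- The product of the trivial models and the trivial model of the product give the same coordinate
expressions, so the data of the derivative carry over unchanged. -/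
theorem HasMFDerivAt.of_prod_space {f : M → F₁ × F₂ × F₃} {x : M} {f' : E →L[ℝ] F₁ × F₂ × F₃}
    (h : HasMFDerivAt I (𝓘(ℝ, F₁).prod (𝓘(ℝ, F₂).prod 𝓘(ℝ, F₃))) f x f') :
    HasMFDerivAt I 𝓘(ℝ, F₁ × F₂ × F₃) f x f' :=
  ⟨h.1, h.2⟩

end ProductModel

section AmbientVectors

variable {n : ℕ} {M : Type*} [TopologicalSpace M] [ChartedSpace (EuclideanSpace ℝ (Fin n)) M]
  {δ : ℝ}

/-- The tangent vector `a ∂_t + b ∂_r + z` of the ambient manifold. -/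
def ambientVec (p : Ambient δ M) (a b : ℝ) (z : TangentSpace (𝓡 n) p.2.2) :
    TangentSpace (ambientModel n) p :=
  ((a, b, z) : AmbientVec n)

section

variable (p : Ambient δ M) (a b a' b' c : ℝ) (z z' : TangentSpace (𝓡 n) p.2.2)

@[simp] theorem dt_ambientVec : dt p (ambientVec p a b z) = a := rfl

@[simp] theorem dr_ambientVec : dr p (ambientVec p a b z) = b := rfl

@[simp] theorem dproj_ambientVec : dproj p (ambientVec p a b z) = z := rfl

theorem ambientVec_eta (v : TangentSpace (ambientModel n) p) :
    ambientVec p (dt p v) (dr p v) (dproj p v) = v := rfl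

end

theorem ambient_ext {p : Ambient δ M} {v w : TangentSpace (ambientModel n) p}
    (h₁ : dt p v = dt p w) (h₂ : dr p v = dr p w) (h₃ : dproj p v = dproj p w) : v = w := by
  rw [← ambientVec_eta p v, ← ambientVec_eta p w, h₁, h₂, h₃]

variable [IsManifold (𝓡 n) ∞ M]

/-- The charts of the `t` and `r` factors are defined everywhere on those factors; only the `M`
factor restricts the domain. -/
theorem mem_tangentTriv_ambient {p q : Ambient δ M} :
    q ∈ (tangentTriv (ambientModel n) p).baseSet ↔ q.2.2 ∈ (tangentTriv (𝓡 n) p.2.2).baseSet := by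
  change q ∈ (chartAt _ p).source ↔ q.2.2 ∈ (chartAt _ p.2.2).source
  simp [prodChartedSpace_chartAt, TopologicalSpace.Opens.chartAt_eq, chartAt_self_eq]

/-- The charts in `t` and `r` are inclusions, with derivative the identity, so a change of
coordinates acts on the `M`-component alone. -/
theorem continuousLinearMapAt_ambient {p q : Ambient δ M}
    (hq : q.2.2 ∈ (tangentTriv (𝓡 n) p.2.2).baseSet) (a b : ℝ) (z : TangentSpace (𝓡 n) q.2.2) :
    (tangentTriv (ambientModel n) p).continuousLinearMapAt ℝ q (ambientVec q a b z) =
      (a, b, (tangentTriv (𝓡 n) p.2.2).continuousLinearMapAt ℝ q.2.2 z) := by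
  have hq' := mem_tangentTriv_ambient.2 hq
  rw [TangentBundle.continuousLinearMapAt_trivializationAt hq',
    TangentBundle.continuousLinearMapAt_trivializationAt hq]
  have h0 : ∀ (U : TopologicalSpace.Opens ℝ) (t : U),
      mfderiv 𝓘(ℝ, ℝ) 𝓘(ℝ, ℝ) (Subtype.val : U → ℝ) t = ContinuousLinearMap.id ℝ ℝ :=
    fun U t ↦ (hasMFDerivAt_subtypeVal U t).mfderiv
  have h1 : ∀ (U : TopologicalSpace.Opens ℝ) (t : U),
      MDifferentiableAt 𝓘(ℝ, ℝ) 𝓘(ℝ, ℝ) (Subtype.val : U → ℝ) t :=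
    fun U t ↦ (hasMFDerivAt_subtypeVal U t).mdifferentiableAt
  have h2 := mdifferentiableAt_extChartAt (I := 𝓡 n) hq
  have h3 : (extChartAt (ambientModel n) p : Ambient δ M → AmbientVec n) =
      Prod.map Subtype.val (Prod.map Subtype.val (extChartAt (𝓡 n) p.2.2)) := by
    rw [extChartAt_prod, extChartAt_prod]
    rfl
  let D : EuclideanSpace ℝ (Fin n) →L[ℝ] EuclideanSpace ℝ (Fin n) :=
    mfderiv (𝓡 n) 𝓘(ℝ, EuclideanSpace ℝ (Fin n)) (extChartAt (𝓡 n) p.2.2) q.2.2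
  have h4 : HasMFDerivAt (ambientModel n) 𝓘(ℝ, AmbientVec n) (extChartAt (ambientModel n) p) q
      ((ContinuousLinearMap.id ℝ ℝ).prodMap ((ContinuousLinearMap.id ℝ ℝ).prodMap D) :
        AmbientVec n →L[ℝ] AmbientVec n) := by
    have h5 := mfderiv_prodMap (p := q.2) (h1 _ q.2.1) h2
    have h6 := ((hasMFDerivAt_subtypeVal posReals q.1).prodMap
      (p := q) ((h1 _ q.2.1).prodMap (y := q.2.2) h2).hasMFDerivAt)
    rw [h0] at h5 h6
    rw [h3]
    refine HasMFDerivAt.of_prod_space ?_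
    have h7 := congrArg (fun L : ℝ × EuclideanSpace ℝ (Fin n) →L[ℝ]
      ℝ × EuclideanSpace ℝ (Fin n) ↦ (ContinuousLinearMap.id ℝ ℝ).prodMap L) h5
    exact h7 ▸ h6
  exact congrArg (fun L : AmbientVec n →L[ℝ] AmbientVec n ↦ L (a, b, z)) h4.mfderiv

theorem symmL_ambient {p q : Ambient δ M}
    (hq : q.2.2 ∈ (tangentTriv (𝓡 n) p.2.2).baseSet) (a b : ℝ) (z : EuclideanSpace ℝ (Fin n)) :
    (tangentTriv (ambientModel n) p).symmL ℝ q (a, b, z) =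
      ambientVec q a b ((tangentTriv (𝓡 n) p.2.2).symmL ℝ q.2.2 z) := by
  have h := continuousLinearMapAt_ambient hq a b ((tangentTriv (𝓡 n) p.2.2).symmL ℝ q.2.2 z)
  rw [Trivialization.continuousLinearMapAt_symmL _ hq] at h
  rw [← h, Trivialization.symmL_continuousLinearMapAt _ (mem_tangentTriv_ambient.2 hq)]

theorem ambientMetric_ambientVec
    (g : ContMDiffRiemannianMetric (𝓡 n) ∞ (EuclideanSpace ℝ (Fin n))
      (TangentSpace (𝓡 n) : M → Type _))
    (γ : ℝ → Π x : M, TangentSpace (𝓡 n) x →L[ℝ] TangentSpace (𝓡 n) x) (p : Ambient δ M)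
    (a b a' b' : ℝ) (z z' : TangentSpace (𝓡 n) p.2.2) :
    ambientMetric g γ p (ambientVec p a b z) (ambientVec p a' b' z') =
      (p.2.1 * a + p.1 * b) * a' + a * (p.2.1 * a' + p.1 * b') +
        (p.1 : ℝ) ^ 2 * g.inner p.2.2 (γ p.2.1 p.2.2 z) z' := rfl

end AmbientVectors

/-! ### Derivatives of functions on the ambient manifold. -/

section AmbientDerivatives

variable {n : ℕ} {M : Type*} [TopologicalSpace M] [ChartedSpace (EuclideanSpace ℝ (Fin n)) M]
  [IsManifold (𝓡 n) ∞ M] {δ : ℝ}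

theorem hasMFDerivAt_ambient_t (p : Ambient δ M) :
    HasMFDerivAt (ambientModel n) 𝓘(ℝ, ℝ) (fun q : Ambient δ M ↦ (q.1 : ℝ)) p (dt p) :=
  (hasMFDerivAt_subtypeVal posReals p.1).comp p (hasMFDerivAt_fst p)

theorem hasMFDerivAt_ambient_r (p : Ambient δ M) :
    HasMFDerivAt (ambientModel n) 𝓘(ℝ, ℝ) (fun q : Ambient δ M ↦ (q.2.1 : ℝ)) p (dr p) :=
  (hasMFDerivAt_subtypeVal (symInterval δ) p.2.1).comp (I := ambientModel n)
    (f := fun q : Ambient δ M ↦ q.2.1) p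
    ((hasMFDerivAt_fst (I := 𝓘(ℝ, ℝ)) (I' := 𝓡 n) p.2).comp (f := fun q : Ambient δ M ↦ q.2) p
      (hasMFDerivAt_snd (I := 𝓘(ℝ, ℝ)) (I' := 𝓘(ℝ, ℝ).prod (𝓡 n)) p))

theorem hasMFDerivAt_ambient_proj (p : Ambient δ M) :
    HasMFDerivAt (ambientModel n) (𝓡 n) (fun q : Ambient δ M ↦ q.2.2) p (dproj p) :=
  (hasMFDerivAt_snd (I := 𝓘(ℝ, ℝ)) (I' := 𝓡 n) p.2).comp (f := fun q : Ambient δ M ↦ q.2) p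
    (hasMFDerivAt_snd (I := 𝓘(ℝ, ℝ)) (I' := 𝓘(ℝ, ℝ).prod (𝓡 n)) p)

/-- Meant for the components of `g(γ(r) ·, ·)`, which do not involve `t`: the derivative splits into
an `r`-part, where `γ̇(0)` will appear, and a part along `M`. -/
theorem mvfderiv_comp_ambient {F : Type*} [NormedAddCommGroup F] [NormedSpace ℝ F]
    {f : ℝ × M → F} {p : Ambient δ M}
    (hf : MDifferentiableAt (𝓘(ℝ, ℝ).prod (𝓡 n)) 𝓘(ℝ, F) f ((p.2.1 : ℝ), p.2.2))
    (v : TangentSpace (ambientModel n) p) :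
    mvfderiv (ambientModel n) (fun q : Ambient δ M ↦ f ((q.2.1 : ℝ), q.2.2)) p v =
      dr p v • deriv (fun r ↦ f (r, p.2.2)) p.2.1 +
        mvfderiv (𝓡 n) (fun y ↦ f ((p.2.1 : ℝ), y)) p.2.2 (dproj p v) := by
  have h1 := (hasMFDerivAt_ambient_r (n := n) p).prodMk (hasMFDerivAt_ambient_proj (n := n) p)
  have h2 := hf.hasMFDerivAt.comp p h1
  let w : TangentSpace (𝓘(ℝ, ℝ).prod (𝓡 n)) ((p.2.1 : ℝ), p.2.2) :=
    show ℝ × EuclideanSpace ℝ (Fin n) from (dr p v, dproj p v)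
  have h3 := mfderiv_prod_eq_add_apply hf (v := w)
  have h4 := congrArg (fun L : AmbientVec n →L[ℝ] F ↦ L v) (mvfderiv_eq_of_hasMFDerivAt h2)
  have h5 : mfderiv 𝓘(ℝ, ℝ) 𝓘(ℝ, F) (fun r ↦ f (r, p.2.2)) p.2.1 =
      fderiv ℝ (fun r ↦ f (r, p.2.2)) p.2.1 := mfderiv_eq_fderiv
  have h6 : mfderiv 𝓘(ℝ, ℝ) 𝓘(ℝ, F) (fun r ↦ f (r, p.2.2)) p.2.1 w.1 =
      dr p v • deriv (fun r ↦ f (r, p.2.2)) p.2.1 :=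
    (congrArg (fun L : ℝ →L[ℝ] F ↦ L (dr p v)) h5).trans (fderiv_eq_smul_deriv _)
  exact h4.trans (h3.trans (congrArg₂ (fun a b : F ↦ a + b) h6 rfl))

end AmbientDerivatives

end

end TractorGeometry

namespace TractorGeometry

noncomputable section

/-! ### The family `γ` in a fixed chart and its derivative at `r = 0`. -/

section AdmissibleFamily

variable {n : ℕ} {M : Type*} [TopologicalSpace M] [ChartedSpace (EuclideanSpace ℝ (Fin n)) M]
  [IsManifold (𝓡 n) ∞ M]
  {g : ContMDiffRiemannianMetric (𝓡 n) ∞ (EuclideanSpace ℝ (Fin n))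
      (TangentSpace (𝓡 n) : M → Type _)}
  {γ : ℝ → Π x : M, TangentSpace (𝓡 n) x →L[ℝ] TangentSpace (𝓡 n) x} {δ : ℝ}

/-- The components of `γ(r)` at `y` in the chart at `x`, as a function of `(r, y)`. -/
def gammaCoord (γ : ℝ → Π x : M, TangentSpace (𝓡 n) x →L[ℝ] TangentSpace (𝓡 n) x) (x : M)
    (q : ℝ × M) : EuclideanSpace ℝ (Fin n) →L[ℝ] EuclideanSpace ℝ (Fin n) :=
  (tangentTriv (𝓡 n) x).continuousLinearMapAt ℝ q.2 ∘L γ q.1 q.2 ∘L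
    (tangentTriv (𝓡 n) x).symmL ℝ q.2

theorem gammaCoord_apply (x : M) (q : ℝ × M) (v : EuclideanSpace ℝ (Fin n)) :
    gammaCoord γ x q v = (tangentTriv (𝓡 n) x).continuousLinearMapAt ℝ q.2
      (γ q.1 q.2 ((tangentTriv (𝓡 n) x).symmL ℝ q.2 v)) := rfl

theorem IsAdmissible.contMDiffAt_gammaCoord (hγ : IsAdmissible g γ δ) (x : M) (r : ℝ) :
    ContMDiffAt (𝓘(ℝ, ℝ).prod (𝓡 n))
      𝓘(ℝ, EuclideanSpace ℝ (Fin n) →L[ℝ] EuclideanSpace ℝ (Fin n)) ∞ (gammaCoord γ x) (r, x) :=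
  ((contMDiffAt_hom_bundle _).1 (hγ.smooth (r, x))).2

theorem gammaCoord_self (x : M) (r : ℝ) : gammaCoord γ x (r, x) =
    (γ r x : EuclideanSpace ℝ (Fin n) →L[ℝ] EuclideanSpace ℝ (Fin n)) := by
  rw [gammaCoord, continuousLinearMapAt_tangent_self, symmL_tangent_self]
  rfl

theorem IsAdmissible.gammaCoord_zero (hγ : IsAdmissible g γ δ) {x y : M}
    (hy : y ∈ (tangentTriv (𝓡 n) x).baseSet) :
    gammaCoord γ x (0, y) = ContinuousLinearMap.id ℝ _ := by
  ext1 v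
  rw [gammaCoord_apply, hγ.at_zero]
  exact Trivialization.continuousLinearMapAt_symmL _ hy v

/-- `gammaDot` is a `deriv`, hence meaningful only once `r ↦ γ r x` is known to be differentiable;
joint smoothness of the components in the chart at `x` supplies this. -/
theorem IsAdmissible.hasDerivAt_inner (hγ : IsAdmissible g γ δ) (x : M)
    (v w : TangentSpace (𝓡 n) x) :
    HasDerivAt (fun r ↦ g.inner x (γ r x v) w) (g.inner x (gammaDot γ x v) w) 0 := by
  have h1 : DifferentiableAt ℝ (fun r ↦ gammaCoord γ x (r, x)) 0 := by
    have h2 : ContMDiffAt 𝓘(ℝ, ℝ) _ ∞ (fun r ↦ gammaCoord γ x (r, x)) 0 :=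
      (hγ.contMDiffAt_gammaCoord x 0).comp (I := 𝓘(ℝ, ℝ)) (f := fun r : ℝ ↦ (r, x)) 0
        (contMDiffAt_id.prodMk contMDiffAt_const)
    exact h2.contDiffAt.differentiableAt (by simp)
  simp only [gammaCoord_self] at h1
  let gx : EuclideanSpace ℝ (Fin n) →L[ℝ] EuclideanSpace ℝ (Fin n) →L[ℝ] ℝ := g.inner x
  let v' : EuclideanSpace ℝ (Fin n) := v
  let w' : EuclideanSpace ℝ (Fin n) := w
  let L : (EuclideanSpace ℝ (Fin n) →L[ℝ] EuclideanSpace ℝ (Fin n)) →L[ℝ] ℝ :=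
    gx.flip w' ∘L ContinuousLinearMap.apply ℝ (EuclideanSpace ℝ (Fin n)) v'
  exact L.hasFDerivAt.comp_hasDerivAt 0 h1.hasDerivAt

/-- Self-adjointness of `γ(r)` is differentiated at `r = 0`, using uniqueness of the derivative. -/
theorem IsAdmissible.inner_gammaDot_comm (hγ : IsAdmissible g γ δ) (x : M)
    (v w : TangentSpace (𝓡 n) x) :
    g.inner x (gammaDot γ x v) w = g.inner x (gammaDot γ x w) v := by
  refine (hγ.hasDerivAt_inner x v w).unique ?_
  refine (hγ.hasDerivAt_inner x w v).congr_of_eventuallyEq (Filter.Eventually.of_forall fun r ↦ ?_)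
  exact (hγ.self_adjoint r x v w).trans (g.symm x v (γ r x w))

end AdmissibleFamily

/-! ### Christoffel symbols of the ambient metric at `r = 0`. -/

section AmbientChristoffel

variable {n : ℕ} {M : Type*} [TopologicalSpace M] [ChartedSpace (EuclideanSpace ℝ (Fin n)) M]
  [IsManifold (𝓡 n) ∞ M]
  {g : ContMDiffRiemannianMetric (𝓡 n) ∞ (EuclideanSpace ℝ (Fin n))
      (TangentSpace (𝓡 n) : M → Type _)}
  {γ : ℝ → Π x : M, TangentSpace (𝓡 n) x →L[ℝ] TangentSpace (𝓡 n) x} {δ : ℝ}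

theorem metricCoord_ambient {p q : Ambient δ M} (hq : q.2.2 ∈ (tangentTriv (𝓡 n) p.2.2).baseSet)
    (a b a' b' : ℝ) (z z' : EuclideanSpace ℝ (Fin n)) :
    metricCoord (ambientModel n) (ambientMetric g γ) p q (a, b, z) (a', b', z') =
      (q.2.1 * a + q.1 * b) * a' + a * (q.2.1 * a' + q.1 * b') +
        (q.1 : ℝ) ^ 2 * metricCoord (𝓡 n) g.inner p.2.2 q.2.2
          (gammaCoord γ p.2.2 (q.2.1, q.2.2) z) z' := by
  rw [metricCoord_apply, symmL_ambient hq, symmL_ambient hq, ambientMetric_ambientVec,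
    metricCoord_apply, gammaCoord_apply, Trivialization.symmL_continuousLinearMapAt _ hq]

theorem eventually_mem_tangentTriv_ambient (p : Ambient δ M) :
    ∀ᶠ q in 𝓝 p, q.2.2 ∈ (tangentTriv (𝓡 n) p.2.2).baseSet :=
  (eventually_mem_tangentTriv (I := ambientModel n) p).mono fun _ h ↦ mem_tangentTriv_ambient.1 h

theorem IsAdmissible.contMDiffAt_metricCoord_gammaCoord (hγ : IsAdmissible g γ δ) (x : M) (r : ℝ)
    (z z' : EuclideanSpace ℝ (Fin n)) :
    ContMDiffAt (𝓘(ℝ, ℝ).prod (𝓡 n)) 𝓘(ℝ, ℝ) ∞ (fun q : ℝ × M ↦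
      metricCoord (𝓡 n) g.inner x q.2 (gammaCoord γ x q z) z') (r, x) := by
  have h1 : ContMDiffAt (𝓘(ℝ, ℝ).prod (𝓡 n)) 𝓘(ℝ, EuclideanSpace ℝ (Fin n) →L[ℝ]
      EuclideanSpace ℝ (Fin n) →L[ℝ] ℝ) ∞
      (fun q : ℝ × M ↦ metricCoord (𝓡 n) g.inner x q.2) (r, x) :=
    (contMDiffAt_metricCoord g x).comp (I := 𝓘(ℝ, ℝ).prod (𝓡 n)) (f := fun q : ℝ × M ↦ q.2) (r, x)
      contMDiffAt_snd
  have h2 : ContMDiffAt (𝓘(ℝ, ℝ).prod (𝓡 n)) 𝓘(ℝ, EuclideanSpace ℝ (Fin n)) ∞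
      (fun q : ℝ × M ↦ gammaCoord γ x q z) (r, x) :=
    (hγ.contMDiffAt_gammaCoord x r).clm_apply contMDiffAt_const
  exact (h1.clm_apply h2).clm_apply contMDiffAt_const

theorem contMDiff_ambient_t : ContMDiff (ambientModel n) 𝓘(ℝ, ℝ) ∞
    (fun q : Ambient δ M ↦ (q.1 : ℝ)) :=
  contMDiff_subtype_val.comp contMDiff_fst

theorem contMDiff_ambient_r : ContMDiff (ambientModel n) 𝓘(ℝ, ℝ) ∞
    (fun q : Ambient δ M ↦ (q.2.1 : ℝ)) :=
  contMDiff_subtype_val.comp (contMDiff_fst.comp contMDiff_snd)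

theorem contMDiff_ambient_rx : ContMDiff (ambientModel n) (𝓘(ℝ, ℝ).prod (𝓡 n)) ∞
    (fun q : Ambient δ M ↦ ((q.2.1 : ℝ), q.2.2)) :=
  contMDiff_ambient_r.prodMk (contMDiff_snd.comp contMDiff_snd)

theorem IsAdmissible.mdifferentiableAt_metricCoord (hγ : IsAdmissible g γ δ) (p : Ambient δ M) :
    MDifferentiableAt (ambientModel n) 𝓘(ℝ, AmbientVec n →L[ℝ] AmbientVec n →L[ℝ] ℝ)
      (metricCoord (ambientModel n) (ambientMetric g γ) p) p := by
  refine ContMDiffAt.mdifferentiableAt (n := ∞) (contMDiffAt_clm_of_apply fun v ↦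
    contMDiffAt_clm_of_apply fun w ↦ ?_) (by simp)
  obtain ⟨a, b, z⟩ := v
  obtain ⟨a', b', z'⟩ := w
  have h : ContMDiffAt (ambientModel n) 𝓘(ℝ, ℝ) ∞ (fun q : Ambient δ M ↦
      metricCoord (𝓡 n) g.inner p.2.2 q.2.2 (gammaCoord γ p.2.2 (q.2.1, q.2.2) z) z') p :=
    (hγ.contMDiffAt_metricCoord_gammaCoord p.2.2 p.2.1 z z').comp (I := ambientModel n)
      (f := fun q : Ambient δ M ↦ ((q.2.1 : ℝ), q.2.2)) p contMDiff_ambient_rx.contMDiffAt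
  have ht := contMDiff_ambient_t (n := n) (δ := δ) (M := M) p
  have hr := contMDiff_ambient_r (n := n) (δ := δ) (M := M) p
  refine ContMDiffAt.congr_of_eventuallyEq ?_
    ((eventually_mem_tangentTriv_ambient p).mono fun q hq ↦ metricCoord_ambient hq a b a' b' z z')
  exact (((((hr.mul contMDiffAt_const).add (ht.mul contMDiffAt_const)).mul contMDiffAt_const).add
    (contMDiffAt_const.mul ((hr.mul contMDiffAt_const).add (ht.mul contMDiffAt_const)))).add
    ((ht.pow 2).mul h))

variable {p : Ambient δ M}

theorem IsAdmissible.metricCoord_ambient_self (hγ : IsAdmissible g γ δ) (hp : (p.2.1 : ℝ) = 0)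
    (a b a' b' : ℝ) (z z' : EuclideanSpace ℝ (Fin n)) :
    metricCoord (ambientModel n) (ambientMetric g γ) p p (a, b, z) (a', b', z') =
      p.1 * (b * a' + a * b') +
        (p.1 : ℝ) ^ 2 * metricCoord (𝓡 n) g.inner p.2.2 p.2.2 z z' := by
  have hx : p.2.2 ∈ (tangentTriv (𝓡 n) p.2.2).baseSet := mem_chart_source _ _
  rw [metricCoord_ambient hx, hp, hγ.gammaCoord_zero hx]
  simp only [ContinuousLinearMap.id_apply]
  ring

theorem IsAdmissible.metricCoord_ambient_nondegenerate (hγ : IsAdmissible g γ δ)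
    (hp : (p.2.1 : ℝ) = 0) (v : AmbientVec n)
    (h : ∀ w, metricCoord (ambientModel n) (ambientMetric g γ) p p v w = 0) : v = 0 := by
  obtain ⟨a, b, z⟩ := v
  have ht : (p.1 : ℝ) ≠ 0 := ne_of_gt p.1.2
  -- At `r = 0` the vectors `∂_r` and `∂_t` are null and dual to each other up to the factor `t`;
  -- pairing with them isolates `a` and `b`.
  have h1 := h (0, 1, 0)
  have h2 := h (1, 0, 0)
  rw [hγ.metricCoord_ambient_self hp] at h1 h2
  have ha : a = 0 := by simpa [ht] using h1
  have hb : b = 0 := by simpa [ht] using h2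
  have hz : z = 0 := by
    refine metricCoord_nondegenerate g p.2.2 z fun w ↦ ?_
    have h3 := h (0, 0, w)
    rw [hγ.metricCoord_ambient_self hp] at h3
    simpa [ht] using h3
  rw [ha, hb, hz]
  rfl

/-- Product rule for `2r dt² + 2t dt dr + t² g(γ(r) ·, ·)` at `r = 0`. The term `2 u₁ v₀ w₀` comes
from differentiating `r` in `2r dt²`. -/
theorem IsAdmissible.metricCoordDeriv_ambient (hγ : IsAdmissible g γ δ) (hp : (p.2.1 : ℝ) = 0)
    (u₀ u₁ v₀ v₁ w₀ w₁ : ℝ) (u v w : EuclideanSpace ℝ (Fin n)) :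
    metricCoordDeriv (ambientModel n) (ambientMetric g γ) p (u₀, u₁, u) (v₀, v₁, v) (w₀, w₁, w) =
      2 * u₁ * v₀ * w₀ + u₀ * (v₁ * w₀ + v₀ * w₁) +
        2 * p.1 * u₀ * metricCoord (𝓡 n) g.inner p.2.2 p.2.2 v w +
        (p.1 : ℝ) ^ 2 * (u₁ * g.inner p.2.2
          (gammaDot γ p.2.2 ((tangentTriv (𝓡 n) p.2.2).symmL ℝ p.2.2 v))
          ((tangentTriv (𝓡 n) p.2.2).symmL ℝ p.2.2 w) +
          metricCoordDeriv (𝓡 n) g.inner p.2.2 u v w) := by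
  have hx : p.2.2 ∈ (tangentTriv (𝓡 n) p.2.2).baseSet := mem_chart_source _ _
  set K : ℝ × M → ℝ := fun q ↦ metricCoord (𝓡 n) g.inner p.2.2 q.2 (gammaCoord γ p.2.2 q v) w
    with hK
  have hKd : MDifferentiableAt (𝓘(ℝ, ℝ).prod (𝓡 n)) 𝓘(ℝ, ℝ) K ((p.2.1 : ℝ), p.2.2) :=
    (hγ.contMDiffAt_metricCoord_gammaCoord p.2.2 p.2.1 v w).mdifferentiableAt (by simp)
  have hk : MDifferentiableAt (ambientModel n) 𝓘(ℝ, ℝ)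
      (fun q : Ambient δ M ↦ K ((q.2.1 : ℝ), q.2.2)) p :=
    hKd.comp (I := ambientModel n) (f := fun q : Ambient δ M ↦ ((q.2.1 : ℝ), q.2.2)) p
      (((contMDiff_ambient_rx (n := n) (M := M) (δ := δ)) p).mdifferentiableAt (by simp))
  have ht : MDifferentiableAt (ambientModel n) 𝓘(ℝ, ℝ) (fun q : Ambient δ M ↦ (q.1 : ℝ)) p :=
    (hasMFDerivAt_ambient_t (n := n) p).mdifferentiableAt
  have hr : MDifferentiableAt (ambientModel n) 𝓘(ℝ, ℝ) (fun q : Ambient δ M ↦ (q.2.1 : ℝ)) p :=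
    (hasMFDerivAt_ambient_r (n := n) p).mdifferentiableAt
  have hdt := mvfderiv_eq_of_hasMFDerivAt (hasMFDerivAt_ambient_t (n := n) p)
  have hdr := mvfderiv_eq_of_hasMFDerivAt (hasMFDerivAt_ambient_r (n := n) p)
  -- The square `t²` is written as nested products `t · (t · K)`, so that the product rule suffices.
  have hcongr : (fun q : Ambient δ M ↦ metricCoord (ambientModel n) (ambientMetric g γ) p q
      (v₀, v₁, v) (w₀, w₁, w)) =ᶠ[𝓝 p] fun q ↦ (q.2.1 : ℝ) * (2 * v₀ * w₀) +
        ((q.1 : ℝ) * (v₁ * w₀ + v₀ * w₁) +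
          (q.1 : ℝ) * ((q.1 : ℝ) * K ((q.2.1 : ℝ), q.2.2))) := by
    filter_upwards [eventually_mem_tangentTriv_ambient (n := n) p] with q hq
    rw [metricCoord_ambient hq]
    ring
  -- The only place where the `r`-dependence of `γ` enters the derivatives of the metric.
  have hKr : deriv (fun r ↦ K (r, p.2.2)) p.2.1 = g.inner p.2.2
      (gammaDot γ p.2.2 ((tangentTriv (𝓡 n) p.2.2).symmL ℝ p.2.2 v))
      ((tangentTriv (𝓡 n) p.2.2).symmL ℝ p.2.2 w) := by
    rw [hp]
    refine ((hγ.hasDerivAt_inner _ _ _).congr_of_eventuallyEq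
      (Filter.Eventually.of_forall fun r ↦ ?_)).deriv
    simp only [hK]
    rw [metricCoord_apply, gammaCoord_apply, symmL_clmAt_self]
  -- Since `γ(0) = Id` at all points near `p.2.2`, derivatives along `M` are those of `g` alone.
  have hKx : mvfderiv (𝓡 n) (fun y ↦ K ((p.2.1 : ℝ), y)) p.2.2
      ((tangentTriv (𝓡 n) p.2.2).symmL ℝ p.2.2 u) =
      metricCoordDeriv (𝓡 n) g.inner p.2.2 u v w := by
    rw [metricCoordDeriv_apply_apply (TractorGeometry.mdifferentiableAt_metricCoord g p.2.2)]
    congr 1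
    refine mvfderiv_congr ?_
    filter_upwards [eventually_mem_tangentTriv (I := 𝓡 n) p.2.2] with y hy
    simp only [hK]
    rw [hp, hγ.gammaCoord_zero hy]
    rfl
  have hKp : K ((p.2.1 : ℝ), p.2.2) = metricCoord (𝓡 n) g.inner p.2.2 p.2.2 v w := by
    simp only [hK]
    rw [hp, hγ.gammaCoord_zero hx]
    rfl
  rw [metricCoordDeriv_apply_apply (hγ.mdifferentiableAt_metricCoord p), mvfderiv_congr hcongr,
    symmL_ambient hx]
  have hpair : ∀ {f : Ambient δ M → ℝ} (c : ℝ), MDifferentiableAt (ambientModel n) 𝓘(ℝ, ℝ) f p →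
      MDifferentiableAt (ambientModel n) 𝓘(ℝ, ℝ) (fun q ↦ f q * c) p :=
    fun c hf ↦ hf.mul mdifferentiableAt_const
  have h1 : MDifferentiableAt (ambientModel n) 𝓘(ℝ, ℝ)
      (fun q : Ambient δ M ↦ (q.1 : ℝ) * K ((q.2.1 : ℝ), q.2.2)) p := ht.mul hk
  have h2 : MDifferentiableAt (ambientModel n) 𝓘(ℝ, ℝ)
      (fun q : Ambient δ M ↦ (q.1 : ℝ) * ((q.1 : ℝ) * K ((q.2.1 : ℝ), q.2.2))) p := ht.mul h1
  have h3 : MDifferentiableAt (ambientModel n) 𝓘(ℝ, ℝ)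
      (fun q : Ambient δ M ↦ (q.1 : ℝ) * (v₁ * w₀ + v₀ * w₁) +
        (q.1 : ℝ) * ((q.1 : ℝ) * K ((q.2.1 : ℝ), q.2.2))) p := (hpair _ ht).add h2
  rw [mvfderiv_fun_add (hpair _ hr) h3, mvfderiv_fun_add (hpair _ ht) h2,
    mvfderiv_fun_mul hr mdifferentiableAt_const, mvfderiv_fun_mul ht mdifferentiableAt_const,
    mvfderiv_fun_mul ht h1, mvfderiv_fun_mul ht hk, mvfderiv_const, mvfderiv_const, hdt, hdr]
  simp only [add_apply, smul_apply, smul_zero, zero_add, smul_eq_mul]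
  rw [mvfderiv_comp_ambient hKd, hKr, dt_ambientVec, dr_ambientVec, dproj_ambientVec, hKx, hKp]
  simp only [smul_eq_mul]
  ring

/-- By nondegeneracy it is enough to pair the proposed vector with an arbitrary `w` and to compare
with the symbols of the first kind. Self-adjointness of `γ̇(0)` is used to bring all the `γ̇(0)`
terms into the same form. -/
theorem IsAdmissible.christoffel_ambient (hγ : IsAdmissible g γ δ) (hp : (p.2.1 : ℝ) = 0)
    (u₀ u₁ v₀ v₁ : ℝ) (u v : TangentSpace (𝓡 n) p.2.2) :
    christoffel (ambientModel n) (ambientMetric g γ) p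
      (u₀, u₁, (tangentTriv (𝓡 n) p.2.2).continuousLinearMapAt ℝ p.2.2 u)
      (v₀, v₁, (tangentTriv (𝓡 n) p.2.2).continuousLinearMapAt ℝ p.2.2 v) =
      (-(p.1 / 2 * g.inner p.2.2 (gammaDot γ p.2.2 u) v),
        (u₀ * v₁ + u₁ * v₀) / p.1 - g.inner p.2.2 u v,
        christoffel (𝓡 n) g.inner p.2.2
          ((tangentTriv (𝓡 n) p.2.2).continuousLinearMapAt ℝ p.2.2 u)
          ((tangentTriv (𝓡 n) p.2.2).continuousLinearMapAt ℝ p.2.2 v) +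
        (tangentTriv (𝓡 n) p.2.2).continuousLinearMapAt ℝ p.2.2
          ((u₀ / p.1) • v + (v₀ / p.1) • u +
            (u₁ / 2) • gammaDot γ p.2.2 v + (v₁ / 2) • gammaDot γ p.2.2 u)) := by
  have ht : (p.1 : ℝ) ≠ 0 := ne_of_gt p.1.2
  refine sub_eq_zero.1 (hγ.metricCoord_ambient_nondegenerate hp _ fun w ↦ ?_)
  rw [map_sub, sub_apply, metricCoord_christoffel p (hγ.metricCoord_ambient_nondegenerate hp)]
  obtain ⟨w₀, w₁, w⟩ := w
  obtain ⟨w, rfl⟩ : ∃ w' : TangentSpace (𝓡 n) p.2.2,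
      (tangentTriv (𝓡 n) p.2.2).continuousLinearMapAt ℝ p.2.2 w' = w :=
    ⟨_, clmAt_symmL_self p.2.2 w⟩
  rw [christoffelFirst_apply, hγ.metricCoordDeriv_ambient hp, hγ.metricCoordDeriv_ambient hp,
    hγ.metricCoordDeriv_ambient hp, hγ.metricCoord_ambient_self hp, map_add, add_apply,
    metricCoord_christoffel p.2.2 (metricCoord_nondegenerate g p.2.2), christoffelFirst_apply]
  simp only [metricCoord_apply, symmL_clmAt_self]
  rw [hγ.inner_gammaDot_comm p.2.2 u v, hγ.inner_gammaDot_comm p.2.2 u w,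
    hγ.inner_gammaDot_comm p.2.2 v w]
  simp only [map_add, map_smul, add_apply, smul_apply, smul_eq_mul]
  rw [hγ.inner_gammaDot_comm p.2.2 w v,
    hγ.inner_gammaDot_comm p.2.2 u w]
  field_simp
  ring

/-- The Levi-Civita connection of the ambient metric at `r = 0`. -/
theorem IsAdmissible.leviCivita_ambient (hγ : IsAdmissible g γ δ) (hp : (p.2.1 : ℝ) = 0)
    (u₀ u₁ v₀ v₁ : ℝ) (u v : TangentSpace (𝓡 n) p.2.2) :
    leviCivita (ambientModel n) (ambientMetric g γ)
      (FiberBundle.extend (AmbientVec n) (ambientVec p v₀ v₁ v)) p (ambientVec p u₀ u₁ u) =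
      ambientVec p (-(p.1 / 2 * g.inner p.2.2 (gammaDot γ p.2.2 u) v))
        ((u₀ * v₁ + u₁ * v₀) / p.1 - g.inner p.2.2 u v)
        (leviCivita (𝓡 n) g.inner (FiberBundle.extend (EuclideanSpace ℝ (Fin n)) v) p.2.2 u +
          ((u₀ / p.1) • v + (v₀ / p.1) • u +
            (u₁ / 2) • gammaDot γ p.2.2 v + (v₁ / 2) • gammaDot γ p.2.2 u)) := by
  have hx : p.2.2 ∈ (tangentTriv (𝓡 n) p.2.2).baseSet := mem_chart_source _ _
  rw [leviCivita_extend, continuousLinearMapAt_ambient hx, continuousLinearMapAt_ambient hx,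
    hγ.christoffel_ambient hp, symmL_ambient hx, leviCivita_extend, map_add, symmL_clmAt_self]

end AmbientChristoffel

end

end TractorGeometry

namespace TractorGeometry

noncomputable section

/-! ### The pullback bundle along `Ψ^u` and its three components. -/

section Immersion

variable {n : ℕ} {M : Type*} [TopologicalSpace M] [ChartedSpace (EuclideanSpace ℝ (Fin n)) M]
  [IsManifold (𝓡 n) ∞ M] {δ : ℝ}

/-- The pullback of the tangent bundle of the ambient manifold along `Ψ^u`. -/
abbrev AmbientPullback (hδ : 0 < δ) (u : C^∞⟮𝓡 n, M; ℝ⟯) : M → Type _ :=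
  (immersion hδ u : M → Ambient δ M) *ᵖ (TangentSpace (ambientModel n) : Ambient δ M → Type _)

variable {hδ : 0 < δ} {u : C^∞⟮𝓡 n, M; ℝ⟯}

/-- The vector `a ∂_t + b ∂_r + z` of the pullback bundle. -/
def pullbackVec (x : M) (a b : ℝ) (z : TangentSpace (𝓡 n) x) : AmbientPullback hδ u x :=
  ambientVec (immersion hδ u x) a b z

/-- The `∂_t`-component. -/
def compT (x : M) : AmbientPullback hδ u x →L[ℝ] ℝ :=
  dt (immersion hδ u x)

/-- The `∂_r`-component. -/
def compR (x : M) : AmbientPullback hδ u x →L[ℝ] ℝ :=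
  dr (immersion hδ u x)

/-- The component tangent to `M`. -/
def compM (x : M) : AmbientPullback hδ u x →L[ℝ] TangentSpace (𝓡 n) x :=
  dproj (immersion hδ u x)

section

variable (x : M) (a b a' b' c : ℝ) (z z' : TangentSpace (𝓡 n) x)

@[simp] theorem compT_pullbackVec : compT x (pullbackVec (hδ := hδ) (u := u) x a b z) = a := rfl

@[simp] theorem compR_pullbackVec : compR x (pullbackVec (hδ := hδ) (u := u) x a b z) = b := rfl

@[simp] theorem compM_pullbackVec : compM x (pullbackVec (hδ := hδ) (u := u) x a b z) = z := rfl

theorem pullbackVec_eta (v : AmbientPullback hδ u x) :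
    pullbackVec x (compT x v) (compR x v) (compM x v) = v := rfl

theorem xi_eq : xi hδ u x = pullbackVec x (Real.exp (u x)) 0 0 := rfl

end

theorem pullback_ext {x : M} {v w : AmbientPullback hδ u x}
    (h₁ : compT x v = compT x w) (h₂ : compR x v = compR x w) (h₃ : compM x v = compM x w) :
    v = w := by
  rw [← pullbackVec_eta x v, ← pullbackVec_eta x w, h₁, h₂, h₃]

theorem snd_trivializationAt_pullback {x y : M} (hy : y ∈ (tangentTriv (𝓡 n) x).baseSet)
    (v : AmbientPullback hδ u y) :
    (trivializationAt (AmbientVec n) (AmbientPullback hδ u) x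
      (TotalSpace.mk' (AmbientVec n) y v)).2 =
      (compT y v, compR y v, (tangentTriv (𝓡 n) x).continuousLinearMapAt ℝ y (compM y v)) := by
  have hy' : (immersion hδ u y).2.2 ∈ (tangentTriv (𝓡 n) (immersion hδ u x).2.2).baseSet := hy
  have h := snd_trivializationAt_apply (mem_tangentTriv_ambient.2 hy') (v := v)
  exact h.trans (continuousLinearMapAt_ambient hy' (compT y v) (compR y v) (compM y v))

/-- The components of a section of the pullback bundle. -/
theorem eventuallyEq_snd_trivializationAt_pullback (σ : Π y : M, AmbientPullback hδ u y) (x : M) :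
    (fun y ↦ (trivializationAt (AmbientVec n) (AmbientPullback hδ u) x
      (TotalSpace.mk' (AmbientVec n) y (σ y))).2) =ᶠ[𝓝 x] fun y ↦ (compT y (σ y), compR y (σ y),
        tangentCoord (𝓡 n) (fun y ↦ compM y (σ y)) x y) := by
  filter_upwards [eventually_mem_tangentTriv (I := 𝓡 n) x] with y hy
  rw [snd_trivializationAt_pullback hy, tangentCoord_apply _ hy]

/-- In the trivialization the pullback bundle is two trivial lines plus `TM`, so regularity is
decided component by component. -/
theorem contMDiffAt_pullback_iff {σ : Π y : M, AmbientPullback hδ u y} {x : M} {k : ℕ∞ω} :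
    ContMDiffAt (𝓡 n) ((𝓡 n).prod 𝓘(ℝ, AmbientVec n)) k
      (fun y ↦ TotalSpace.mk' (AmbientVec n) y (σ y)) x ↔
    ContMDiffAt (𝓡 n) 𝓘(ℝ, ℝ) k (fun y ↦ compT y (σ y)) x ∧
    ContMDiffAt (𝓡 n) 𝓘(ℝ, ℝ) k (fun y ↦ compR y (σ y)) x ∧
    ContMDiffAt (𝓡 n) ((𝓡 n).prod 𝓘(ℝ, EuclideanSpace ℝ (Fin n))) k
      (fun y ↦ TotalSpace.mk' (EuclideanSpace ℝ (Fin n)) y (compM y (σ y))) x := by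
  rw [contMDiffAt_section, contMDiffAt_section,
    (eventuallyEq_snd_trivializationAt_pullback σ x).contMDiffAt_iff,
    contMDiffAt_prod_module_iff, contMDiffAt_prod_module_iff]
  rfl

theorem mdifferentiableAt_pullback_iff {σ : Π y : M, AmbientPullback hδ u y} {x : M} :
    MDifferentiableAt (𝓡 n) ((𝓡 n).prod 𝓘(ℝ, AmbientVec n))
      (fun y ↦ TotalSpace.mk' (AmbientVec n) y (σ y)) x ↔
    MDifferentiableAt (𝓡 n) 𝓘(ℝ, ℝ) (fun y ↦ compT y (σ y)) x ∧
    MDifferentiableAt (𝓡 n) 𝓘(ℝ, ℝ) (fun y ↦ compR y (σ y)) x ∧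
    MDifferentiableAt (𝓡 n) ((𝓡 n).prod 𝓘(ℝ, EuclideanSpace ℝ (Fin n)))
      (fun y ↦ TotalSpace.mk' (EuclideanSpace ℝ (Fin n)) y (compM y (σ y))) x := by
  rw [mdifferentiableAt_section, mdifferentiableAt_section,
    (eventuallyEq_snd_trivializationAt_pullback σ x).mdifferentiableAt_iff,
    mdifferentiableAt_prod_module_iff, mdifferentiableAt_prod_module_iff]
  rfl

theorem mdifferentiableAt_smooth (x : M) : MDifferentiableAt (𝓡 n) 𝓘(ℝ, ℝ) u x :=
  (u.contMDiff x).mdifferentiableAt (by simp)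

theorem mvfderiv_exp_comp (x : M) (v : TangentSpace (𝓡 n) x) :
    mvfderiv (𝓡 n) (fun y ↦ Real.exp (u y)) x v = Real.exp (u x) * mvfderiv (𝓡 n) u x v := by
  have h := ((Real.hasDerivAt_exp (u x)).hasFDerivAt.hasMFDerivAt).comp x
    (hasMFDerivAt_mvfderiv (mdifferentiableAt_smooth (u := u) x))
  have h2 := congrArg (fun L : EuclideanSpace ℝ (Fin n) →L[ℝ] ℝ ↦ L v)
    (mvfderiv_eq_of_hasMFDerivAt h)
  exact h2.trans (mul_comm (mvfderiv (𝓡 n) u x v) (Real.exp (u x)))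

/-- The three components come from composing `Ψ^u` with the coordinates `t`, `r` and the projection
to `M`, which gives `e^u`, `0` and the identity. -/
theorem mfderiv_immersion (x : M) (v : TangentSpace (𝓡 n) x) :
    mfderiv (𝓡 n) (ambientModel n) (immersion hδ u) x v =
      ambientVec (immersion hδ u x) (Real.exp (u x) * mvfderiv (𝓡 n) u x v) 0 v := by
  have hΨ : HasMFDerivAt (𝓡 n) (ambientModel n) (immersion hδ u) x
      (mfderiv (𝓡 n) (ambientModel n) (immersion hδ u) x) :=
    (((immersion hδ u).contMDiff x).mdifferentiableAt (by simp)).hasMFDerivAt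
  have h1 := (hasMFDerivAt_ambient_t (n := n) (immersion hδ u x)).comp x hΨ
  have h2 := (hasMFDerivAt_ambient_r (n := n) (immersion hδ u x)).comp x hΨ
  have h3 := (hasMFDerivAt_ambient_proj (n := n) (immersion hδ u x)).comp x hΨ
  refine ambient_ext ?_ ?_ ?_
  · exact (congrArg (fun L : EuclideanSpace ℝ (Fin n) →L[ℝ] ℝ ↦ L v)
      (mvfderiv_eq_of_hasMFDerivAt h1)).symm.trans (mvfderiv_exp_comp x v)
  · have h4 : mvfderiv (𝓡 n) (fun _ : M ↦ (0 : ℝ)) x v = 0 := by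
      rw [mvfderiv_const]; rfl
    exact (congrArg (fun L : EuclideanSpace ℝ (Fin n) →L[ℝ] ℝ ↦ L v)
      (mvfderiv_eq_of_hasMFDerivAt h2)).symm.trans h4
  · exact congrArg (fun L : EuclideanSpace ℝ (Fin n) →L[ℝ] EuclideanSpace ℝ (Fin n) ↦ L v)
      (hasMFDerivAt_unique h3 (hasMFDerivAt_id x))

end Immersion

/-! ### The tractor metric and connection in components. -/

section TractorConnection

variable {n : ℕ} {M : Type*} [TopologicalSpace M] [ChartedSpace (EuclideanSpace ℝ (Fin n)) M]
  [IsManifold (𝓡 n) ∞ M]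
  {g : ContMDiffRiemannianMetric (𝓡 n) ∞ (EuclideanSpace ℝ (Fin n))
      (TangentSpace (𝓡 n) : M → Type _)}
  {γ : ℝ → Π x : M, TangentSpace (𝓡 n) x →L[ℝ] TangentSpace (𝓡 n) x} {δ : ℝ}

/-- The tractor bundle associated with `(Ψ^u, ξ^u)`. -/
abbrev ambientTractor
    (g : ContMDiffRiemannianMetric (𝓡 n) ∞ (EuclideanSpace ℝ (Fin n))
      (TangentSpace (𝓡 n) : M → Type _))
    (γ : ℝ → Π x : M, TangentSpace (𝓡 n) x →L[ℝ] TangentSpace (𝓡 n) x)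
    (hδ : 0 < δ) (u : C^∞⟮𝓡 n, M; ℝ⟯) : TractorData (𝓡 n) (AmbientPullback hδ u) :=
  associatedTractorBundle (ambientMetric (δ := δ) g γ) (immersion hδ u) (xi hδ u)

variable {u : C^∞⟮𝓡 n, M; ℝ⟯}

theorem IsAdmissible.ambientTractor_metric (hγ : IsAdmissible g γ δ) (x : M)
    (v w : AmbientPullback hγ.delta_pos u x) :
    (ambientTractor g γ hγ.delta_pos u).metric x v w =
      Real.exp (u x) * (compT x v * compR x w + compR x v * compT x w) +
        Real.exp (u x) ^ 2 * g.inner x (compM x v) (compM x w) := by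
  have h := ambientMetric_ambientVec g γ (immersion hγ.delta_pos u x) (compT x v) (compR x v)
    (compT x w) (compR x w) (compM x v) (compM x w)
  refine h.trans ?_
  have h0 : γ 0 x (compM x v) = compM x v := by rw [hγ.at_zero]; rfl
  change (0 * _ + Real.exp (u x) * _) * _ + _ * (0 * _ + Real.exp (u x) * _) +
    Real.exp (u x) ^ 2 * g.inner x (γ 0 x (compM x v)) (compM x w) = _
  rw [h0]
  ring

theorem ambientTractor_conn (hδ : 0 < δ) (σ : Π y : M, AmbientPullback hδ u y) (x : M)
    (v : TangentSpace (𝓡 n) x) :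
    (ambientTractor g γ hδ u).conn σ x v =
      (show TangentSpace (ambientModel n) (immersion hδ u x) from
      (tangentTriv (ambientModel n) (immersion hδ u x)).symmL ℝ (immersion hδ u x)
        (mvfderiv (𝓡 n) (fun y ↦ (trivializationAt (AmbientVec n) (AmbientPullback hδ u) x
          (TotalSpace.mk' (AmbientVec n) y (σ y))).2) x v) +
      leviCivita (ambientModel n) (ambientMetric g γ) (FiberBundle.extend (AmbientVec n)
        (show TangentSpace (ambientModel n) (immersion hδ u x) from σ x)) (immersion hδ u x)
        (mfderiv (𝓡 n) (ambientModel n) (immersion hδ u) x v)) := rfl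

/-- The tractor connection in components. -/
theorem IsAdmissible.ambientTractor_conn_eq (hγ : IsAdmissible g γ δ)
    {σ : Π y : M, AmbientPullback hγ.delta_pos u y} {x : M}
    (hσ : MDifferentiableAt (𝓡 n) ((𝓡 n).prod 𝓘(ℝ, AmbientVec n))
      (fun y ↦ TotalSpace.mk' (AmbientVec n) y (σ y)) x) (v : TangentSpace (𝓡 n) x) :
    (ambientTractor g γ hγ.delta_pos u).conn σ x v = pullbackVec x
      (mvfderiv (𝓡 n) (fun y ↦ compT y (σ y)) x v -
        Real.exp (u x) / 2 * g.inner x (gammaDot γ x v) (compM x (σ x)))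
      (mvfderiv (𝓡 n) (fun y ↦ compR y (σ y)) x v + mvfderiv (𝓡 n) u x v * compR x (σ x) -
        g.inner x v (compM x (σ x)))
      (leviCivita (𝓡 n) g.inner (fun y ↦ compM y (σ y)) x v +
        mvfderiv (𝓡 n) u x v • compM x (σ x) + (compT x (σ x) / Real.exp (u x)) • v +
        (compR x (σ x) / 2) • gammaDot γ x v) := by
  obtain ⟨h1, h2, h3⟩ := mdifferentiableAt_pullback_iff.1 hσ
  have h4 := mdifferentiableAt_tangentCoord h3
  have h5 : MDifferentiableAt (𝓡 n) 𝓘(ℝ, AmbientVec n) (fun y ↦ ((compT y (σ y), compR y (σ y),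
      tangentCoord (𝓡 n) (fun y ↦ compM y (σ y)) x y) : AmbientVec n)) x :=
    h1.prodMk_space (h2.prodMk_space h4)
  have hx : (immersion hγ.delta_pos u x).2.2 ∈
    (tangentTriv (𝓡 n) (immersion hγ.delta_pos u x).2.2).baseSet := mem_chart_source _ _
  have h6 : mvfderiv (𝓡 n) (fun y ↦ (trivializationAt (AmbientVec n)
      (AmbientPullback hγ.delta_pos u) x (TotalSpace.mk' (AmbientVec n) y (σ y))).2) x v =
      (mvfderiv (𝓡 n) (fun y ↦ compT y (σ y)) x v, mvfderiv (𝓡 n) (fun y ↦ compR y (σ y)) x v,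
        mvfderiv (𝓡 n) (tangentCoord (𝓡 n) (fun y ↦ compM y (σ y)) x) x v) := by
    rw [mvfderiv_congr (eventuallyEq_snd_trivializationAt_pullback σ x)]
    let L₁ := ContinuousLinearMap.fst ℝ ℝ (ℝ × EuclideanSpace ℝ (Fin n))
    let L := ContinuousLinearMap.snd ℝ ℝ (ℝ × EuclideanSpace ℝ (Fin n))
    let L₂ := ContinuousLinearMap.fst ℝ ℝ (EuclideanSpace ℝ (Fin n)) ∘L L
    let L₃ := ContinuousLinearMap.snd ℝ ℝ (EuclideanSpace ℝ (Fin n)) ∘L L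
    exact Prod.ext (mvfderiv_clm_comp L₁ h5 v).symm
      (Prod.ext (mvfderiv_clm_comp L₂ h5 v).symm (mvfderiv_clm_comp L₃ h5 v).symm)
  -- Here `rfl` is the fact that `r = 0` on the image of `Ψ^u`; the direction is `dΨ^u(v) = (e^u
  -- du(v), 0, v)`.
  have h7 := hγ.leviCivita_ambient (p := immersion hγ.delta_pos u x) rfl
    (Real.exp (u x) * mvfderiv (𝓡 n) u x v) 0 (compT x (σ x)) (compR x (σ x)) v (compM x (σ x))
  have ht : Real.exp (u x) ≠ 0 := Real.exp_ne_zero _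
  rw [ambientTractor_conn, h6, symmL_ambient hx, mfderiv_immersion]
  refine (congrArg (fun w : TangentSpace (ambientModel n) (immersion hγ.delta_pos u x) ↦
    ambientVec (immersion hγ.delta_pos u x) (mvfderiv (𝓡 n) (fun y ↦ compT y (σ y)) x v)
      (mvfderiv (𝓡 n) (fun y ↦ compR y (σ y)) x v) ((tangentTriv (𝓡 n) x).symmL ℝ x
        (mvfderiv (𝓡 n) (tangentCoord (𝓡 n) (fun y ↦ compM y (σ y)) x) x v)) + w) h7).trans ?_
  refine pullback_ext ?_ ?_ ?_
  · change mvfderiv (𝓡 n) (fun y ↦ compT y (σ y)) x v +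
      -(Real.exp (u x) / 2 * g.inner x (gammaDot γ x v) (compM x (σ x))) = _
    rw [compT_pullbackVec, sub_eq_add_neg]
  · change mvfderiv (𝓡 n) (fun y ↦ compR y (σ y)) x v +
      ((Real.exp (u x) * mvfderiv (𝓡 n) u x v * compR x (σ x) + 0 * compT x (σ x)) /
        Real.exp (u x) - g.inner x v (compM x (σ x))) = _
    rw [compR_pullbackVec]
    field_simp
    ring
  · change (tangentTriv (𝓡 n) x).symmL ℝ x
        (mvfderiv (𝓡 n) (tangentCoord (𝓡 n) (fun y ↦ compM y (σ y)) x) x v) +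
      (leviCivita (𝓡 n) g.inner
        (FiberBundle.extend (EuclideanSpace ℝ (Fin n)) (compM x (σ x))) x v +
        ((Real.exp (u x) * mvfderiv (𝓡 n) u x v / Real.exp (u x)) • compM x (σ x) +
          (compT x (σ x) / Real.exp (u x)) • v +
            ((0 : ℝ) / 2) • gammaDot γ x (compM x (σ x)) +
            (compR x (σ x) / 2) • gammaDot γ x v)) = _
    -- The derivative of the components and the Christoffel term, which came from the two summands
    -- of the pullback connection, recombine into the Levi-Civita derivative of the `M`-component.
    rw [compM_pullbackVec, leviCivita_extend, leviCivita_apply, map_add, tangentCoord_self,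
      mul_div_cancel_left₀ _ ht]
    module

end TractorConnection

end

end TractorGeometry

namespace TractorGeometry

noncomputable section

/-! ### Smoothness of `γ̇(0)`. -/

section GammaDotSmooth

variable {n : ℕ} {M : Type*} [TopologicalSpace M] [ChartedSpace (EuclideanSpace ℝ (Fin n)) M]
  [IsManifold (𝓡 n) ∞ M]
  {g : ContMDiffRiemannianMetric (𝓡 n) ∞ (EuclideanSpace ℝ (Fin n))
      (TangentSpace (𝓡 n) : M → Type _)}
  {γ : ℝ → Π x : M, TangentSpace (𝓡 n) x →L[ℝ] TangentSpace (𝓡 n) x} {δ : ℝ}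

theorem contMDiffAt_tangentCoord {X : Π y : M, TangentSpace (𝓡 n) y} {x : M} {k : ℕ∞ω}
    (hX : ContMDiffAt (𝓡 n) ((𝓡 n).prod 𝓘(ℝ, EuclideanSpace ℝ (Fin n))) k
      (fun y ↦ TotalSpace.mk' (EuclideanSpace ℝ (Fin n)) y (X y)) x) :
    ContMDiffAt (𝓡 n) 𝓘(ℝ, EuclideanSpace ℝ (Fin n)) k (tangentCoord (𝓡 n) X x) x :=
  (contMDiffAt_section x).1 hX

/-- The function is the `r`-derivative at `0` of `g(γ(r) X, Z)`, which is jointly smooth in the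
point and `r`, and a partial derivative of a jointly smooth function is smooth in the parameter. -/
theorem IsAdmissible.contMDiffAt_inner_gammaDot (hγ : IsAdmissible g γ δ) {x : M}
    {X Z : Π y : M, TangentSpace (𝓡 n) y}
    (hX : ContMDiffAt (𝓡 n) ((𝓡 n).prod 𝓘(ℝ, EuclideanSpace ℝ (Fin n))) ∞
      (fun y ↦ TotalSpace.mk' (EuclideanSpace ℝ (Fin n)) y (X y)) x)
    (hZ : ContMDiffAt (𝓡 n) ((𝓡 n).prod 𝓘(ℝ, EuclideanSpace ℝ (Fin n))) ∞
      (fun y ↦ TotalSpace.mk' (EuclideanSpace ℝ (Fin n)) y (Z y)) x) :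
    ContMDiffAt (𝓡 n) 𝓘(ℝ, ℝ) ∞ (fun y ↦ g.inner y (gammaDot γ y (X y)) (Z y)) x := by
  let f : M → ℝ → ℝ := fun y r ↦ g.inner y (γ r y (X y)) (Z y)
  have hf : ContMDiffAt ((𝓡 n).prod 𝓘(ℝ, ℝ)) 𝓘(ℝ, ℝ) ∞ (Function.uncurry f) (x, 0) := by
    have h1 : ContMDiffAt ((𝓡 n).prod 𝓘(ℝ, ℝ)) 𝓘(ℝ, EuclideanSpace ℝ (Fin n) →L[ℝ]
        EuclideanSpace ℝ (Fin n) →L[ℝ] ℝ) ∞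
        (fun q : M × ℝ ↦ metricCoord (𝓡 n) g.inner x q.1) (x, 0) :=
      (contMDiffAt_metricCoord g x).comp (I := (𝓡 n).prod 𝓘(ℝ, ℝ)) (f := fun q : M × ℝ ↦ q.1)
        (x, 0) contMDiffAt_fst
    have h2 : ContMDiffAt ((𝓡 n).prod 𝓘(ℝ, ℝ)) 𝓘(ℝ, EuclideanSpace ℝ (Fin n) →L[ℝ]
        EuclideanSpace ℝ (Fin n)) ∞ (fun q : M × ℝ ↦ gammaCoord γ x (q.2, q.1)) (x, 0) :=
      (hγ.contMDiffAt_gammaCoord x 0).comp (I := (𝓡 n).prod 𝓘(ℝ, ℝ))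
        (f := fun q : M × ℝ ↦ (q.2, q.1)) (x, 0) (contMDiffAt_snd.prodMk contMDiffAt_fst)
    have h3 : ContMDiffAt ((𝓡 n).prod 𝓘(ℝ, ℝ)) 𝓘(ℝ, EuclideanSpace ℝ (Fin n)) ∞
        (fun q : M × ℝ ↦ tangentCoord (𝓡 n) X x q.1) (x, 0) :=
      (contMDiffAt_tangentCoord hX).comp (I := (𝓡 n).prod 𝓘(ℝ, ℝ)) (f := fun q : M × ℝ ↦ q.1)
        (x, 0) contMDiffAt_fst
    have h4 : ContMDiffAt ((𝓡 n).prod 𝓘(ℝ, ℝ)) 𝓘(ℝ, EuclideanSpace ℝ (Fin n)) ∞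
        (fun q : M × ℝ ↦ tangentCoord (𝓡 n) Z x q.1) (x, 0) :=
      (contMDiffAt_tangentCoord hZ).comp (I := (𝓡 n).prod 𝓘(ℝ, ℝ)) (f := fun q : M × ℝ ↦ q.1)
        (x, 0) contMDiffAt_fst
    refine ((h1.clm_apply (h2.clm_apply h3)).clm_apply h4).congr_of_eventuallyEq ?_
    have h5 : ∀ᶠ q : M × ℝ in 𝓝 (x, 0), q.1 ∈ (tangentTriv (𝓡 n) x).baseSet :=
      continuousAt_fst.eventually (eventually_mem_tangentTriv (I := 𝓡 n) x)
    filter_upwards [h5] with q hq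
    rw [Function.uncurry, metricCoord_apply, gammaCoord_apply, tangentCoord_apply _ hq,
      tangentCoord_apply _ hq, Trivialization.symmL_continuousLinearMapAt _ hq,
      Trivialization.symmL_continuousLinearMapAt _ hq,
      Trivialization.symmL_continuousLinearMapAt _ hq]
  have h := ContMDiffAt.mfderiv (m := ∞) f (fun _ ↦ (0 : ℝ)) hf contMDiffAt_const (by simp)
  have h0 := inTangentCoordinates_model_space (I := 𝓘(ℝ, ℝ)) (I' := 𝓘(ℝ, ℝ)) (fun _ : M ↦ (0 : ℝ))
    (fun y ↦ f y 0) (fun y ↦ (mfderiv 𝓘(ℝ, ℝ) 𝓘(ℝ, ℝ) (f y) 0 : ℝ →L[ℝ] ℝ)) x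
  have h' : ContMDiffAt (𝓡 n) 𝓘(ℝ, ℝ →L[ℝ] ℝ) ∞ (fun y ↦ fderiv ℝ (f y) 0) x := by
    refine h.congr_of_eventuallyEq (Filter.Eventually.of_forall fun y ↦ ?_)
    exact mfderiv_eq_fderiv.symm.trans (congrFun h0 y).symm
  refine (h'.clm_apply (contMDiffAt_const (c := (1 : ℝ)))).congr_of_eventuallyEq
    (Filter.Eventually.of_forall fun y ↦ ?_)
  exact (hγ.hasDerivAt_inner y (X y) (Z y)).deriv.symm

theorem IsAdmissible.contMDiffAt_gammaDot (hγ : IsAdmissible g γ δ) {x : M}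
    {X : Π y : M, TangentSpace (𝓡 n) y}
    (hX : ContMDiffAt (𝓡 n) ((𝓡 n).prod 𝓘(ℝ, EuclideanSpace ℝ (Fin n))) ∞
      (fun y ↦ TotalSpace.mk' (EuclideanSpace ℝ (Fin n)) y (X y)) x) :
    ContMDiffAt (𝓡 n) ((𝓡 n).prod 𝓘(ℝ, EuclideanSpace ℝ (Fin n))) ∞
      (fun y ↦ TotalSpace.mk' (EuclideanSpace ℝ (Fin n)) y (gammaDot γ y (X y))) x :=
  contMDiffAt_of_inner g fun z ↦ hγ.contMDiffAt_inner_gammaDot hX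
    (FiberBundle.contMDiffAt_extend (𝓡 n) (EuclideanSpace ℝ (Fin n)) z)

end GammaDotSmooth

/-! ### Orthonormal bases of a positive definite form. -/

section OrthonormalBasis

variable {V : Type*} [AddCommGroup V] [Module ℝ V] [FiniteDimensional ℝ V]

/-- Pairing a vanishing combination with `f j` leaves `ε j` times the `j`-th coefficient. The signs
in `ε` are allowed to vary for the sake of the Lorentzian basis. -/
theorem linearIndependent_of_apply_eq_ite {ι : Type*} [Finite ι] [DecidableEq ι]
    (B : LinearMap.BilinForm ℝ V) {f : ι → V} {ε : ι → ℝ} (hε : ∀ i, ε i ≠ 0)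
    (hf : ∀ i j, B (f i) (f j) = if i = j then ε i else 0) : LinearIndependent ℝ f := by
  have := Fintype.ofFinite ι
  refine Fintype.linearIndependent_iff.2 fun c hc j ↦ ?_
  have h := congrArg (fun v ↦ B v (f j)) hc
  simpa [hf, hε] using h

theorem exists_orthonormal_basis {n : ℕ} (hn : Module.finrank ℝ V = n)
    (B : LinearMap.BilinForm ℝ V) (hs : ∀ v w, B v w = B w v) (hB : ∀ v, v ≠ 0 → 0 < B v v) :
    ∃ e : Module.Basis (Fin n) ℝ V, ∀ i j, B (e i) (e j) = if i = j then 1 else 0 := by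
  subst hn
  obtain ⟨b, hb⟩ := LinearMap.BilinForm.exists_orthogonal_basis (B := B) ⟨hs⟩
  have hpos : ∀ i, 0 < B (b i) (b i) := fun i ↦ hB _ (b.ne_zero i)
  let e : Fin (Module.finrank ℝ V) → V := fun i ↦ (√(B (b i) (b i)))⁻¹ • b i
  have he : ∀ i j, B (e i) (e j) = if i = j then 1 else 0 := by
    intro i j
    by_cases hij : i = j
    · subst hij
      have h1 := Real.mul_self_sqrt (hpos i).le
      have h2 := (Real.sqrt_pos.2 (hpos i)).ne'
      simp only [e, map_smul, LinearMap.smul_apply, smul_eq_mul, if_pos]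
      field_simp
      rw [sq, h1]
    · have : B (b i) (b j) = 0 := hb hij
      simp [e, this, hij]
  have hli := linearIndependent_of_apply_eq_ite B (f := e) (ε := fun _ ↦ 1) (by simp) he
  refine ⟨basisOfLinearIndependentOfCardEqFinrank' e hli (by simp), fun i j ↦ ?_⟩
  simp [he]

end OrthonormalBasis

end

end TractorGeometry

namespace TractorGeometry

noncomputable section

/-! ### Smoothness of bilinear forms. -/

section Bilinear

variable {E : Type*} [NormedAddCommGroup E] [NormedSpace ℝ E]
  {H : Type*} [TopologicalSpace H] {I : ModelWithCorners ℝ E H}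
  {M : Type*} [TopologicalSpace M] [ChartedSpace H M]
  {F : Type*} [NormedAddCommGroup F] [NormedSpace ℝ F] [FiniteDimensional ℝ F]
  {V : M → Type*} [TopologicalSpace (TotalSpace F V)]
  [∀ x, AddCommGroup (V x)] [∀ x, Module ℝ (V x)] [∀ x, TopologicalSpace (V x)]
  [∀ x, IsTopologicalAddGroup (V x)] [∀ x, ContinuousSMul ℝ (V x)]
  [FiberBundle F V] [VectorBundle ℝ F V]

theorem contMDiff_bilin_of_extend {k : ℕ∞ω} {G : Π x : M, V x →L[ℝ] V x →L[ℝ] ℝ}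
    (h : ∀ (x : M) (v w : V x), ContMDiffAt I 𝓘(ℝ, ℝ) k
      (fun y ↦ G y (FiberBundle.extend F v y) (FiberBundle.extend F w y)) x) :
    ContMDiff I (I.prod 𝓘(ℝ, F →L[ℝ] F →L[ℝ] ℝ)) k
      (fun x ↦ TotalSpace.mk' (F →L[ℝ] F →L[ℝ] ℝ) x (G x)) := by
  intro x
  refine contMDiffAt_hom_of_extend fun v ↦ contMDiffAt_hom_of_extend (V' := Bundle.Trivial M ℝ)
    (φ := fun y ↦ G y (FiberBundle.extend F v y)) fun w ↦ ?_
  rw [contMDiffAt_totalSpace]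
  exact ⟨contMDiffAt_id, h x v w⟩

end Bilinear

/-! ### Condition (a): the conformal tractor bundle. -/

section TractorBundle

variable {n : ℕ} {M : Type*} [TopologicalSpace M] [ChartedSpace (EuclideanSpace ℝ (Fin n)) M]
  [IsManifold (𝓡 n) ∞ M]
  {g : ContMDiffRiemannianMetric (𝓡 n) ∞ (EuclideanSpace ℝ (Fin n))
      (TangentSpace (𝓡 n) : M → Type _)}
  {γ : ℝ → Π x : M, TangentSpace (𝓡 n) x →L[ℝ] TangentSpace (𝓡 n) x} {δ : ℝ}
  {u : C^∞⟮𝓡 n, M; ℝ⟯}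

theorem contMDiffAt_exp_comp (x : M) :
    ContMDiffAt (𝓡 n) 𝓘(ℝ, ℝ) ∞ (fun y ↦ Real.exp (u y)) x :=
  Real.contDiff_exp.contMDiff.contMDiffAt.comp x (u.contMDiff x)

theorem contMDiffAt_xi (hδ : 0 < δ) (x : M) :
    ContMDiffAt (𝓡 n) ((𝓡 n).prod 𝓘(ℝ, AmbientVec n)) ∞
      (fun y ↦ TotalSpace.mk' (AmbientVec n) y (xi hδ u y)) x :=
  contMDiffAt_pullback_iff.2 ⟨contMDiffAt_exp_comp x, contMDiffAt_const,
    Bundle.contMDiff_zeroSection ℝ (TangentSpace (𝓡 n) : M → Type _) x⟩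

theorem mem_ambientTractor_line {hδ : 0 < δ} {x : M} {v : AmbientPullback hδ u x} :
    v ∈ (ambientTractor g γ hδ u).line x ↔ compR x v = 0 ∧ compM x v = 0 := by
  constructor
  · intro h
    obtain ⟨c, rfl⟩ := Submodule.mem_span_singleton.1 h
    rw [xi_eq, map_smul, map_smul, compR_pullbackVec, compM_pullbackVec, smul_zero, smul_zero]
    exact ⟨rfl, rfl⟩
  · rintro ⟨h1, h2⟩
    refine Submodule.mem_span_singleton.2 ⟨compT x v / Real.exp (u x), ?_⟩
    refine pullback_ext ?_ ?_ ?_ <;> rw [xi_eq, map_smul]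
    · rw [compT_pullbackVec, smul_eq_mul, div_mul_cancel₀ _ (Real.exp_ne_zero _)]
    · rw [compR_pullbackVec, h1, smul_zero]
    · rw [compM_pullbackVec, h2, smul_zero]

/-- Pairing with `ξ^u` multiplies the `∂_r`-component by `e^{2u}` and ignores the other two. -/
theorem IsAdmissible.mem_ambientTractor_perp (hγ : IsAdmissible g γ δ) {x : M}
    {v : AmbientPullback hγ.delta_pos u x} :
    v ∈ (ambientTractor g γ hγ.delta_pos u).perp x ↔ compR x v = 0 := by
  have ht := Real.exp_ne_zero (u x)
  constructor
  · intro h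
    have h1 : (ambientTractor g γ hγ.delta_pos u).metric x (xi hγ.delta_pos u x) v = 0 :=
      h _ (Submodule.mem_span_singleton_self _)
    rw [hγ.ambientTractor_metric, xi_eq, compT_pullbackVec, compR_pullbackVec, compM_pullbackVec,
      map_zero] at h1
    simpa [ht] using h1
  · intro h l hl
    obtain ⟨h1, h2⟩ := mem_ambientTractor_line.1 hl
    rw [hγ.ambientTractor_metric, h1, h2, h, map_zero]
    simp

theorem IsAdmissible.ambientTractor_metric_symm (hγ : IsAdmissible g γ δ) (x : M)
    (v w : AmbientPullback hγ.delta_pos u x) :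
    (ambientTractor g γ hγ.delta_pos u).metric x v w =
      (ambientTractor g γ hγ.delta_pos u).metric x w v := by
  rw [hγ.ambientTractor_metric, hγ.ambientTractor_metric, g.symm x (compM x v)]
  ring

theorem finrank_ambientVec : Module.finrank ℝ (AmbientVec n) = n + 2 := by
  simp [AmbientVec, Module.finrank_prod]
  omega

theorem IsAdmissible.contMDiffAt_ambientTractor_metric (hγ : IsAdmissible g γ δ) (x : M)
    {σ τ : Π y : M, AmbientPullback hγ.delta_pos u y}
    (hσ : ContMDiffAt (𝓡 n) ((𝓡 n).prod 𝓘(ℝ, AmbientVec n)) ∞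
      (fun y ↦ TotalSpace.mk' (AmbientVec n) y (σ y)) x)
    (hτ : ContMDiffAt (𝓡 n) ((𝓡 n).prod 𝓘(ℝ, AmbientVec n)) ∞
      (fun y ↦ TotalSpace.mk' (AmbientVec n) y (τ y)) x) :
    ContMDiffAt (𝓡 n) 𝓘(ℝ, ℝ) ∞
      (fun y ↦ (ambientTractor g γ hγ.delta_pos u).metric y (σ y) (τ y)) x := by
  simp only [hγ.ambientTractor_metric]
  obtain ⟨h1, h2, h3⟩ := contMDiffAt_pullback_iff.1 hσ
  obtain ⟨h1', h2', h3'⟩ := contMDiffAt_pullback_iff.1 hτ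
  have h := contMDiffAt_exp_comp (u := u) x
  exact (h.mul ((h1.mul h2').add (h2.mul h1'))).add
    ((h.pow 2).mul (contMDiffAt_inner g le_rfl h3 h3'))

theorem IsAdmissible.ambientTractor_lorentzian (hγ : IsAdmissible g γ δ) (x : M) :
    ∃ b : Module.Basis (Fin (n + 2)) ℝ (AmbientPullback hγ.delta_pos u x), ∀ i j,
    (ambientTractor g γ hγ.delta_pos u).metric x (b i) (b j) =
      if i = j then (if i = 0 then -1 else 1) else 0 := by
  have : FiniteDimensional ℝ (TangentSpace (𝓡 n) x) :=
    inferInstanceAs (FiniteDimensional ℝ (EuclideanSpace ℝ (Fin n)))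
  have : FiniteDimensional ℝ (AmbientPullback hγ.delta_pos u x) :=
    inferInstanceAs (FiniteDimensional ℝ (AmbientVec n))
  have hn : Module.finrank ℝ (TangentSpace (𝓡 n) x) = n :=
    finrank_euclideanSpace_fin (𝕜 := ℝ) (n := n)
  have hn2 : Module.finrank ℝ (AmbientPullback hγ.delta_pos u x) = n + 2 := finrank_ambientVec
  let B : LinearMap.BilinForm ℝ (TangentSpace (𝓡 n) x) :=
    LinearMap.mk₂ ℝ (fun v w ↦ g.inner x v w) (by simp) (by simp) (by simp) (by simp)
  let B' : LinearMap.BilinForm ℝ (AmbientPullback hγ.delta_pos u x) :=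
    LinearMap.mk₂ ℝ (fun v w ↦ (ambientTractor g γ hγ.delta_pos u).metric x v w)
      (by simp) (by simp) (by simp) (by simp)
  obtain ⟨e, he⟩ := exists_orthonormal_basis hn B (fun v w ↦ g.symm x v w) (fun v hv ↦ g.pos x v hv)
  have he' : ∀ i j, g.inner x (e i) (e j) = if i = j then 1 else 0 := he
  set t := Real.exp (u x) with ht
  have htpos : 0 < t := Real.exp_pos _
  -- Since `∂_t` and `∂_r` are null with product `t`, the vectors `s (∂_t ∓ ∂_r)` have square
  -- `∓2ts²`, so `s = (2t)^{-1/2}` normalizes them. The remaining basis vectors are `e i / t`,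
  -- because the metric on the `M`-component is `t² g`.
  set s := (√(2 * t))⁻¹ with hs
  have hss : t * (s * s) = 1 / 2 := by
    rw [hs, ← mul_inv, Real.mul_self_sqrt (by positivity)]
    field_simp
  let f : Fin (n + 2) → AmbientPullback hγ.delta_pos u x :=
    Fin.cons (pullbackVec x s (-s) 0) (Fin.cons (pullbackVec x s s 0)
      fun i ↦ pullbackVec x 0 0 (t⁻¹ • e i))
  have hf : ∀ i j, (ambientTractor g γ hγ.delta_pos u).metric x (f i) (f j) =
      if i = j then (if i = 0 then -1 else 1) else 0 := by
    have h2 : t ^ 2 * (t⁻¹ * t⁻¹) = 1 := by field_simp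
    intro i j
    rw [hγ.ambientTractor_metric]
    refine Fin.cases ?_ (fun i ↦ Fin.cases ?_ (fun i ↦ ?_) i) i <;>
    refine Fin.cases ?_ (fun j ↦ Fin.cases ?_ (fun j ↦ ?_) j) j <;>
    simp only [f, Fin.cons_zero, Fin.cons_succ, compT_pullbackVec, compR_pullbackVec,
      compM_pullbackVec, map_zero, zero_apply, map_smul, smul_apply, smul_eq_mul, he', ← ht]
    · simp; linarith
    · simp
    · simp [Fin.ext_iff]
    · simp
    · simp; linarith
    · simp [Fin.ext_iff]
    · simp [Fin.ext_iff]
    · simp [Fin.ext_iff]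
    · by_cases hij : i = j
      · subst hij
        simp only [if_pos, mul_one, Fin.succ_ne_zero, if_false, mul_zero, add_zero, zero_add]
        exact h2
      · have h3 : i.succ.succ ≠ j.succ.succ := fun h ↦ hij (Fin.succ_injective _
          (Fin.succ_injective _ h))
        simp only [hij, h3, if_false, mul_zero, add_zero]
  have hli : LinearIndependent ℝ f := linearIndependent_of_apply_eq_ite B' (f := f)
    (ε := fun i ↦ if i = 0 then -1 else 1) (fun i ↦ by split_ifs <;> norm_num) hf
  refine ⟨basisOfLinearIndependentOfCardEqFinrank' f hli (by simp [hn2]), fun i j ↦ ?_⟩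
  simp [hf]

theorem IsAdmissible.isConformalTractorBundle (hγ : IsAdmissible g γ δ) :
    (ambientTractor g γ hγ.delta_pos u).IsConformalTractorBundle (AmbientVec n) n where
  rank_eq := finrank_ambientVec
  metric_smooth := contMDiff_bilin_of_extend fun x v w ↦ hγ.contMDiffAt_ambientTractor_metric x
    (FiberBundle.contMDiffAt_extend (𝓡 n) (AmbientVec n) v)
    (FiberBundle.contMDiffAt_extend (𝓡 n) (AmbientVec n) w)
  metric_symm := hγ.ambientTractor_metric_symm
  lorentzian := hγ.ambientTractor_lorentzian
  line_subbundle x := by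
    refine ⟨Set.univ, isOpen_univ, trivial, xi hγ.delta_pos u,
      fun y _ ↦ (contMDiffAt_xi hγ.delta_pos y).contMDiffWithinAt, fun y _ ↦ ⟨?_, ?_, rfl, rfl⟩⟩
    · intro h
      have h1 := congrArg (compT y) h
      rw [xi_eq, compT_pullbackVec, map_zero] at h1
      exact Real.exp_ne_zero _ h1
    · rw [hγ.ambientTractor_metric, xi_eq, compR_pullbackVec, compM_pullbackVec, map_zero]
      simp

end TractorBundle

end

end TractorGeometry

namespace TractorGeometry

noncomputable section

/-! ### Conditions (b) and (c): the tractor connection and the conformal class. -/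

section TractorConnection

variable {n : ℕ} {M : Type*} [TopologicalSpace M] [ChartedSpace (EuclideanSpace ℝ (Fin n)) M]
  [IsManifold (𝓡 n) ∞ M]
  {g : ContMDiffRiemannianMetric (𝓡 n) ∞ (EuclideanSpace ℝ (Fin n))
      (TangentSpace (𝓡 n) : M → Type _)}
  {γ : ℝ → Π x : M, TangentSpace (𝓡 n) x →L[ℝ] TangentSpace (𝓡 n) x} {δ : ℝ}
  {u : C^∞⟮𝓡 n, M; ℝ⟯}

theorem leviCivita_eq_zero {G : Π x : M, TangentSpace (𝓡 n) x →L[ℝ] TangentSpace (𝓡 n) x →L[ℝ] ℝ}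
    {σ : Π y : M, TangentSpace (𝓡 n) y} {x : M} (h : ∀ᶠ y in 𝓝 x, σ y = 0) :
    leviCivita (𝓡 n) G σ x = 0 := by
  rw [leviCivita_congr (τ := 0) h]
  exact isCovariantDerivativeOn_leviCivita.zero trivial

theorem IsAdmissible.ambientTractor_conn_add (hγ : IsAdmissible g γ δ)
    {σ σ' : Π y : M, AmbientPullback hγ.delta_pos u y} {x : M}
    (hσ : MDifferentiableAt (𝓡 n) ((𝓡 n).prod 𝓘(ℝ, AmbientVec n))
      (fun y ↦ TotalSpace.mk' (AmbientVec n) y (σ y)) x)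
    (hσ' : MDifferentiableAt (𝓡 n) ((𝓡 n).prod 𝓘(ℝ, AmbientVec n))
      (fun y ↦ TotalSpace.mk' (AmbientVec n) y (σ' y)) x) :
    (ambientTractor g γ hγ.delta_pos u).conn (σ + σ') x =
      (ambientTractor g γ hγ.delta_pos u).conn σ x +
        (ambientTractor g γ hγ.delta_pos u).conn σ' x := by
  ext v
  obtain ⟨h1, h2, h3⟩ := mdifferentiableAt_pullback_iff.1 hσ
  obtain ⟨h1', h2', h3'⟩ := mdifferentiableAt_pullback_iff.1 hσ'
  rw [add_apply, hγ.ambientTractor_conn_eq hσ, hγ.ambientTractor_conn_eq hσ',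
    hγ.ambientTractor_conn_eq (mdifferentiableAt_add_section hσ hσ')]
  have e1 : mvfderiv (𝓡 n) (fun y ↦ compT y ((σ + σ') y)) x v =
      mvfderiv (𝓡 n) (fun y ↦ compT y (σ y)) x v +
        mvfderiv (𝓡 n) (fun y ↦ compT y (σ' y)) x v := by
    simp only [Pi.add_apply, map_add]
    rw [mvfderiv_fun_add h1 h1', add_apply]
  have e2 : mvfderiv (𝓡 n) (fun y ↦ compR y ((σ + σ') y)) x v =
      mvfderiv (𝓡 n) (fun y ↦ compR y (σ y)) x v +
        mvfderiv (𝓡 n) (fun y ↦ compR y (σ' y)) x v := by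
    simp only [Pi.add_apply, map_add]
    rw [mvfderiv_fun_add h2 h2', add_apply]
  have e3 : leviCivita (𝓡 n) g.inner (fun y ↦ compM y ((σ + σ') y)) x v =
      leviCivita (𝓡 n) g.inner (fun y ↦ compM y (σ y)) x v +
      leviCivita (𝓡 n) g.inner (fun y ↦ compM y (σ' y)) x v := by
    rw [← add_apply, ← isCovariantDerivativeOn_leviCivita.add h3 h3']
    congr 2
  rw [e1, e2, e3]
  simp only [Pi.add_apply, map_add]
  refine pullback_ext ?_ ?_ ?_ <;>
  simp only [map_add, compT_pullbackVec, compR_pullbackVec, compM_pullbackVec]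
  · ring
  · ring
  · module

theorem IsAdmissible.ambientTractor_conn_smul (hγ : IsAdmissible g γ δ)
    {σ : Π y : M, AmbientPullback hγ.delta_pos u y} {f : M → ℝ} {x : M}
    (hσ : MDifferentiableAt (𝓡 n) ((𝓡 n).prod 𝓘(ℝ, AmbientVec n))
      (fun y ↦ TotalSpace.mk' (AmbientVec n) y (σ y)) x)
    (hf : MDifferentiableAt (𝓡 n) 𝓘(ℝ, ℝ) f x) :
    (ambientTractor g γ hγ.delta_pos u).conn (f • σ) x =
      f x • (ambientTractor g γ hγ.delta_pos u).conn σ x +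
        (mvfderiv (𝓡 n) f x).smulRight (σ x) := by
  ext v
  obtain ⟨h1, h2, h3⟩ := mdifferentiableAt_pullback_iff.1 hσ
  rw [add_apply, smul_apply, ContinuousLinearMap.smulRight_apply, hγ.ambientTractor_conn_eq hσ,
    hγ.ambientTractor_conn_eq (hf.smul_section hσ)]
  have e1 : mvfderiv (𝓡 n) (fun y ↦ compT y ((f • σ) y)) x v =
      f x * mvfderiv (𝓡 n) (fun y ↦ compT y (σ y)) x v +
        mvfderiv (𝓡 n) f x v * compT x (σ x) := by
    simp only [Pi.smul_apply', map_smul, smul_eq_mul]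
    rw [mvfderiv_fun_mul hf h1, add_apply, smul_apply, smul_apply, smul_eq_mul, smul_eq_mul,
      mul_comm (compT x (σ x))]
  have e2 : mvfderiv (𝓡 n) (fun y ↦ compR y ((f • σ) y)) x v =
      f x * mvfderiv (𝓡 n) (fun y ↦ compR y (σ y)) x v +
        mvfderiv (𝓡 n) f x v * compR x (σ x) := by
    simp only [Pi.smul_apply', map_smul, smul_eq_mul]
    rw [mvfderiv_fun_mul hf h2, add_apply, smul_apply, smul_apply, smul_eq_mul, smul_eq_mul,
      mul_comm (compR x (σ x))]
  have e3 : leviCivita (𝓡 n) g.inner (fun y ↦ compM y ((f • σ) y)) x v =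
      f x • leviCivita (𝓡 n) g.inner (fun y ↦ compM y (σ y)) x v +
      mvfderiv (𝓡 n) f x v • compM x (σ x) := by
    have h := congrArg (fun L ↦ L v) (isCovariantDerivativeOn_leviCivita.leibniz h3 hf
      (cov := leviCivita (𝓡 n) g.inner))
    rw [add_apply, smul_apply, ContinuousLinearMap.smulRight_apply] at h
    rw [← h]
    congr 2
  rw [e1, e2, e3]
  simp only [Pi.smul_apply', map_smul]
  refine pullback_ext ?_ ?_ ?_ <;>
  simp only [map_add, map_smul, compT_pullbackVec, compR_pullbackVec, compM_pullbackVec,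
    smul_eq_mul]
  · ring
  · ring
  · module

theorem IsAdmissible.isCovariantDerivativeOn_ambientTractor (hγ : IsAdmissible g γ δ) :
    IsCovariantDerivativeOn (AmbientVec n) (ambientTractor g γ hγ.delta_pos u).conn Set.univ where
  add hσ hσ' _ := hγ.ambientTractor_conn_add hσ hσ'
  leibniz hσ hf _ := hγ.ambientTractor_conn_smul hσ hf

/-- A section smooth at `x` is differentiable nearby, so the component formula holds near `x`, and
each of its terms is smooth. -/
theorem IsAdmissible.contMDiffAt_ambientTractor_conn (hγ : IsAdmissible g γ δ) {x : M}
    {σ : Π y : M, AmbientPullback hγ.delta_pos u y} {X : Π y : M, TangentSpace (𝓡 n) y}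
    (hσ : ContMDiffAt (𝓡 n) ((𝓡 n).prod 𝓘(ℝ, AmbientVec n)) ∞
      (fun y ↦ TotalSpace.mk' (AmbientVec n) y (σ y)) x)
    (hX : ContMDiffAt (𝓡 n) ((𝓡 n).prod 𝓘(ℝ, EuclideanSpace ℝ (Fin n))) ∞
      (fun y ↦ TotalSpace.mk' (EuclideanSpace ℝ (Fin n)) y (X y)) x) :
    ContMDiffAt (𝓡 n) ((𝓡 n).prod 𝓘(ℝ, AmbientVec n)) ∞
      (fun y ↦ TotalSpace.mk' (AmbientVec n) y
        ((ambientTractor g γ hγ.delta_pos u).conn σ y (X y))) x := by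
  obtain ⟨h1, h2, h3⟩ := contMDiffAt_pullback_iff.1 hσ
  have hu : ContMDiffAt (𝓡 n) 𝓘(ℝ, ℝ) ∞ u x := u.contMDiff x
  have he := contMDiffAt_exp_comp (u := u) x
  have hdu := contMDiffAt_mvfderiv_apply hu hX
  have key : ∀ᶠ y in 𝓝 x, (ambientTractor g γ hγ.delta_pos u).conn σ y (X y) = _ :=
    (eventually_mdifferentiableAt hσ).mono fun y hy ↦ hγ.ambientTractor_conn_eq hy (X y)
  refine contMDiffAt_pullback_iff.2 ⟨?_, ?_, ?_⟩
  · refine ContMDiffAt.congr_of_eventuallyEq ?_ (key.mono fun y hy ↦ (congrArg (compT y) hy))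
    exact (contMDiffAt_mvfderiv_apply h1 hX).sub
      ((he.div_const 2).mul (hγ.contMDiffAt_inner_gammaDot hX h3))
  · refine ContMDiffAt.congr_of_eventuallyEq ?_ (key.mono fun y hy ↦ (congrArg (compR y) hy))
    exact ((contMDiffAt_mvfderiv_apply h2 hX).add (hdu.mul h2)).sub
      (contMDiffAt_inner g le_rfl hX h3)
  · refine ContMDiffAt.congr_of_eventuallyEq ?_ (key.mono fun y hy ↦
      congrArg (TotalSpace.mk' (EuclideanSpace ℝ (Fin n)) y) (congrArg (compM y) hy))
    exact (((contMDiffAt_leviCivita_apply g h3 hX).add_section (hdu.smul_section h3)).add_section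
      ((h1.div₀ he (Real.exp_ne_zero _)).smul_section hX)).add_section
      ((h2.div_const 2).smul_section (hγ.contMDiffAt_gammaDot hX))

theorem IsAdmissible.contMDiffCovariantDerivativeOn_ambientTractor (hγ : IsAdmissible g γ δ) :
    ContMDiffCovariantDerivativeOn (AmbientVec n) ∞ (ambientTractor g γ hγ.delta_pos u).conn
      Set.univ where
  contMDiff {σ} hσ := by
    intro x _
    have h : ContMDiffAt (𝓡 n) ((𝓡 n).prod 𝓘(ℝ, AmbientVec n)) ∞
      (fun y ↦ TotalSpace.mk' (AmbientVec n) y (σ y)) x := (hσ x trivial).contMDiffAt (by simp)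
    exact (contMDiffAt_hom_of_extend fun w ↦ hγ.contMDiffAt_ambientTractor_conn h
      (FiberBundle.contMDiffAt_extend (𝓡 n) (EuclideanSpace ℝ (Fin n)) w)).contMDiffWithinAt

theorem mvfderiv_metric_expression {t a b a' b' q : M → ℝ} {x : M}
    (ht : MDifferentiableAt (𝓡 n) 𝓘(ℝ, ℝ) t x) (ha : MDifferentiableAt (𝓡 n) 𝓘(ℝ, ℝ) a x)
    (hb : MDifferentiableAt (𝓡 n) 𝓘(ℝ, ℝ) b x) (ha' : MDifferentiableAt (𝓡 n) 𝓘(ℝ, ℝ) a' x)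
    (hb' : MDifferentiableAt (𝓡 n) 𝓘(ℝ, ℝ) b' x) (hq : MDifferentiableAt (𝓡 n) 𝓘(ℝ, ℝ) q x)
    (v : TangentSpace (𝓡 n) x) :
    mvfderiv (𝓡 n) (fun y ↦ t y * (a y * b' y + b y * a' y) + t y ^ 2 * q y) x v =
      mvfderiv (𝓡 n) t x v * (a x * b' x + b x * a' x) +
      t x * (mvfderiv (𝓡 n) a x v * b' x + a x * mvfderiv (𝓡 n) b' x v +
        mvfderiv (𝓡 n) b x v * a' x + b x * mvfderiv (𝓡 n) a' x v) +
      2 * t x * mvfderiv (𝓡 n) t x v * q x + t x ^ 2 * mvfderiv (𝓡 n) q x v := by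
  have k1 : MDifferentiableAt (𝓡 n) 𝓘(ℝ, ℝ) (fun y ↦ a y * b' y) x := ha.mul hb'
  have k2 : MDifferentiableAt (𝓡 n) 𝓘(ℝ, ℝ) (fun y ↦ b y * a' y) x := hb.mul ha'
  have k3 : MDifferentiableAt (𝓡 n) 𝓘(ℝ, ℝ) (fun y ↦ a y * b' y + b y * a' y) x := k1.add k2
  have k4 : MDifferentiableAt (𝓡 n) 𝓘(ℝ, ℝ)
    (fun y ↦ t y * (a y * b' y + b y * a' y)) x := ht.mul k3
  have k5 : MDifferentiableAt (𝓡 n) 𝓘(ℝ, ℝ) (fun y ↦ t y * q y) x := ht.mul hq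
  have k6 : MDifferentiableAt (𝓡 n) 𝓘(ℝ, ℝ) (fun y ↦ t y * (t y * q y)) x := ht.mul k5
  simp only [sq, mul_assoc (t _)]
  rw [mvfderiv_fun_add k4 k6, mvfderiv_fun_mul ht k3, mvfderiv_fun_add k1 k2,
    mvfderiv_fun_mul ha hb', mvfderiv_fun_mul hb ha', mvfderiv_fun_mul ht k5,
    mvfderiv_fun_mul ht hq]
  simp only [add_apply, smul_apply, smul_eq_mul]
  ring

/-- In components, the `du` terms account for the derivatives of `e^u` and `e^{2u}`. The `γ̇(0)`
terms of the `∂_t`- and `TM`-components cancel each other, as do the `g(v, ·)` terms of the `∂_r`-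
and `TM`-components; the rest is metric compatibility on `M`. -/
theorem IsAdmissible.ambientTractor_metric_parallel (hγ : IsAdmissible g γ δ)
    {σ τ : Π y : M, AmbientPullback hγ.delta_pos u y} {x : M}
    (hσ : MDifferentiableAt (𝓡 n) ((𝓡 n).prod 𝓘(ℝ, AmbientVec n))
      (fun y ↦ TotalSpace.mk' (AmbientVec n) y (σ y)) x)
    (hτ : MDifferentiableAt (𝓡 n) ((𝓡 n).prod 𝓘(ℝ, AmbientVec n))
      (fun y ↦ TotalSpace.mk' (AmbientVec n) y (τ y)) x) (v : TangentSpace (𝓡 n) x) :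
    mvfderiv (𝓡 n) (fun y ↦ (ambientTractor g γ hγ.delta_pos u).metric y (σ y) (τ y)) x v =
      (ambientTractor g γ hγ.delta_pos u).metric x
        ((ambientTractor g γ hγ.delta_pos u).conn σ x v) (τ x) +
      (ambientTractor g γ hγ.delta_pos u).metric x (σ x)
        ((ambientTractor g γ hγ.delta_pos u).conn τ x v) := by
  obtain ⟨h1, h2, h3⟩ := mdifferentiableAt_pullback_iff.1 hσ
  obtain ⟨h1', h2', h3'⟩ := mdifferentiableAt_pullback_iff.1 hτ
  have he : MDifferentiableAt (𝓡 n) 𝓘(ℝ, ℝ) (fun y ↦ Real.exp (u y)) x :=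
    (contMDiffAt_exp_comp (u := u) x).mdifferentiableAt (by simp)
  simp only [hγ.ambientTractor_metric]
  rw [hγ.ambientTractor_conn_eq hσ, hγ.ambientTractor_conn_eq hτ,
    mvfderiv_metric_expression he h1 h2 h1' h2' (mdifferentiableAt_inner g h3 h3'),
    mvfderiv_exp_comp, mvfderiv_inner g h3 h3']
  simp only [compT_pullbackVec, compR_pullbackVec, compM_pullbackVec, map_add, map_smul,
    add_apply, smul_apply, smul_eq_mul]
  rw [g.symm x (compM x (σ x)) v, g.symm x (compM x (σ x)) (gammaDot γ x v)]
  have ht := Real.exp_ne_zero (u x)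
  generalize Real.exp (u x) = t at ht
  field_simp
  ring

theorem IsLineSectionOn.eventually {hδ : 0 < δ} {U : Set M}
    {s : Π y : M, AmbientPullback hδ u y} (hU : IsOpen U)
    (hs : (ambientTractor g γ hδ u).IsLineSectionOn (AmbientVec n) s U) {x : M} (hx : x ∈ U) :
    ∀ᶠ y in 𝓝 x, compR y (s y) = 0 ∧ compM y (s y) = 0 :=
  Filter.eventually_of_mem (hU.mem_nhds hx) fun y hy ↦ mem_ambientTractor_line.1 (hs.2 y hy)

/-- The derivative of a section of the line bundle. -/
theorem IsAdmissible.ambientTractor_conn_line (hγ : IsAdmissible g γ δ) {U : Set M}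
    {s : Π y : M, AmbientPullback hγ.delta_pos u y} (hU : IsOpen U)
    (hs : (ambientTractor g γ hγ.delta_pos u).IsLineSectionOn (AmbientVec n) s U) {x : M}
    (hx : x ∈ U) (v : TangentSpace (𝓡 n) x) :
    (ambientTractor g γ hγ.delta_pos u).conn s x v =
      pullbackVec x (mvfderiv (𝓡 n) (fun y ↦ compT y (s y)) x v) 0
        ((compT x (s x) / Real.exp (u x)) • v) := by
  have hev := IsLineSectionOn.eventually hU hs hx
  have hsx : ContMDiffAt (𝓡 n) ((𝓡 n).prod 𝓘(ℝ, AmbientVec n)) ∞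
    (fun y ↦ TotalSpace.mk' (AmbientVec n) y (s y)) x := hs.1.contMDiffAt (hU.mem_nhds hx)
  have h0 : mvfderiv (𝓡 n) (fun y ↦ compR y (s y)) x v = 0 := by
    rw [mvfderiv_congr (g := fun _ ↦ (0 : ℝ)) (hev.mono fun y hy ↦ hy.1), mvfderiv_const]
    rfl
  rw [hγ.ambientTractor_conn_eq (hsx.mdifferentiableAt (by simp)), h0,
    leviCivita_eq_zero (hev.mono fun y hy ↦ hy.2), hev.self_of_nhds.1, hev.self_of_nhds.2]
  simp

theorem IsAdmissible.mkQ_ambientTractor_conn_line (hγ : IsAdmissible g γ δ) {U : Set M}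
    {s : Π y : M, AmbientPullback hγ.delta_pos u y} (hU : IsOpen U)
    (hs : (ambientTractor g γ hγ.delta_pos u).IsLineSectionOn (AmbientVec n) s U) {x : M}
    (hx : x ∈ U) (v : TangentSpace (𝓡 n) x) :
    ((ambientTractor g γ hγ.delta_pos u).line x).mkQ
      ((ambientTractor g γ hγ.delta_pos u).conn s x v) =
    ((ambientTractor g γ hγ.delta_pos u).line x).mkQ
      (pullbackVec x 0 0 ((compT x (s x) / Real.exp (u x)) • v)) := by
  rw [Submodule.mkQ_apply, Submodule.mkQ_apply, Submodule.Quotient.eq,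
    hγ.ambientTractor_conn_line hU hs hx, mem_ambientTractor_line]
  simp

/-- The map `β` of the ambient tractor bundle. -/
def ambientBeta (g : ContMDiffRiemannianMetric (𝓡 n) ∞ (EuclideanSpace ℝ (Fin n))
      (TangentSpace (𝓡 n) : M → Type _))
    (γ : ℝ → Π x : M, TangentSpace (𝓡 n) x →L[ℝ] TangentSpace (𝓡 n) x)
    (hδ : 0 < δ) (u : C^∞⟮𝓡 n, M; ℝ⟯) (x : M) : TangentSpace (𝓡 n) x →ₗ[ℝ]
      ((ambientTractor g γ hδ u).line x →ₗ[ℝ]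
        AmbientPullback hδ u x ⧸ (ambientTractor g γ hδ u).line x) :=
  LinearMap.mk₂ ℝ (fun v l ↦ ((ambientTractor g γ hδ u).line x).mkQ
      (pullbackVec x 0 0 ((compT x l.1 / Real.exp (u x)) • v)))
    (fun v v' l ↦ by
      rw [← map_add]
      congr 1
      refine pullback_ext ?_ ?_ ?_ <;> simp)
    (fun c v l ↦ by
      rw [← map_smul]
      congr 1
      refine pullback_ext ?_ ?_ ?_ <;> simp [smul_smul, mul_comm])
    (fun v l l' ↦ by
      rw [← map_add]
      congr 1
      refine pullback_ext ?_ ?_ ?_ <;> simp [add_div, add_smul])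
    (fun c v l ↦ by
      rw [← map_smul]
      congr 1
      refine pullback_ext ?_ ?_ ?_ <;> simp [smul_smul, mul_div_assoc])

theorem ambientBeta_apply {hδ : 0 < δ} (x : M) (v : TangentSpace (𝓡 n) x)
    (l : (ambientTractor g γ hδ u).line x) :
    ambientBeta g γ hδ u x v l = ((ambientTractor g γ hδ u).line x).mkQ
      (pullbackVec x 0 0 ((compT x l.1 / Real.exp (u x)) • v)) := rfl

theorem IsAdmissible.isTractorConnection (hγ : IsAdmissible g γ δ) :
    (ambientTractor g γ hγ.delta_pos u).IsTractorConnection (AmbientVec n) where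
  isCovariantDerivative := hγ.isCovariantDerivativeOn_ambientTractor
  smooth := hγ.contMDiffCovariantDerivativeOn_ambientTractor
  metric_parallel _ _ _ hσ hτ := hγ.ambientTractor_metric_parallel hσ hτ
  beta_iso := by
    refine ⟨ambientBeta g γ hγ.delta_pos u, fun U s hU hs x hx v ↦
      (hγ.mkQ_ambientTractor_conn_line hU hs hx v).symm, fun x ↦ ?_⟩
    let ξ : (ambientTractor g γ hγ.delta_pos u).line x :=
      ⟨xi hγ.delta_pos u x, Submodule.mem_span_singleton_self _⟩
    have hξ : ∀ v, ambientBeta g γ hγ.delta_pos u x v ξ =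
        ((ambientTractor g γ hγ.delta_pos u).line x).mkQ (pullbackVec x 0 0 v) := by
      intro v
      rw [ambientBeta_apply]
      simp only [ξ]
      rw [xi_eq, compT_pullbackVec, div_self (Real.exp_ne_zero _), one_smul]
    refine ⟨(injective_iff_map_eq_zero _).2 fun v hv ↦ ?_, fun φ ↦ ⟨?_, fun hφ ↦ ?_⟩⟩
    · have h1 := hξ v
      rw [hv, LinearMap.zero_apply, eq_comm, Submodule.mkQ_apply,
        Submodule.Quotient.mk_eq_zero, mem_ambientTractor_line] at h1
      exact h1.2
    · rintro ⟨v, rfl⟩ l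
      rw [ambientBeta_apply]
      exact Submodule.mem_map_of_mem (hγ.mem_ambientTractor_perp.2 (compR_pullbackVec _ _ _ _))
    -- The line is spanned by `ξ^u`, so `φ` is determined by its value there. A lift `z` of this
    -- value lies in the orthogonal complement and equals its `M`-component modulo the line; that
    -- component is the preimage.
    · obtain ⟨z, hz, hzφ⟩ := hφ ξ
      refine ⟨compM x z, LinearMap.ext fun l ↦ ?_⟩
      obtain ⟨c, hc⟩ := Submodule.mem_span_singleton.1 l.2
      obtain rfl : l = c • ξ := Subtype.ext hc.symm
      rw [map_smul, map_smul, hξ, ← hzφ]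
      congr 1
      rw [Submodule.mkQ_apply, Submodule.mkQ_apply, Submodule.Quotient.eq,
        mem_ambientTractor_line]
      have hz' := hγ.mem_ambientTractor_perp.1 hz
      simp [hz']

theorem IsAdmissible.inducesConformalClass (hγ : IsAdmissible g γ δ) :
    (ambientTractor g γ hγ.delta_pos u).InducesConformalClass (AmbientVec n) g.inner := by
  intro U s hU hs hs0
  -- The `M`-component of `∇_v s` is `(s_t / e^u) v` and its `∂_r`-component vanishes. The factor
  -- `e^{2u}` of the metric therefore leaves `s_t²`, with `s_t` the `∂_t`-component of `s`.
  refine ⟨fun y ↦ compT y (s y) ^ 2, fun x hx ↦ ?_, fun x hx ↦ ⟨?_, fun v w ↦ ?_⟩⟩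
  · exact (((contMDiffAt_pullback_iff.1
      (hs.1.contMDiffAt (hU.mem_nhds hx))).1).pow 2).contMDiffWithinAt
  · obtain ⟨h1, h2⟩ := mem_ambientTractor_line.1 (hs.2 x hx)
    have h3 : compT x (s x) ≠ 0 := fun h ↦ hs0 x hx (pullback_ext (by simpa using h)
      (by simpa using h1) (by simpa using h2))
    positivity
  · rw [hγ.ambientTractor_conn_line hU hs hx, hγ.ambientTractor_conn_line hU hs hx,
      hγ.ambientTractor_metric]
    have ht := Real.exp_ne_zero (u x)
    simp only [compT_pullbackVec, compR_pullbackVec, compM_pullbackVec, map_smul, smul_apply,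
      smul_eq_mul]
    field_simp
    ring

end TractorConnection

end

end TractorGeometry

namespace TractorGeometry

noncomputable section

/-! ### The tractor curvature on the orthogonal complement of the line. -/

section TractorCurvature

variable {n : ℕ} {M : Type*} [TopologicalSpace M] [ChartedSpace (EuclideanSpace ℝ (Fin n)) M]
  [IsManifold (𝓡 n) ∞ M]
  {g : ContMDiffRiemannianMetric (𝓡 n) ∞ (EuclideanSpace ℝ (Fin n))
      (TangentSpace (𝓡 n) : M → Type _)}
  {γ : ℝ → Π x : M, TangentSpace (𝓡 n) x →L[ℝ] TangentSpace (𝓡 n) x} {δ : ℝ}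
  {u : C^∞⟮𝓡 n, M; ℝ⟯}

/-- The extension used by `curvature` is constant in the trivialization of the pullback bundle;
since that trivialization respects the splitting, its `M`-component is the coordinate extension on
`M`. -/
theorem eventually_extend_pullback {hδ : 0 < δ} {x : M} (s : AmbientPullback hδ u x) :
    ∀ᶠ y in 𝓝 x, FiberBundle.extend (AmbientVec n) s y = pullbackVec y (compT x s) (compR x s)
      (FiberBundle.extend (EuclideanSpace ℝ (Fin n)) (compM x s) y) := by
  filter_upwards [eventually_mem_tangentTriv (I := 𝓡 n) x,
    eventually_mem_baseSet (F := AmbientVec n) (V := AmbientPullback hδ u) x] with y hy hy'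
  have h1 := snd_trivializationAt_extend hy' s
  rw [← snd_trivializationAt_apply (FiberBundle.mem_baseSet_trivializationAt' x),
    snd_trivializationAt_pullback hy, snd_trivializationAt_pullback (mem_chart_source _ x),
    Prod.mk.injEq, Prod.mk.injEq] at h1
  obtain ⟨h2, h3, h4⟩ := h1
  refine pullback_ext h2 h3 ?_
  rw [compM_pullbackVec, extend_apply_of_mem hy, ← h4,
    Trivialization.symmL_continuousLinearMapAt _ hy]

/-- Obtained by differentiating the constant function `e^u · (a / e^u)`. -/
theorem mvfderiv_div_exp (a : ℝ) (x : M) (v : TangentSpace (𝓡 n) x) :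
    mvfderiv (𝓡 n) (fun y ↦ a / Real.exp (u y)) x v =
      -(a / Real.exp (u x) * mvfderiv (𝓡 n) u x v) := by
  have he : MDifferentiableAt (𝓡 n) 𝓘(ℝ, ℝ) (fun y ↦ Real.exp (u y)) x :=
    (contMDiffAt_exp_comp (u := u) x).mdifferentiableAt (by simp)
  have hd : MDifferentiableAt (𝓡 n) 𝓘(ℝ, ℝ) (fun y ↦ a / Real.exp (u y)) x :=
    (contMDiffAt_const.div₀ (contMDiffAt_exp_comp (u := u) x)
      (Real.exp_ne_zero _)).mdifferentiableAt (n := ∞) (by simp)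
  have h := mvfderiv_fun_mul he hd
  have h2 : (fun y ↦ Real.exp (u y) * (a / Real.exp (u y))) = fun _ : M ↦ a := by
    ext y
    rw [mul_div_cancel₀ _ (Real.exp_ne_zero _)]
  rw [h2, mvfderiv_const] at h
  have h3 := congrArg (fun L ↦ L v) h
  simp only [zero_apply, add_apply, smul_apply, smul_eq_mul] at h3
  rw [mvfderiv_exp_comp, ← mul_assoc, div_mul_cancel₀ _ (Real.exp_ne_zero _)] at h3
  have ht := Real.exp_ne_zero (u x)
  field_simp
  linarith

/-- The first derivative of the extension of a vector orthogonal to the line bundle. -/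
theorem IsAdmissible.eventually_ambientTractor_conn_extend (hγ : IsAdmissible g γ δ) {x : M}
    (s : AmbientPullback hγ.delta_pos u x) (hs : compR x s = 0) (w : TangentSpace (𝓡 n) x) :
    ∀ᶠ y in 𝓝 x, (ambientTractor g γ hγ.delta_pos u).conn
        (FiberBundle.extend (AmbientVec n) s) y (FiberBundle.extend (EuclideanSpace ℝ (Fin n)) w y) =
      pullbackVec y
        (-(Real.exp (u y) / 2 * g.inner y
          (gammaDot γ y (FiberBundle.extend (EuclideanSpace ℝ (Fin n)) w y))
          (FiberBundle.extend (EuclideanSpace ℝ (Fin n)) (compM x s) y)))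
        (-g.inner y (FiberBundle.extend (EuclideanSpace ℝ (Fin n)) w y)
          (FiberBundle.extend (EuclideanSpace ℝ (Fin n)) (compM x s) y))
        (leviCivita (𝓡 n) g.inner (FiberBundle.extend (EuclideanSpace ℝ (Fin n)) (compM x s)) y
            (FiberBundle.extend (EuclideanSpace ℝ (Fin n)) w y) +
          mvfderiv (𝓡 n) u y (FiberBundle.extend (EuclideanSpace ℝ (Fin n)) w y) •
            FiberBundle.extend (EuclideanSpace ℝ (Fin n)) (compM x s) y +
          (compT x s / Real.exp (u y)) • FiberBundle.extend (EuclideanSpace ℝ (Fin n)) w y) := by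
  filter_upwards [(eventually_extend_pullback s).eventually_nhds, eventually_mdifferentiableAt
    (FiberBundle.contMDiffAt_extend (k := ∞) (𝓡 n) (AmbientVec n) s)] with y hy hd
  rw [hγ.ambientTractor_conn_eq hd]
  have e1 : (fun q ↦ compT q (FiberBundle.extend (AmbientVec n) s q)) =ᶠ[𝓝 y] fun _ ↦ compT x s :=
    hy.mono fun q hq ↦ (congrArg (compT q) hq :)
  have e2 : (fun q ↦ compR q (FiberBundle.extend (AmbientVec n) s q)) =ᶠ[𝓝 y] fun _ ↦ compR x s :=
    hy.mono fun q hq ↦ (congrArg (compR q) hq :)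
  have e3 : ∀ᶠ q in 𝓝 y, compM q (FiberBundle.extend (AmbientVec n) s q) =
      FiberBundle.extend (EuclideanSpace ℝ (Fin n)) (compM x s) q :=
    hy.mono fun q hq ↦ congrArg (compM q) hq
  rw [mvfderiv_congr e1, mvfderiv_congr e2, leviCivita_congr e3, e3.self_of_nhds, mvfderiv_const,
    mvfderiv_const, show compT y (FiberBundle.extend (AmbientVec n) s y) = compT x s from
      e1.self_of_nhds, show compR y (FiberBundle.extend (AmbientVec n) s y) = compR x s from
      e2.self_of_nhds, hs]
  refine pullback_ext ?_ ?_ ?_ <;>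
  simp

section

variable (hγ : IsAdmissible g γ δ) {x : M} (s : AmbientPullback hγ.delta_pos u x)
  (hs : compR x s = 0) (v w : TangentSpace (𝓡 n) x)

include hs

/-- The second derivative is needed only in its `∂_r`- and `M`-components: the conditions on the
curvature are modulo the line, which is the `∂_t`-direction. -/
theorem IsAdmissible.compR_ambientTractor_conn_conn_extend :
    compR x ((ambientTractor g γ hγ.delta_pos u).conn
      (fun y ↦ (ambientTractor g γ hγ.delta_pos u).conn (FiberBundle.extend (AmbientVec n) s) y
        (FiberBundle.extend (EuclideanSpace ℝ (Fin n)) w y)) x v) =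
      -(g.inner x (leviCivita (𝓡 n) g.inner
          (FiberBundle.extend (EuclideanSpace ℝ (Fin n)) w) x v) (compM x s) +
        g.inner x w (leviCivita (𝓡 n) g.inner
          (FiberBundle.extend (EuclideanSpace ℝ (Fin n)) (compM x s)) x v)) -
      mvfderiv (𝓡 n) u x v * g.inner x w (compM x s) -
      g.inner x v (leviCivita (𝓡 n) g.inner
        (FiberBundle.extend (EuclideanSpace ℝ (Fin n)) (compM x s)) x w +
        mvfderiv (𝓡 n) u x w • compM x s + (compT x s / Real.exp (u x)) • w) := by
  have hS := FiberBundle.contMDiffAt_extend (k := ∞) (𝓡 n) (AmbientVec n) s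
  have hW := FiberBundle.contMDiffAt_extend (k := ∞) (𝓡 n) (EuclideanSpace ℝ (Fin n)) w
  have hZ := FiberBundle.contMDiffAt_extend (k := ∞) (𝓡 n) (EuclideanSpace ℝ (Fin n)) (compM x s)
  have hev := hγ.eventually_ambientTractor_conn_extend s hs w
  have e2 : (fun y ↦ compR y ((ambientTractor g γ hγ.delta_pos u).conn
      (FiberBundle.extend (AmbientVec n) s) y
      (FiberBundle.extend (EuclideanSpace ℝ (Fin n)) w y))) =ᶠ[𝓝 x] fun y ↦
      -g.inner y (FiberBundle.extend (EuclideanSpace ℝ (Fin n)) w y)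
          (FiberBundle.extend (EuclideanSpace ℝ (Fin n)) (compM x s) y) :=
    hev.mono fun y hy ↦ congrArg (compR y) hy
  rw [hγ.ambientTractor_conn_eq
    ((hγ.contMDiffAt_ambientTractor_conn hS hW).mdifferentiableAt (by simp)), mvfderiv_congr e2,
    mvfderiv_fun_neg, neg_apply, mvfderiv_inner g (hW.mdifferentiableAt (by simp))
      (hZ.mdifferentiableAt (by simp)), hev.self_of_nhds]
  simp only [compR_pullbackVec, compM_pullbackVec, FiberBundle.extend_apply_self]
  ring

theorem IsAdmissible.compM_ambientTractor_conn_conn_extend :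
    compM x ((ambientTractor g γ hγ.delta_pos u).conn
      (fun y ↦ (ambientTractor g γ hγ.delta_pos u).conn (FiberBundle.extend (AmbientVec n) s) y
        (FiberBundle.extend (EuclideanSpace ℝ (Fin n)) w y)) x v) =
      leviCivita (𝓡 n) g.inner (fun y ↦ leviCivita (𝓡 n) g.inner
        (FiberBundle.extend (EuclideanSpace ℝ (Fin n)) (compM x s)) y
        (FiberBundle.extend (EuclideanSpace ℝ (Fin n)) w y)) x v +
      mvfderiv (𝓡 n) (fun y ↦ mvfderiv (𝓡 n) u y
        (FiberBundle.extend (EuclideanSpace ℝ (Fin n)) w y)) x v • compM x s +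
      mvfderiv (𝓡 n) u x w • leviCivita (𝓡 n) g.inner
        (FiberBundle.extend (EuclideanSpace ℝ (Fin n)) (compM x s)) x v +
      (-(compT x s / Real.exp (u x) * mvfderiv (𝓡 n) u x v)) • w +
      (compT x s / Real.exp (u x)) • leviCivita (𝓡 n) g.inner
        (FiberBundle.extend (EuclideanSpace ℝ (Fin n)) w) x v +
      mvfderiv (𝓡 n) u x v • (leviCivita (𝓡 n) g.inner
        (FiberBundle.extend (EuclideanSpace ℝ (Fin n)) (compM x s)) x w +
        mvfderiv (𝓡 n) u x w • compM x s + (compT x s / Real.exp (u x)) • w) -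
      (g.inner x (gammaDot γ x w) (compM x s) / 2) • v -
      (g.inner x w (compM x s) / 2) • gammaDot γ x v := by
  have hS := FiberBundle.contMDiffAt_extend (k := ∞) (𝓡 n) (AmbientVec n) s
  have hW := FiberBundle.contMDiffAt_extend (k := ∞) (𝓡 n) (EuclideanSpace ℝ (Fin n)) w
  have hZ := FiberBundle.contMDiffAt_extend (k := ∞) (𝓡 n) (EuclideanSpace ℝ (Fin n)) (compM x s)
  have hWd := hW.mdifferentiableAt (by simp)
  have hZd := hZ.mdifferentiableAt (by simp)
  have hev := hγ.eventually_ambientTractor_conn_extend s hs w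
  let f : M → ℝ := fun y ↦ mvfderiv (𝓡 n) u y (FiberBundle.extend (EuclideanSpace ℝ (Fin n)) w y)
  let h : M → ℝ := fun y ↦ compT x s / Real.exp (u y)
  have hf : MDifferentiableAt (𝓡 n) 𝓘(ℝ, ℝ) f x :=
    (contMDiffAt_mvfderiv_apply (u.contMDiff x) hW).mdifferentiableAt (by simp)
  have hh : MDifferentiableAt (𝓡 n) 𝓘(ℝ, ℝ) h x :=
    (contMDiffAt_const.div₀ (contMDiffAt_exp_comp (u := u) x)
      (Real.exp_ne_zero _)).mdifferentiableAt (n := ∞) (by simp)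
  have hL := mdifferentiableAt_leviCivita_extend g (compM x s) w
  have e3 : ∀ᶠ y in 𝓝 x, compM y ((ambientTractor g γ hγ.delta_pos u).conn
      (FiberBundle.extend (AmbientVec n) s) y
      (FiberBundle.extend (EuclideanSpace ℝ (Fin n)) w y)) =
      (((fun y ↦ leviCivita (𝓡 n) g.inner
        (FiberBundle.extend (EuclideanSpace ℝ (Fin n)) (compM x s)) y
        (FiberBundle.extend (EuclideanSpace ℝ (Fin n)) w y)) +
        f • FiberBundle.extend (EuclideanSpace ℝ (Fin n)) (compM x s)) +
        h • FiberBundle.extend (EuclideanSpace ℝ (Fin n)) w) y :=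
    hev.mono fun y hy ↦ congrArg (compM y) hy
  have hc := isCovariantDerivativeOn_leviCivita (I := 𝓡 n) (G := g.inner)
  rw [hγ.ambientTractor_conn_eq
    ((hγ.contMDiffAt_ambientTractor_conn hS hW).mdifferentiableAt (by simp)), compM_pullbackVec,
    leviCivita_congr e3,
    hc.add (mdifferentiableAt_add_section hL (hf.smul_section hZd)) (hh.smul_section hWd),
    hc.add hL (hf.smul_section hZd), hc.leibniz hZd hf, hc.leibniz hWd hh, hev.self_of_nhds]
  simp only [add_apply, smul_apply, ContinuousLinearMap.smulRight_apply, compT_pullbackVec,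
    compR_pullbackVec, compM_pullbackVec, FiberBundle.extend_apply_self]
  rw [mvfderiv_div_exp]
  have ht := Real.exp_ne_zero (u x)
  have h1 : -(Real.exp (u x) / 2 * g.inner x (gammaDot γ x w) (compM x s)) / Real.exp (u x) =
      -(g.inner x (gammaDot γ x w) (compM x s) / 2) := by
    field_simp
  rw [h1]
  simp only [f, h, FiberBundle.extend_apply_self]
  module

/-- The `∂_r`-component of the second derivative is symmetric in `v` and `w`, by symmetry of `g` and
`∇_v W = ∇_w V` for the coordinate extensions. -/
theorem IsAdmissible.compR_ambientTractor_curvature :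
    compR x (curvature (𝓡 n) (AmbientVec n) (ambientTractor g γ hγ.delta_pos u).conn x v w s) =
      0 := by
  rw [curvature_eq, map_sub, hγ.compR_ambientTractor_conn_conn_extend s hs,
    hγ.compR_ambientTractor_conn_conn_extend s hs, leviCivita_extend_comm g x w v]
  simp only [map_add, map_smul, smul_eq_mul]
  rw [g.symm x v w]
  ring

/-- Every term with `du` either cancels or is symmetric in `v` and `w`, the second derivatives of
`u` because coordinate derivatives commute. What survives is the Riemann curvature and the terms
with `γ̇(0)`. -/
theorem IsAdmissible.compM_ambientTractor_curvature :
    compM x (curvature (𝓡 n) (AmbientVec n) (ambientTractor g γ hγ.delta_pos u).conn x v w s) =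
      riemann g x v w (compM x s) -
        (g.inner x (gammaDot γ x w) (compM x s) / 2) • v +
        (g.inner x (gammaDot γ x v) (compM x s) / 2) • w -
        (g.inner x w (compM x s) / 2) • gammaDot γ x v +
        (g.inner x v (compM x s) / 2) • gammaDot γ x w := by
  rw [curvature_eq, map_sub, hγ.compM_ambientTractor_conn_conn_extend s hs,
    hγ.compM_ambientTractor_conn_conn_extend s hs, leviCivita_extend_comm g x w v, riemann,
    curvature_eq, mvfderiv_mvfderiv_extend_comm ((u.contMDiff x).of_le (by norm_cast)) v w]
  module

end

end TractorCurvature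

end

end TractorGeometry

namespace TractorGeometry

noncomputable section

/-! ### Traces in the coordinate basis. -/

section CoordinateBasis

variable {n : ℕ} {M : Type*} [TopologicalSpace M] [ChartedSpace (EuclideanSpace ℝ (Fin n)) M]

/-- The basis of the tangent space given by the coordinate vectors. -/
def coordBasis (x : M) : Module.Basis (Fin n) ℝ (TangentSpace (𝓡 n) x) :=
  (EuclideanSpace.basisFun (Fin n) ℝ).toBasis

theorem coordBasis_apply (x : M) (i : Fin n) : coordBasis x i = coordVec x i := by
  have h : (EuclideanSpace.basisFun (Fin n) ℝ).toBasis i = EuclideanSpace.single i (1 : ℝ) := by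
    simp
  exact h

theorem coordBasis_repr (x : M) (v : TangentSpace (𝓡 n) x) (i : Fin n) :
    (coordBasis x).repr v i = coordComp x v i := rfl

theorem sum_coordComp_smul_coordVec (x : M) (v : TangentSpace (𝓡 n) x) :
    ∑ i, coordComp x v i • coordVec x i = v := by
  simpa only [coordBasis_repr, coordBasis_apply] using (coordBasis x).sum_repr v

theorem trace_eq_sum_coordComp (x : M) (A : TangentSpace (𝓡 n) x →ₗ[ℝ] TangentSpace (𝓡 n) x) :
    LinearMap.trace ℝ (TangentSpace (𝓡 n) x) A = ∑ i, coordComp x (A (coordVec x i)) i := by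
  rw [LinearMap.trace_eq_matrix_trace ℝ (coordBasis x), Matrix.trace]
  simp only [Matrix.diag, LinearMap.toMatrix_apply, coordBasis_repr, coordBasis_apply]

end CoordinateBasis

/-! ### Condition (d): the Ricci-type contraction. -/

section Normalization

variable {n : ℕ} {M : Type*} [TopologicalSpace M] [ChartedSpace (EuclideanSpace ℝ (Fin n)) M]
  [IsManifold (𝓡 n) ∞ M]
  (g : ContMDiffRiemannianMetric (𝓡 n) ∞ (EuclideanSpace ℝ (Fin n))
      (TangentSpace (𝓡 n) : M → Type _))
  (γ : ℝ → Π x : M, TangentSpace (𝓡 n) x →L[ℝ] TangentSpace (𝓡 n) x) {δ : ℝ}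
  {u : C^∞⟮𝓡 n, M; ℝ⟯}

/-- The endomorphism `v ↦ R(v, w) z`. -/
def riemannEnd (x : M) (w z : TangentSpace (𝓡 n) x) :
    TangentSpace (𝓡 n) x →ₗ[ℝ] TangentSpace (𝓡 n) x where
  toFun v := riemann g x v w z
  map_add' v v' := curvature_add_left g x v v' w z
  map_smul' c v := curvature_smul_left g x c v w z

theorem trace_riemannEnd (x : M) (w z : TangentSpace (𝓡 n) x) :
    LinearMap.trace ℝ (TangentSpace (𝓡 n) x) (riemannEnd g x w z) = ricci g x w z :=
  trace_eq_sum_coordComp x _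

/-- The functional `v ↦ g(v, z)`. -/
def innerRight (x : M) (z : TangentSpace (𝓡 n) x) : TangentSpace (𝓡 n) x →ₗ[ℝ] ℝ where
  toFun v := g.inner x v z
  map_add' v v' := by rw [map_add, add_apply]
  map_smul' c v := by rw [map_smul, smul_apply, RingHom.id_apply]

theorem innerRight_apply (x : M) (z v : TangentSpace (𝓡 n) x) :
    innerRight g x z v = g.inner x v z := rfl

/-- The endomorphism `v ↦ R(v, w) z` given by the curvature of the tractor connection, in terms of
the identification of `(T¹)^⊥ / T¹` with the tangent bundle. -/
def tractorEnd (x : M) (w z : TangentSpace (𝓡 n) x) :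
    TangentSpace (𝓡 n) x →ₗ[ℝ] TangentSpace (𝓡 n) x :=
  riemannEnd g x w z - (g.inner x (gammaDot γ x w) z / 2) • LinearMap.id +
    ((1 / 2 : ℝ) • innerRight g x z ∘ₗ (gammaDot γ x).toLinearMap).smulRight w -
    (g.inner x w z / 2) • (gammaDot γ x).toLinearMap +
    ((1 / 2 : ℝ) • innerRight g x z).smulRight (gammaDot γ x w)

theorem tractorEnd_apply (x : M) (v w z : TangentSpace (𝓡 n) x) :
    tractorEnd g γ x w z v = riemann g x v w z -
        (g.inner x (gammaDot γ x w) z / 2) • v +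
        (g.inner x (gammaDot γ x v) z / 2) • w -
        (g.inner x w z / 2) • gammaDot γ x v +
        (g.inner x v z / 2) • gammaDot γ x w := by
  have h1 : riemannEnd g x w z v = riemann g x v w z := rfl
  simp only [tractorEnd, LinearMap.add_apply, LinearMap.sub_apply, LinearMap.smul_apply,
    LinearMap.smulRight_apply, LinearMap.comp_apply, LinearMap.id_apply, h1, innerRight_apply,
    ContinuousLinearMap.coe_coe, smul_eq_mul, one_div_mul_eq_div]

/-- The identity has trace `n`, and each of the two rank-one terms has trace `g(γ̇ w, z) / 2`;
together they give the coefficient `-(n - 2) / 2`. -/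
theorem trace_tractorEnd (x : M) (w z : TangentSpace (𝓡 n) x) :
    LinearMap.trace ℝ (TangentSpace (𝓡 n) x) (tractorEnd g γ x w z) =
      ricci g x w z - ((n : ℝ) - 2) / 2 * g.inner x (gammaDot γ x w) z -
        LinearMap.trace ℝ (TangentSpace (𝓡 n) x) (gammaDot γ x).toLinearMap / 2 *
          g.inner x w z := by
  have : FiniteDimensional ℝ (TangentSpace (𝓡 n) x) :=
    inferInstanceAs (FiniteDimensional ℝ (EuclideanSpace ℝ (Fin n)))
  have hn : Module.finrank ℝ (TangentSpace (𝓡 n) x) = n :=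
    finrank_euclideanSpace_fin (𝕜 := ℝ) (n := n)
  rw [tractorEnd, map_add, map_sub, map_add, map_sub, map_smul, map_smul, trace_riemannEnd,
    LinearMap.trace_id, hn, LinearMap.trace_smulRight, LinearMap.trace_smulRight]
  simp only [LinearMap.smul_apply, LinearMap.comp_apply, ContinuousLinearMap.coe_coe,
    innerRight_apply, smul_eq_mul]
  ring

variable {g γ}

theorem IsAdmissible.ambientTractor_torsion_free (hγ : IsAdmissible g γ δ) (x : M)
    (v w : TangentSpace (𝓡 n) x) (l : AmbientPullback hγ.delta_pos u x)
    (hl : l ∈ (ambientTractor g γ hγ.delta_pos u).line x) :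
    curvature (𝓡 n) (AmbientVec n) (ambientTractor g γ hγ.delta_pos u).conn x v w l ∈
      (ambientTractor g γ hγ.delta_pos u).line x := by
  obtain ⟨h1, h2⟩ := mem_ambientTractor_line.1 hl
  have h3 : riemann g x v w 0 = 0 := by
    have h4 := curvature_smul_right g x 0 v w 0
    rwa [zero_smul, zero_smul] at h4
  refine mem_ambientTractor_line.2 ⟨hγ.compR_ambientTractor_curvature l h1 v w, ?_⟩
  rw [hγ.compM_ambientTractor_curvature l h1 v w, h2, h3]
  simp

theorem compT_ne_zero {hδ : 0 < δ} {x : M} {v : AmbientPullback hδ u x}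
    (hv : v ∈ (ambientTractor g γ hδ u).line x) (h0 : v ≠ 0) : compT x v ≠ 0 := by
  obtain ⟨h1, h2⟩ := mem_ambientTractor_line.1 hv
  exact fun h ↦ h0 (pullback_ext (by simpa using h) (by simpa using h1) (by simpa using h2))

theorem IsAdmissible.mkQ_ambientTractor_curvature_eq_iff (hγ : IsAdmissible g γ δ) {U : Set M}
    {s : Π y : M, AmbientPullback hγ.delta_pos u y} (hU : IsOpen U)
    (hs : (ambientTractor g γ hγ.delta_pos u).IsLineSectionOn (AmbientVec n) s U) {x : M}
    (hx : x ∈ U) {z : AmbientPullback hγ.delta_pos u x}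
    (hz : z ∈ (ambientTractor g γ hγ.delta_pos u).perp x) (v w v' : TangentSpace (𝓡 n) x) :
    ((ambientTractor g γ hγ.delta_pos u).line x).mkQ
        (curvature (𝓡 n) (AmbientVec n) (ambientTractor g γ hγ.delta_pos u).conn x v w z) =
      ((ambientTractor g γ hγ.delta_pos u).line x).mkQ
        ((ambientTractor g γ hγ.delta_pos u).conn s x v') ↔
    tractorEnd g γ x w (compM x z) v = (compT x (s x) / Real.exp (u x)) • v' := by
  have hz' := hγ.mem_ambientTractor_perp.1 hz
  rw [hγ.mkQ_ambientTractor_conn_line hU hs hx, Submodule.mkQ_apply, Submodule.mkQ_apply,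
    Submodule.Quotient.eq, mem_ambientTractor_line, map_sub, map_sub,
    hγ.compR_ambientTractor_curvature z hz', hγ.compM_ambientTractor_curvature z hz',
    tractorEnd_apply, compR_pullbackVec, compM_pullbackVec, sub_eq_zero (b := _ • _)]
  simp

theorem IsAdmissible.isNormalConnection_iff (hγ : IsAdmissible g γ δ) :
    (ambientTractor g γ hγ.delta_pos u).IsNormalConnection (AmbientVec n) ↔
      ∀ (x : M) (w z : TangentSpace (𝓡 n) x),
        LinearMap.trace ℝ (TangentSpace (𝓡 n) x) (tractorEnd g γ x w z) = 0 := by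
  constructor
  · intro h x w z
    have hxi : (ambientTractor g γ hγ.delta_pos u).IsLineSectionOn (AmbientVec n)
        (xi hγ.delta_pos u) Set.univ :=
      ⟨fun y _ ↦ (contMDiffAt_xi hγ.delta_pos y).contMDiffWithinAt,
        fun y _ ↦ Submodule.mem_span_singleton_self _⟩
    have hxi0 : xi hγ.delta_pos u x ≠ 0 := by
      intro h
      have h1 := congrArg (compT x) h
      rw [xi_eq, compT_pullbackVec, map_zero] at h1
      exact Real.exp_ne_zero _ h1
    have hz : (pullbackVec x 0 0 z : AmbientPullback hγ.delta_pos u x) ∈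
        (ambientTractor g γ hγ.delta_pos u).perp x :=
      hγ.mem_ambientTractor_perp.2 (compR_pullbackVec _ _ _ _)
    -- For `s = ξ^u` the identification of `TM` with the quotient carries no scalar factor, so `A`
    -- is `tractorEnd` itself.
    obtain ⟨A, hA, hA0⟩ := h.ricci_free Set.univ _ isOpen_univ hxi x trivial hxi0 w _ hz
    have h1 : tractorEnd g γ x w z = A := by
      ext v
      have h2 := (hγ.mkQ_ambientTractor_curvature_eq_iff isOpen_univ hxi trivial hz v w (A v)).1
        (hA v)
      rwa [compM_pullbackVec, xi_eq, compT_pullbackVec, div_self (Real.exp_ne_zero _),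
        one_smul] at h2
    rw [h1, hA0]
  · intro h
    refine ⟨hγ.ambientTractor_torsion_free, fun U s hU hs x hx hsx w z hz ↦ ?_⟩
    have hc : compT x (s x) / Real.exp (u x) ≠ 0 :=
      div_ne_zero (compT_ne_zero (hs.2 x hx) hsx) (Real.exp_ne_zero _)
    -- Another section scales the identification by `compT x (s x) / e^u`, so `A` is divided by this
    -- nonzero number and its trace still vanishes.
    refine ⟨(compT x (s x) / Real.exp (u x))⁻¹ • tractorEnd g γ x w (compM x z), fun v ↦ ?_, ?_⟩
    · refine (hγ.mkQ_ambientTractor_curvature_eq_iff hU hs hx hz v w _).2 ?_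
      rw [LinearMap.smul_apply, smul_smul, mul_inv_cancel₀ hc, one_smul]
    · rw [map_smul, h, smul_zero]

theorem IsAdmissible.isNormalConformalTractorBundle_iff (hγ : IsAdmissible g γ δ) :
    IsNormalConformalTractorBundle g (AmbientVec n) (ambientTractor g γ hγ.delta_pos u) ↔
      ∀ (x : M) (w z : TangentSpace (𝓡 n) x),
        ricci g x w z = ((n : ℝ) - 2) / 2 * g.inner x (gammaDot γ x w) z +
          LinearMap.trace ℝ (TangentSpace (𝓡 n) x) (gammaDot γ x).toLinearMap / 2 *
            g.inner x w z := by
  have h : IsNormalConformalTractorBundle g (AmbientVec n) (ambientTractor g γ hγ.delta_pos u) ↔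
      (ambientTractor g γ hγ.delta_pos u).IsNormalConnection (AmbientVec n) :=
    ⟨fun h ↦ h.normal, fun h ↦ ⟨hγ.isConformalTractorBundle, hγ.isTractorConnection,
      hγ.inducesConformalClass, h⟩⟩
  rw [h, hγ.isNormalConnection_iff]
  refine forall_congr' fun x ↦ forall_congr' fun w ↦ forall_congr' fun z ↦ ?_
  rw [trace_tractorEnd, sub_sub, sub_eq_zero]

end Normalization

end

end TractorGeometry

namespace TractorGeometry

noncomputable section

/-! ### Contraction with the inverse metric and the Schouten tensor. -/

section Contraction

variable {n : ℕ} {M : Type*} [TopologicalSpace M] [ChartedSpace (EuclideanSpace ℝ (Fin n)) M]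
  [IsManifold (𝓡 n) ∞ M]
  (g : ContMDiffRiemannianMetric (𝓡 n) ∞ (EuclideanSpace ℝ (Fin n))
      (TangentSpace (𝓡 n) : M → Type _))

/-- The Gram matrix of the coordinate vectors. -/
def gramMatrix (x : M) : Matrix (Fin n) (Fin n) ℝ :=
  Matrix.of fun i j ↦ g.inner x (coordVec x i) (coordVec x j)

theorem sum_smul_coordVec_inner (x : M) (c : Fin n → ℝ) (v : TangentSpace (𝓡 n) x) :
    g.inner x (∑ i, c i • coordVec x i) v = ∑ i, c i * g.inner x (coordVec x i) v := by
  have h := map_sum (innerRight g x v) (fun i ↦ c i • coordVec x i) Finset.univ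
  simpa only [map_smul, smul_eq_mul, innerRight_apply] using h

/-- A vector in the kernel gives a tangent vector orthogonal to all coordinate vectors, hence to
itself, and this vanishes by positivity. -/
theorem isUnit_gramMatrix (x : M) : IsUnit (gramMatrix g x) := by
  rw [← Matrix.mulVec_injective_iff_isUnit]
  refine (injective_iff_map_eq_zero (gramMatrix g x).mulVecLin).2 fun c hc ↦ ?_
  have h1 : ∀ i, g.inner x (∑ j, c j • coordVec x j) (coordVec x i) = 0 := by
    intro i
    have h := congrFun hc i
    rw [sum_smul_coordVec_inner, ← show (0 : Fin n → ℝ) i = 0 from rfl, ← h]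
    simp only [Matrix.mulVecLin_apply, Matrix.mulVec, dotProduct]
    refine Finset.sum_congr rfl fun j _ ↦ ?_
    rw [mul_comm, g.symm]
    rfl
  have h2 : ∑ j, c j • coordVec x j = 0 := by
    by_contra h
    refine (g.pos x _ h).ne' ?_
    rw [sum_smul_coordVec_inner]
    refine Finset.sum_eq_zero fun i _ ↦ ?_
    rw [g.symm, h1, mul_zero]
  have h3 : ∑ j, c j • coordBasis x j = 0 := by simpa only [coordBasis_apply] using h2
  exact funext fun i ↦ Fintype.linearIndependent_iff.1 (coordBasis x).linearIndependent c h3 i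

/-- Contracting `g(A·, ·)` with the inverse metric gives the trace of `A`. -/
theorem sum_gramMatrix_inv_mul_inner (x : M)
    (A : TangentSpace (𝓡 n) x →ₗ[ℝ] TangentSpace (𝓡 n) x) :
    ∑ i, ∑ j, (gramMatrix g x)⁻¹ i j * g.inner x (A (coordVec x i)) (coordVec x j) =
      LinearMap.trace ℝ (TangentSpace (𝓡 n) x) A := by
  set a : Matrix (Fin n) (Fin n) ℝ := Matrix.of fun k i ↦ coordComp x (A (coordVec x i)) k
    with ha
  have h1 : ∀ i j, g.inner x (A (coordVec x i)) (coordVec x j) = (gramMatrix g x * a) j i := by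
    intro i j
    conv_lhs => rw [← sum_coordComp_smul_coordVec x (A (coordVec x i)), sum_smul_coordVec_inner]
    rw [Matrix.mul_apply]
    refine Finset.sum_congr rfl fun k _ ↦ ?_
    rw [mul_comm, g.symm]
    rfl
  have h2 : (gramMatrix g x)⁻¹ * (gramMatrix g x * a) = a := by
    rw [← mul_assoc, Matrix.nonsing_inv_mul _ ((Matrix.isUnit_iff_isUnit_det _).1
      (isUnit_gramMatrix g x)), one_mul]
  rw [trace_eq_sum_coordComp]
  refine Finset.sum_congr rfl fun i _ ↦ ?_
  have h3 := congrFun (congrFun h2 i) i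
  rw [Matrix.mul_apply] at h3
  simp only [h1, h3]
  rfl

/-- The scalar curvature when the Ricci tensor is a combination of `g(A·, ·)` and `g`. -/
theorem scalarCurvature_of_ricci_eq (x : M)
    (A : TangentSpace (𝓡 n) x →ₗ[ℝ] TangentSpace (𝓡 n) x) (a b : ℝ)
    (h : ∀ w z, ricci g x w z = a * g.inner x (A w) z + b * g.inner x w z) :
    scalarCurvature g x = a * LinearMap.trace ℝ (TangentSpace (𝓡 n) x) A + b * n := by
  have : FiniteDimensional ℝ (TangentSpace (𝓡 n) x) :=
    inferInstanceAs (FiniteDimensional ℝ (EuclideanSpace ℝ (Fin n)))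
  have hn : Module.finrank ℝ (TangentSpace (𝓡 n) x) = n :=
    finrank_euclideanSpace_fin (𝕜 := ℝ) (n := n)
  have h1 := sum_gramMatrix_inv_mul_inner g x A
  have h2 := sum_gramMatrix_inv_mul_inner g x LinearMap.id
  rw [LinearMap.trace_id, hn] at h2
  rw [← h1, ← h2, Finset.mul_sum, Finset.mul_sum, ← Finset.sum_add_distrib]
  refine Finset.sum_congr rfl fun i _ ↦ ?_
  rw [Finset.mul_sum, Finset.mul_sum, ← Finset.sum_add_distrib]
  refine Finset.sum_congr rfl fun j _ ↦ ?_
  rw [h, LinearMap.id_apply]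
  change (gramMatrix g x)⁻¹ i j * _ = _
  ring

/-- Each of the two equations, once contracted, forces `S = (n - 1) trace A`, and under this
relation they are the same equation solved for `Ric` or for `A`. -/
theorem ricci_eq_iff_schouten (hn : 3 ≤ n) (x : M)
    (A : TangentSpace (𝓡 n) x →ₗ[ℝ] TangentSpace (𝓡 n) x) :
    (∀ w z, ricci g x w z = ((n : ℝ) - 2) / 2 * g.inner x (A w) z +
        LinearMap.trace ℝ (TangentSpace (𝓡 n) x) A / 2 * g.inner x w z) ↔
      ∀ w z, g.inner x (A w) z = 2 * schouten g x w z := by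
  have hn' : (3 : ℝ) ≤ n := by exact_mod_cast hn
  have h2 : (n : ℝ) - 2 ≠ 0 := by linarith
  have h1 : (n : ℝ) - 1 ≠ 0 := by linarith
  constructor
  · intro h w z
    rw [schouten, scalarCurvature_of_ricci_eq g x A _ _ h, h]
    field_simp
    ring
  · intro h
    have h3 : ∀ w z, ricci g x w z = ((n : ℝ) - 2) / 2 * g.inner x (A w) z +
        scalarCurvature g x / (2 * ((n : ℝ) - 1)) * g.inner x w z := by
      intro w z
      rw [h, schouten]
      field_simp
      ring
    have h4 := scalarCurvature_of_ricci_eq g x A _ _ h3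
    have h5 : scalarCurvature g x =
        ((n : ℝ) - 1) * LinearMap.trace ℝ (TangentSpace (𝓡 n) x) A := by
      field_simp at h4
      -- The contracted equation determines `S` only up to the factor `n - 2`, which is nonzero
      -- since `n ≥ 3`.
      refine mul_left_cancel₀ h2 ?_
      linear_combination h4
    intro w z
    rw [h3, h5]
    field_simp

end Contraction

/-! ### Surfaces: the Ricci tensor is `K g`. -/

section Surface

variable {M : Type*} [TopologicalSpace M] [ChartedSpace (EuclideanSpace ℝ (Fin 2)) M]
  [IsManifold (𝓡 2) ∞ M]
  (g : ContMDiffRiemannianMetric (𝓡 2) ∞ (EuclideanSpace ℝ (Fin 2))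
      (TangentSpace (𝓡 2) : M → Type _))

theorem coordVec_gram_det_pos (x : M) :
    0 < g.inner x (coordVec x 0) (coordVec x 0) * g.inner x (coordVec x 1) (coordVec x 1) -
      g.inner x (coordVec x 0) (coordVec x 1) ^ 2 := by
  have hE : 0 < g.inner x (coordVec x 0) (coordVec x 0) := by
    refine g.pos x _ ?_
    rw [← coordBasis_apply]
    exact (coordBasis x).ne_zero 0
  set E := g.inner x (coordVec x 0) (coordVec x 0) with hEd
  set F := g.inner x (coordVec x 0) (coordVec x 1) with hFd
  -- With `G = g(e₁, e₁)`, the vector `F e₀ - E e₁` has squared length `E (EG - F²)`, so positivity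
  -- of the metric gives that of the Gram determinant.
  have hne : F • coordVec (n := 2) x 0 - E • coordVec (n := 2) x 1 ≠ 0 := by
    intro h
    have h1 := congrArg (fun v ↦ (coordBasis x).repr v 1) h
    simp [← coordBasis_apply] at h1
    exact hE.ne' h1
  have h2 := g.pos x _ hne
  simp only [map_sub, map_smul, sub_apply, smul_apply, smul_eq_mul, ← hEd, ← hFd,
    g.symm x (coordVec x 1) (coordVec x 0)] at h2
  refine pos_of_mul_pos_right (a := E) ?_ hE.le
  linarith

/-- In dimension two every curvature operator is a multiple of `R(e₀, e₁)`, by antisymmetry. This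
operator is skew-adjoint for `g`, hence fixed by the single number `g(R(e₀, e₁) e₁, e₀)`, which also
defines `K`. -/
theorem ricci_eq_gaussCurvature_mul (x : M) (w z : TangentSpace (𝓡 2) x) :
    ricci g x w z = gaussCurvature g rfl x * g.inner x w z := by
  have hD := coordVec_gram_det_pos g x
  have hanti : ∀ v w z, riemann g x v w z = -riemann g x w v z := curvature_antisymm g x
  have hskew : ∀ z z', g.inner x (riemann g x (coordVec x 0) (coordVec x 1) z) z' =
      -g.inner x z (riemann g x (coordVec x 0) (coordVec x 1) z') :=
    inner_curvature_skew g x _ _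
  have hself : ∀ v z, riemann g x v v z = 0 := by
    intro v z
    have h : (2 : ℝ) • riemann g x v v z = 0 := by
      rw [two_smul]
      nth_rewrite 2 [hanti]
      exact add_neg_cancel _
    exact (smul_eq_zero.1 h).resolve_left two_ne_zero
  have hw : ∀ v, riemann g x v w z =
      coordComp x w 0 • riemann g x v (coordVec x 0) z +
        coordComp x w 1 • riemann g x v (coordVec x 1) z := by
    intro v
    have h := map_sum (riemannEnd g x v z) (fun i ↦ coordComp x w i • coordVec x i) Finset.univ
    rw [sum_coordComp_smul_coordVec, Fin.sum_univ_two, map_smul, map_smul] at h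
    change riemann g x w v z = coordComp x w 0 • riemann g x (coordVec x 0) v z +
      coordComp x w 1 • riemann g x (coordVec x 1) v z at h
    rw [hanti, h, hanti (coordVec x 0), hanti (coordVec x 1)]
    module
  have hK : gaussCurvature g rfl x =
      g.inner x (riemann g x (coordVec x 0) (coordVec x 1) (coordVec x 1)) (coordVec x 0) /
        (g.inner x (coordVec x 0) (coordVec x 0) * g.inner x (coordVec x 1) (coordVec x 1) -
          g.inner x (coordVec x 0) (coordVec x 1) ^ 2) := rfl
  have hexp : ∀ y v, g.inner x y v = coordComp x y 0 * g.inner x (coordVec x 0) v +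
      coordComp x y 1 * g.inner x (coordVec x 1) v := by
    intro y v
    have h := sum_smul_coordVec_inner g x (coordComp x y) v
    rwa [sum_coordComp_smul_coordVec, Fin.sum_univ_two] at h
  have hR : ricci g x w z =
      coordComp x w 1 * coordComp x (riemann g x (coordVec x 0) (coordVec x 1) z) 0 -
        coordComp x w 0 * coordComp x (riemann g x (coordVec x 0) (coordVec x 1) z) 1 := by
    rw [ricci, Fin.sum_univ_two, hw, hw, hself, hself, hanti (coordVec x 1) (coordVec x 0)]
    simp only [← coordBasis_repr, map_add, map_smul, map_neg, map_zero, Finsupp.add_apply,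
      Finsupp.smul_apply, Finsupp.neg_apply, Finsupp.zero_apply, smul_eq_mul]
    ring
  set y := riemann g x (coordVec x 0) (coordVec x 1) z with hy
  -- Skew-adjointness paired with `e₀` and `e₁` gives a linear system for the two coordinates of
  -- `y`, with the Gram matrix as coefficients.
  have h0 := hskew z (coordVec x 0)
  have h1 := hskew z (coordVec x 1)
  have h00 := hskew (coordVec x 0) (coordVec x 0)
  have h11 := hskew (coordVec x 1) (coordVec x 1)
  have h01 := hskew (coordVec x 0) (coordVec x 1)
  rw [← hy, hexp y, hexp z] at h0 h1
  rw [g.symm x (riemann g x (coordVec x 0) (coordVec x 1) (coordVec x 0)), self_eq_neg] at h00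
  rw [g.symm x (riemann g x (coordVec x 0) (coordVec x 1) (coordVec x 1)), self_eq_neg] at h11
  rw [g.symm x (riemann g x (coordVec x 0) (coordVec x 1) (coordVec x 0))] at h01
  rw [h00, h01] at h0
  rw [h11] at h1
  rw [hK, hR, g.symm x (riemann g x (coordVec x 0) (coordVec x 1) (coordVec x 1)), hexp w z,
    g.symm x (coordVec x 0) z, g.symm x (coordVec x 1) z, hexp z, hexp z,
    div_mul_eq_mul_div, eq_div_iff hD.ne']
  rw [g.symm x (coordVec x 1) (coordVec x 0)] at h0 ⊢
  generalize g.inner x (coordVec x 0) (coordVec x 0) = E at *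
  generalize g.inner x (coordVec x 0) (coordVec x 1) = F at *
  generalize g.inner x (coordVec x 1) (coordVec x 1) = G at *
  -- Cramer's rule: `G h0 - F h1` and `E h1 - F h0` yield the coordinates of `y` times the Gram
  -- determinant.
  linear_combination coordComp x w 1 * (G * h0 - F * h1) - coordComp x w 0 * (E * h1 - F * h0)

theorem ricci_eq_iff_gaussCurvature (x : M) (t : ℝ) :
    (∀ w z, ricci g x w z = t / 2 * g.inner x w z) ↔ t = 2 * gaussCurvature g rfl x := by
  constructor
  · intro h
    have h0 : coordVec (n := 2) x 0 ≠ 0 := by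
      rw [← coordBasis_apply]
      exact (coordBasis x).ne_zero 0
    have h1 := h (coordVec x 0) (coordVec x 0)
    rw [ricci_eq_gaussCurvature_mul] at h1
    have h2 := mul_right_cancel₀ (g.pos x _ h0).ne' h1
    linarith
  · rintro rfl w z
    rw [ricci_eq_gaussCurvature_mul]
    ring

end Surface

end

end TractorGeometry

theorem corollary1502948766 {n : ℕ} {M : Type*} [TopologicalSpace M] [T2Space M]
    [SecondCountableTopology M] [ChartedSpace (EuclideanSpace ℝ (Fin n)) M]
    [IsManifold (𝓡 n) ∞ M]
    (g : ContMDiffRiemannianMetric (𝓡 n) ∞ (EuclideanSpace ℝ (Fin n))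
      (TangentSpace (𝓡 n) : M → Type _))
    (γ : ℝ → Π x : M, TangentSpace (𝓡 n) x →L[ℝ] TangentSpace (𝓡 n) x) (δ : ℝ)
    (hγ : TractorGeometry.IsAdmissible g γ δ) (u : C^∞⟮𝓡 n, M; ℝ⟯) :
    (∀ hn : n = 2,
      (TractorGeometry.IsNormalConformalTractorBundle g (TractorGeometry.AmbientVec n)
          (TractorGeometry.associatedTractorBundle
            (TractorGeometry.ambientMetric (δ := δ) g γ)
            (TractorGeometry.immersion hγ.delta_pos u) (TractorGeometry.xi hγ.delta_pos u)) ↔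
        ∀ x : M, LinearMap.trace ℝ (TangentSpace (𝓡 n) x) (TractorGeometry.gammaDot γ x) =
          2 * TractorGeometry.gaussCurvature g hn x)) ∧
    (3 ≤ n →
      (TractorGeometry.IsNormalConformalTractorBundle g (TractorGeometry.AmbientVec n)
          (TractorGeometry.associatedTractorBundle
            (TractorGeometry.ambientMetric (δ := δ) g γ)
            (TractorGeometry.immersion hγ.delta_pos u) (TractorGeometry.xi hγ.delta_pos u)) ↔
        ∀ (x : M) (v w : TangentSpace (𝓡 n) x),
          g.inner x (TractorGeometry.gammaDot γ x v) w =
            2 * TractorGeometry.schouten g x v w)) := by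
  refine ⟨fun hn ↦ ?_, fun hn ↦ ?_⟩
  · subst hn
    refine hγ.isNormalConformalTractorBundle_iff.trans (forall_congr' fun x ↦ ?_)
    rw [← TractorGeometry.ricci_eq_iff_gaussCurvature]
    refine forall_congr' fun w ↦ forall_congr' fun z ↦ ?_
    -- For `n = 2` the coefficient `(n - 2) / 2` vanishes, so only the trace of `γ̇(0)` is
    -- constrained.
    norm_num
  · exact hγ.isNormalConformalTractorBundle_iff.trans (forall_congr' fun x ↦
      TractorGeometry.ricci_eq_iff_schouten g hn x (TractorGeometry.gammaDot γ x).toLinearMap)
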